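/- **Proposition 1 (Consistency).** Let $d\ge 2$ and let $\{(X_i,U_i)\}_{i\in\mathbb Z}$ be random variables with $X_i=(1,X_{i2}',Q_i)'\in\mathbb R^d$, $U_i\in\mathbb R$. Write $X_i(\tau)=(X_i',X_i'\mathbb 1\{Q_i>\tau\})'\in\mathbb R^{2d}$. For each sample size $n\ge1$ let $$Y_i=X_i(\tau_0)'\alpha_0+U_i,\qquad \alpha_0=(\beta_0',\delta_0')',\qquad \delta_0=d_0\,n^{-\varphi},$$ with $0\le\varphi<1/2$ and fixed $\beta_0$, $d_0\ne0$, $\tau_0$. Let $\Lambda\subset\mathbb R^{2d}$ and $\mathbb T\subset\mathbb R$ be compact with $\alpha_0\in\Lambda$ for all $n\ge1$ and $\tau_0\in\mathbb T$. Assume: * **C.** Writing $\delta_0=(\delta_{10},\delta_{20}',\delta_{30})'$ conformably with $X_i$: $\delta_{30}\ne0$, $\delta_{10}+\delta_{30}\tau_0=0$ and $\delta_{20}=0$. * **1.** $\{(X_i,U_i)\}$ is strictly stationary and ergodic, its $\rho$-mixing coefficients satisfy $\sum_{m\ge1}\rho_m^{1/2}<\infty$, and $E(U_i\mid\mathcal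 F_{i-1})=0$, where $\mathcal F_{i-1}$ is generated by $\{X_j\}_{j\le i}$ and $\{U_j\}_{j<i}$. With $\mathbf X_i=X_i(\tau_0)$, the matrices $M=E(\mathbf X_i\mathbf X_i')$ and $\Omega=E(\mathbf X_i\mathbf X_i'U_i^2)$ are positive definite; $E\|X_i\|^4<\infty$, $E\|X_iU_i\|^4<\infty$, and $E|U_i|^{4+\eta}<\infty$ for some $\eta>0$. * **2.** $Q_i$ has a density $f$, and there are versions of $f$ and of the conditional moments below (as functions of $\tau\in\mathbb R$) such that: $f(\tau)$, $D(\tau)=E(X_iX_i'\mid Q_i=\tau)$ and $V(\tau)=E(X_iX_i'U_i^2\mid Q_i=\tau)$ are continuous at $\tau_0$; at every $\tau\in\mathbb T$ the functions $f(\tau)$, $E(X_iX_i'\mathbb 1\{Q_i\le\tau\})$ and $\mathrm{Var}(X_{i2}\mid Q_i=\tau)$ are continuous and positive (positive definite); and $f(\tau)$, $E(\|X_i\|^4\mid Q_i=\tau)$, $E(\|X_iU_i\|^4\mid Q_i=\tau)$ are bounded on $\mathbb T$ by some $C<\infty$. Let $\mathbb S_n(\alpha,\tau)=\frac1n\sum_{i=1}^n(Y_i-X_i(\tau)'\alpha)^2$,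 and let $(\widehat\alpha,\widehat\tau)$ be the unrestricted least squares estimator in either of the following senses: 1. almost surely, for every $n\ge 1$, $(\widehat\alpha,\widehat\tau)$ is a minimizer of $\mathbb S_n$ over $\Lambda\times\mathbb T$; or 2. $\mathbb T$ contains $[\tau_0,\tau_0+\epsilon]$ or $[\tau_0-\epsilon,\tau_0]$ for some $\epsilon>0$ (as every nondegenerate interval containing $\tau_0$ does) and, almost surely, for every $n\ge1$ such that $\mathbb T_n=\mathbb T\cap\{Q_1,\dots,Q_n\}$ is non-empty, it is computed in two steps: $\widehat\alpha(\tau)$ minimizes $\mathbb S_n(\cdot,\tau)$ over $\Lambda$ for each $\tau\in\mathbb T_n$, $\widehat\tau$ minimizes $\mathbb S_n(\widehat\alpha(\tau),\tau)$ over $\tau\in\mathbb T_n$, and $\widehat\alpha=\widehat\alpha(\widehat\tau)$. Then, as $n\to\infty$, $$\widehat\alpha-\alpha_0=O_p\big(n^{-1/2}\big)\qquad\text{and}\qquad\widehat\tau-\tau_0=O_p\big(n^{(2\varphi-1)/3}\big).$$ -/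

import Mathlib

open MeasureTheory ProbabilityTheory Filter Topology

namespace KinkThreshold

noncomputable section

/-- Regressors `X = (1, X₂, Q)` and slope vectors `β`, `δ`, in `ℝ^d` with `d = p + 2`: coordinate
`0` is the constant, the last one belongs to the threshold variable `Q`, the `p = d - 2`
coordinates in between (those of the form `j.castSucc.succ`) belong to `X₂`. -/
abbrev Regr (p : ℕ) : Type := EuclideanSpace ℝ (Fin (p + 2))

/-- Vectors `α = (β', δ')'` and `X(τ) = (X', X' 𝟙{Q > τ})'` in `ℝ^{2d}`. -/
abbrev Coef (p : ℕ) : Type := EuclideanSpace ℝ (Fin (p + 2) ⊕ Fin (p + 2))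

/-- The threshold variable, i.e. the last regressor. -/
def thr {p : ℕ} (x : Regr p) : ℝ := x (Fin.last (p + 1))

/-- The `j`-th coordinate of `X₂`. -/
def mid {p : ℕ} (x : Regr p) (j : Fin p) : ℝ := x j.castSucc.succ

/-- The stacked vector `(β', δ')'`. -/
def stack {p : ℕ} (b c : Regr p) : Coef p := WithLp.toLp 2 (Sum.elim (fun j => b j) (fun j => c j))

open Classical in
/-- `X(τ) = (X', X' 𝟙{Q > τ})'`. -/
def regAt {p : ℕ} (x : Regr p) (τ : ℝ) : Coef p := stack x (if thr x > τ then x else 0)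

/-- The threshold effect `δ₀ = d₀ n^{-φ}` at sample size `n`. -/
def effect {p : ℕ} (d₀ : Regr p) (φ : ℝ) (n : ℕ) : Regr p := ((n : ℝ) ^ (-φ)) • d₀

/-- The response `Y = X(τ)' α + U`. -/
def response {p : ℕ} (α : Coef p) (τ : ℝ) (x : Regr p) (u : ℝ) : ℝ := inner ℝ (regAt x τ) α + u

/-- The objective `S_n(α, τ) = n⁻¹ ∑_{i=1}^n (Y_i - X_i(τ)' α)²` for a sample `(x_i, y_i)`. -/
def objective {p : ℕ} (n : ℕ) (x : ℤ → Regr p) (y : ℤ → ℝ) (α : Coef p) (τ : ℝ) : ℝ :=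
  (1 / (n : ℝ)) * ∑ i ∈ Finset.Icc (1 : ℤ) n, (y i - inner ℝ (regAt (x i) τ) α) ^ 2

/-- `(α, τ)` is a minimizer of `S_n` over `Λ × T`. -/
def IsLSE {p : ℕ} (Λ : Set (Coef p)) (T : Set ℝ) (n : ℕ) (x : ℤ → Regr p) (y : ℤ → ℝ)
    (α : Coef p) (τ : ℝ) : Prop :=
  α ∈ Λ ∧ τ ∈ T ∧ ∀ a ∈ Λ, ∀ t ∈ T, objective n x y α τ ≤ objective n x y a t

/-- The discretized threshold space `T_n = T ∩ {Q_1, …, Q_n}`. -/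
def grid {p : ℕ} (T : Set ℝ) (n : ℕ) (x : ℤ → Regr p) : Set ℝ :=
  {t | t ∈ T ∧ ∃ i : ℤ, 1 ≤ i ∧ i ≤ n ∧ t = thr (x i)}

/-- The two-step computation: for every `t ∈ T_n` let `a t` minimize `S_n(·, t)` over `Λ`, let `τ`
minimize the profiled objective `t ↦ S_n(a t, t)` over `T_n`, and put `α = a τ`. -/
def IsTwoStepLSE {p : ℕ} (Λ : Set (Coef p)) (T : Set ℝ) (n : ℕ) (x : ℤ → Regr p) (y : ℤ → ℝ)
    (α : Coef p) (τ : ℝ) : Prop :=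
  ∃ a : ℝ → Coef p,
    (∀ t ∈ grid T n x, a t ∈ Λ ∧ ∀ c ∈ Λ, objective n x y (a t) t ≤ objective n x y c t) ∧
    τ ∈ grid T n x ∧
    (∀ t ∈ grid T n x, objective n x y (a τ) τ ≤ objective n x y (a t) t) ∧
    α = a τ

/-- The continuity (kink) restriction: `δ₃ ≠ 0`, `δ₁ + δ₃ τ = 0`, `δ₂ = 0`. -/
def ContinuityRestriction {p : ℕ} (c : Regr p) (τ : ℝ) : Prop :=
  thr c ≠ 0 ∧ c 0 + thr c * τ = 0 ∧ ∀ j : Fin p, mid c j = 0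

section Probability

variable {Ω : Type*} [MeasurableSpace Ω]

/-- The stochastic order `Z_n = O_p(r_n)`: for every `ε > 0` there is `C` with
`P(‖Z_n‖ > C r_n) ≤ ε` for all large `n`. -/
def IsBigOP {E : Type*} [Norm E] (μ : Measure Ω) (Z : ℕ → Ω → E) (r : ℕ → ℝ) : Prop :=
  ∀ ε : ℝ, 0 < ε → ∃ C : ℝ, ∀ᶠ n : ℕ in atTop, μ {ω | C * r n < ‖Z n ω‖} ≤ ENNReal.ofReal ε

/-- The maximal correlation of two σ-algebras: the supremum of `|Corr(Z, W)|` over square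
integrable `Z`, `W` measurable for the first and second one. (A constant variable contributes the
value `0`.) -/
def maxCorr (μ : Measure Ω) (m₁ m₂ : MeasurableSpace Ω) : ℝ :=
  sSup {c : ℝ | ∃ Z W : Ω → ℝ, Measurable[m₁] Z ∧ Measurable[m₂] W ∧ MemLp Z 2 μ ∧ MemLp W 2 μ ∧
    c = |cov[Z, W; μ]| / (Real.sqrt (Var[Z; μ]) * Real.sqrt (Var[W; μ]))}

/-- The σ-algebra generated by `(X_j, U_j)`, `j ∈ J`. -/
@[reducible] def sigmaOf {p : ℕ} (X : ℤ → Ω → Regr p) (U : ℤ → Ω → ℝ) (J : Set ℤ) : MeasurableSpace Ω :=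
  ⨆ j ∈ J, MeasurableSpace.comap (fun ω => (X j ω, U j ω)) inferInstance

/-- The `ρ`-mixing coefficient `ρ_m` of `(X_i, U_i)_{i ∈ ℤ}`. -/
def rhoMix {p : ℕ} (μ : Measure Ω) (X : ℤ → Ω → Regr p) (U : ℤ → Ω → ℝ) (m : ℕ) : ℝ :=
  ⨆ k : ℤ, maxCorr μ (sigmaOf X U (Set.Iic k)) (sigmaOf X U (Set.Ici (k + m)))

/-- The information `F_{i-1}` available before `U_i` is realized: it is generated by the regressors
`X_j`, `j ≤ i` (the regressor `X_i` is predetermined) and the errors `U_j`, `j < i`. -/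
@[reducible] def infoBefore {p : ℕ} (X : ℤ → Ω → Regr p) (U : ℤ → Ω → ℝ) (i : ℤ) : MeasurableSpace Ω :=
  (⨆ j ∈ Set.Iic i, MeasurableSpace.comap (X j) inferInstance) ⊔
    ⨆ j ∈ Set.Iio i, MeasurableSpace.comap (U j) inferInstance

/-- The path `(X_i, U_i)_{i ∈ ℤ}`. -/
def path {p : ℕ} (X : ℤ → Ω → Regr p) (U : ℤ → Ω → ℝ) (ω : Ω) : ℤ → Regr p × ℝ :=
  fun i => (X i ω, U i ω)

/-- The shift on two-sided sequences. -/
def shift {S : Type*} (z : ℤ → S) : ℤ → S := fun i => z (i + 1)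

/-- `M = E 𝐗 𝐗'` with `𝐗 = X(τ₀)`. -/
def matM {p : ℕ} (μ : Measure Ω) (X : ℤ → Ω → Regr p) (τ₀ : ℝ) :
    Matrix (Fin (p + 2) ⊕ Fin (p + 2)) (Fin (p + 2) ⊕ Fin (p + 2)) ℝ :=
  Matrix.of fun a b => ∫ ω, regAt (X 0 ω) τ₀ a * regAt (X 0 ω) τ₀ b ∂μ

/-- `Ω = E 𝐗 𝐗' U²` with `𝐗 = X(τ₀)`. -/
def matOmega {p : ℕ} (μ : Measure Ω) (X : ℤ → Ω → Regr p) (U : ℤ → Ω → ℝ) (τ₀ : ℝ) :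
    Matrix (Fin (p + 2) ⊕ Fin (p + 2)) (Fin (p + 2) ⊕ Fin (p + 2)) ℝ :=
  Matrix.of fun a b => ∫ ω, regAt (X 0 ω) τ₀ a * regAt (X 0 ω) τ₀ b * U 0 ω ^ 2 ∂μ

open Classical in
/-- `E (X X' 𝟙{Q ≤ τ})`. -/
def lowerMoment {p : ℕ} (μ : Measure Ω) (X : ℤ → Ω → Regr p) (τ : ℝ) :
    Matrix (Fin (p + 2)) (Fin (p + 2)) ℝ :=
  Matrix.of fun a b => ∫ ω, (if thr (X 0 ω) ≤ τ then X 0 ω a * X 0 ω b else 0) ∂μ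

/-- The assumption on the data generating process: strict stationarity and ergodicity of the
sequence `(X_i, U_i)` (`Ergodic` includes the invariance of the law under the shift), `ρ`-mixing,
martingale difference errors, rank conditions and moments. -/
structure DataAssumption {p : ℕ} (μ : Measure Ω) (X : ℤ → Ω → Regr p) (U : ℤ → Ω → ℝ)
    (τ₀ : ℝ) : Prop where
  measurable_X : ∀ i, Measurable (X i)
  measurable_U : ∀ i, Measurable (U i)
  stationary_ergodic : Ergodic shift (μ.map (path X U))
  rho_mixing : Summable fun m : ℕ => rhoMix μ X U (m + 1) ^ (1 / 2 : ℝ)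
  martingale_diff : ∀ i, μ[U i | infoBefore X U i] =ᵐ[μ] 0
  posDef_M : (matM μ X τ₀).PosDef
  posDef_Omega : (matOmega μ X U τ₀).PosDef
  moment_X : Integrable (fun ω => ‖X 0 ω‖ ^ 4) μ
  moment_XU : Integrable (fun ω => ‖U 0 ω • X 0 ω‖ ^ 4) μ
  moment_U : ∃ η : ℝ, 0 < η ∧ Integrable (fun ω => |U 0 ω| ^ (4 + η)) μ

/-- `h` is a version of `τ ↦ E(Z | q = τ)`. -/
def IsCondMean (μ : Measure Ω) (q Z : Ω → ℝ) (h : ℝ → ℝ) : Prop :=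
  Measurable h ∧ (fun ω => h (q ω)) =ᵐ[μ] μ[Z | MeasurableSpace.comap q inferInstance]

/-- `Z - E(Z | q)`. -/
def centered (μ : Measure Ω) (q Z : Ω → ℝ) (ω : Ω) : ℝ :=
  Z ω - (μ[Z | MeasurableSpace.comap q inferInstance]) ω

/-- `f` is a density of the real random variable `q`. -/
def IsDensity (μ : Measure Ω) (q : Ω → ℝ) (f : ℝ → ℝ) : Prop :=
  Measurable f ∧ (∀ t, 0 ≤ f t) ∧ μ.map q = volume.withDensity (fun t => ENNReal.ofReal (f t))

/-- The assumption on the distribution of the threshold variable: for suitable versions of the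
density `f` of `Q`, of `D(τ) = E(X X' | Q = τ)`, `V(τ) = E(X X' U² | Q = τ)`,
`S(τ) = Var(X₂ | Q = τ)`, `m₄(τ) = E(‖X‖⁴ | Q = τ)` and `u₄(τ) = E(‖X U‖⁴ | Q = τ)`, the listed
continuity, positivity and boundedness properties hold. -/
def ThresholdAssumption {p : ℕ} (μ : Measure Ω) (X : ℤ → Ω → Regr p) (U : ℤ → Ω → ℝ)
    (T : Set ℝ) (τ₀ : ℝ) : Prop :=
  ∃ (f : ℝ → ℝ) (D V : ℝ → Matrix (Fin (p + 2)) (Fin (p + 2)) ℝ)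
    (S : ℝ → Matrix (Fin p) (Fin p) ℝ) (m₄ u₄ : ℝ → ℝ),
    IsDensity μ (fun ω => thr (X 0 ω)) f ∧
    (∀ a b, IsCondMean μ (fun ω => thr (X 0 ω)) (fun ω => X 0 ω a * X 0 ω b)
      (fun τ => D τ a b)) ∧
    (∀ a b, IsCondMean μ (fun ω => thr (X 0 ω)) (fun ω => X 0 ω a * X 0 ω b * U 0 ω ^ 2)
      (fun τ => V τ a b)) ∧
    (∀ j k, IsCondMean μ (fun ω => thr (X 0 ω))
      (fun ω => centered μ (fun ω => thr (X 0 ω)) (fun ω => mid (X 0 ω) j) ω *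
        centered μ (fun ω => thr (X 0 ω)) (fun ω => mid (X 0 ω) k) ω)
      (fun τ => S τ j k)) ∧
    IsCondMean μ (fun ω => thr (X 0 ω)) (fun ω => ‖X 0 ω‖ ^ 4) m₄ ∧
    IsCondMean μ (fun ω => thr (X 0 ω)) (fun ω => ‖U 0 ω • X 0 ω‖ ^ 4) u₄ ∧
    (ContinuousAt f τ₀ ∧ ContinuousAt V τ₀ ∧ ContinuousAt D τ₀) ∧
    (∀ τ ∈ T, (0 < f τ ∧ ContinuousAt f τ) ∧
      ((lowerMoment μ X τ).PosDef ∧ ContinuousAt (lowerMoment μ X) τ) ∧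
      ((S τ).PosDef ∧ ContinuousAt S τ)) ∧
    ∃ C : ℝ, ∀ τ ∈ T, f τ ≤ C ∧ m₄ τ ≤ C ∧ u₄ τ ≤ C

end Probability

end

end KinkThreshold

namespace KinkThreshold

/-! ### Correlation bounds, ρ-mixing, stationarity and orthogonality of the errors -/

section Moments

variable {Ω : Type*} [MeasurableSpace Ω] {μ : Measure Ω}

/-! Let `b`, `c` be the errors in the two slope vectors and `κ = n^(-φ) * thr d₀`. The continuity
restriction says `X'δ₀ = κ (Q - τ₀)`, so the difference of the two fits is `fitGap`, and expanding
squares (`mul_objective_sub`) gives `n (S_n(α, τ) - S_n(α₀, τ₀)) = ∑ gap² - 2 ∑ U gap`. At the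
estimator this is at most a constant `A`. For a joint minimizer it is nonpositive. For the two-step
version the sample has a grid point within `h = n^((2φ-1)/3)` of `τ₀`, and moving the threshold
there costs only `O(1)` (`GoodSample.gap_le`).

Quadratic part. Below `min T` the gap is `X'b`, above `max T` it is `X'(b + c)`, and both regimes
have a positive definite second moment matrix; hence `∑ gap²` dominates `n (‖b‖² + ‖c‖²)`
(`GoodSample.slope_le`). Between `τ₀` and `τ` the gap is `±κ (Q - τ₀)` up to a slope term, and `E (Q
- τ₀)²` over an interval of length `t` at `τ₀` is of order `t³`; hence `∑ gap²` also dominates `n κ²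
|τ - τ₀|³` (`GoodSample.kink_le`, `GoodSample.kink_ge`).

Noise part. Cut `|τ - τ₀|` into dyadic scales `2^j h`. Uniformly over scale `j`, the sums of `U X`
over the observations between `τ₀` and `τ` are `O(2^j √(n h))`, and the kink contributes a further
factor `κ 2^j h` (`GoodSample.abs_noise_le`).

The choice of `h` makes `n κ² h³` constant. With `y² = n (‖b‖² + ‖c‖²)` and `z = 2^j` everything
reduces to `c (y² + z³) ≤ A + B (y + y √z + z²)`, which bounds `y` and `z`
(`bounds_of_cubic_inequality`). These are the two rates. The inequality is valid at all distances
inside `T`, so no preliminary consistency argument is needed.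

The probabilistic core is the maximal inequality `DataAssumption.exists_meas_noise_slab_le`. Partial
sums of `U ψ(X)` have conditionally centred increments, and ρ-mixing controls the dependence of
their squares, so `E S_n⁴ ≲ n² v² + n g`, where `v` and `g` are the second and fourth moments of one
term (`integral_partialSum_pow_four_le`). Chaining by bisecting the mass of `1 + ‖X U‖²` then gives
the supremum over `τ`. Laws of large numbers for the quadratic terms come from Chebyshev with mixing
variance bounds. -/

theorem abs_covariance_le_sqrt [IsProbabilityMeasure μ] {Z W : Ω → ℝ} (hZ : MemLp Z 2 μ)
    (hW : MemLp W 2 μ) :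
    |cov[Z, W; μ]| ≤ Real.sqrt (Var[Z; μ]) * Real.sqrt (Var[W; μ]) := by
  rw [← Real.sqrt_mul (variance_nonneg _ _)]
  apply Real.abs_le_sqrt
  -- The variance of `Z + t W` is a nonnegative quadratic in `t`, so its discriminant is
  -- nonpositive.
  have h : ∀ t : ℝ, 0 ≤ Var[W; μ] * (t * t) + 2 * cov[Z, W; μ] * t + Var[Z; μ] := by
    intro t
    have h1 := variance_add (μ := μ) hZ (hW.const_smul t)
    rw [covariance_smul_right, variance_smul] at h1
    nlinarith [variance_nonneg (Z + t • W) μ]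
  have := discrim_le_zero h
  rw [discrim] at this
  nlinarith

theorem abs_covariance_le_maxCorr {Ω : Type*} {m₁ m₂ : MeasurableSpace Ω} [MeasurableSpace Ω]
    {μ : Measure Ω} [IsProbabilityMeasure μ] {Z W : Ω → ℝ} (hZm : Measurable[m₁] Z)
    (hWm : Measurable[m₂] W)
    (hZ : MemLp Z 2 μ) (hW : MemLp W 2 μ) :
    |cov[Z, W; μ]| ≤ maxCorr μ m₁ m₂ * (Real.sqrt (Var[Z; μ]) * Real.sqrt (Var[W; μ])) := by
  have hb : BddAbove {c : ℝ | ∃ Z W : Ω → ℝ, Measurable[m₁] Z ∧ Measurable[m₂] W ∧ MemLp Z 2 μ ∧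
      MemLp W 2 μ ∧ c = |cov[Z, W; μ]| / (Real.sqrt (Var[Z; μ]) * Real.sqrt (Var[W; μ]))} := by
    refine ⟨1, ?_⟩
    rintro c ⟨Z, W, -, -, h1, h2, rfl⟩
    exact div_le_one_of_le₀ (abs_covariance_le_sqrt h1 h2) (by positivity)
  have h := le_csSup hb ⟨Z, W, hZm, hWm, hZ, hW, rfl⟩
  have h0 := abs_covariance_le_sqrt (μ := μ) hZ hW
  -- With a vanishing variance the quotient has the default value 0 and carries no information;
  -- Cauchy–Schwarz then forces the covariance itself to vanish.
  rcases eq_or_lt_of_le (show 0 ≤ Real.sqrt (Var[Z; μ]) * Real.sqrt (Var[W; μ]) by positivity)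
    with h1 | h1
  · rw [← h1] at h0 ⊢
    simpa using h0
  · exact (div_le_iff₀ h1).1 h

theorem maxCorr_nonneg {Ω : Type*} (m₁ m₂ : MeasurableSpace Ω) [MeasurableSpace Ω] (μ : Measure Ω) :
    0 ≤ maxCorr μ m₁ m₂ := by
  apply Real.sSup_nonneg
  rintro c ⟨Z, W, -, -, h1, h2, rfl⟩
  positivity

theorem maxCorr_le_one {Ω : Type*} (m₁ m₂ : MeasurableSpace Ω) [MeasurableSpace Ω] (μ : Measure Ω)
    [IsProbabilityMeasure μ] :
    maxCorr μ m₁ m₂ ≤ 1 := by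
  apply Real.sSup_le _ zero_le_one
  rintro c ⟨Z, W, -, -, h1, h2, rfl⟩
  exact div_le_one_of_le₀ (abs_covariance_le_sqrt h1 h2) (by positivity)

variable {p : ℕ} {X : ℤ → Ω → Regr p} {U : ℤ → Ω → ℝ}

theorem rhoMix_nonneg (μ : Measure Ω) (X : ℤ → Ω → Regr p) (U : ℤ → Ω → ℝ) (m : ℕ) :
    0 ≤ rhoMix μ X U m :=
  Real.iSup_nonneg fun _ => maxCorr_nonneg _ _ _

theorem rhoMix_le_one [IsProbabilityMeasure μ] (m : ℕ) : rhoMix μ X U m ≤ 1 :=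
  ciSup_le fun _ => maxCorr_le_one _ _ _

/-- Variances are replaced by raw second moments, which is the form in which mixing is used below.
Boundedness of the family over `k` has to be supplied, since an unbounded real supremum would have a
default value. -/
theorem abs_covariance_le_rhoMix [IsProbabilityMeasure μ] {Z W : Ω → ℝ} {k : ℤ} {m : ℕ}
    (hZm : Measurable[sigmaOf X U (Set.Iic k)] Z)
    (hWm : Measurable[sigmaOf X U (Set.Ici (k + m))] W) (hZ : MemLp Z 2 μ) (hW : MemLp W 2 μ) :
    |cov[Z, W; μ]| ≤ rhoMix μ X U m * (Real.sqrt (∫ ω, Z ω ^ 2 ∂μ) *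
      Real.sqrt (∫ ω, W ω ^ 2 ∂μ)) := by
  have hb : BddAbove (Set.range fun k : ℤ =>
      maxCorr μ (sigmaOf X U (Set.Iic k)) (sigmaOf X U (Set.Ici (k + m)))) := by
    refine ⟨1, ?_⟩
    rintro _ ⟨k, rfl⟩
    exact maxCorr_le_one _ _ _
  have hvar : ∀ {Z : Ω → ℝ}, MemLp Z 2 μ → Var[Z; μ] ≤ ∫ ω, Z ω ^ 2 ∂μ := fun h =>
    variance_le_expectation_sq h.1
  refine (abs_covariance_le_maxCorr hZm hWm hZ hW).trans ?_
  refine mul_le_mul (le_ciSup hb k) ?_ (by positivity) (rhoMix_nonneg _ _ _ _)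
  exact mul_le_mul (Real.sqrt_le_sqrt (hvar hZ)) (Real.sqrt_le_sqrt (hvar hW)) (by positivity)
    (by positivity)

theorem measurable_pair_sigmaOf {Ω : Type*} {X : ℤ → Ω → Regr p} {U : ℤ → Ω → ℝ} {J : Set ℤ}
    {j : ℤ} (hj : j ∈ J) :
    Measurable[sigmaOf X U J] fun ω => (X j ω, U j ω) := by
  refine Measurable.mono (comap_measurable _) ?_ le_rfl
  exact le_iSup₂_of_le j hj le_rfl

/-- Since `0 ≤ ρ ≤ 1`, `ρ ≤ ρ^(1/2)`. Only summability of the coefficients themselves is needed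
later. -/
theorem DataAssumption.summable_rhoMix [IsProbabilityMeasure μ] {τ₀ : ℝ}
    (h1 : DataAssumption μ X U τ₀) : Summable fun m : ℕ => rhoMix μ X U (m + 1) := by
  refine Summable.of_nonneg_of_le (fun m => rhoMix_nonneg _ _ _ _) (fun m => ?_) h1.rho_mixing
  have := Real.rpow_le_rpow_of_exponent_ge' (rhoMix_nonneg μ X U (m + 1))
    (rhoMix_le_one (μ := μ) (X := X) (U := U) (m + 1)) (by norm_num : (0 : ℝ) ≤ 1 / 2)
    (by norm_num : (1 / 2 : ℝ) ≤ 1)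
  simpa using this

/-- The distribution of `(X_0, U_0)`. -/
noncomputable def margin (μ : Measure Ω) (X : ℤ → Ω → Regr p) (U : ℤ → Ω → ℝ) :
    Measure (Regr p × ℝ) :=
  μ.map fun ω => (X 0 ω, U 0 ω)

theorem DataAssumption.measurable_pair {τ₀ : ℝ} (h1 : DataAssumption μ X U τ₀) (i : ℤ) :
    Measurable fun ω => (X i ω, U i ω) :=
  (h1.measurable_X i).prodMk (h1.measurable_U i)

/-- Projecting the shift-invariant path law to one coordinate identifies the laws at `i` and `i +
1`; induction in both directions does the rest. This moves all one-observation expectations to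
`margin`. -/
theorem DataAssumption.map_pair {τ₀ : ℝ} (h1 : DataAssumption μ X U τ₀) (i : ℤ) :
    μ.map (fun ω => (X i ω, U i ω)) = margin μ X U := by
  have hp : Measurable (path X U) := measurable_pi_lambda _ h1.measurable_pair
  have hsm : Measurable (shift : (ℤ → Regr p × ℝ) → _) :=
    measurable_pi_lambda _ fun i => measurable_pi_apply _
  have hstep : ∀ i : ℤ, μ.map (fun ω => (X (i + 1) ω, U (i + 1) ω)) =
      μ.map (fun ω => (X i ω, U i ω)) := by
    intro i
    have h := h1.stationary_ergodic.map_eq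
    have h2 := congrArg (fun ν => Measure.map (fun z : ℤ → Regr p × ℝ => z i) ν) h
    rw [Measure.map_map (measurable_pi_apply i) hsm,
      Measure.map_map ((measurable_pi_apply i).comp hsm) hp,
      Measure.map_map (measurable_pi_apply i) hp] at h2
    exact h2
  have hall : ∀ i : ℤ, μ.map (fun ω => (X i ω, U i ω)) = μ.map (fun ω => (X 0 ω, U 0 ω)) := by
    intro i
    induction i using Int.induction_on with
    | zero => rfl
    | succ i hi => rw [hstep, hi]
    | pred i hi => rw [← hi, ← hstep (-(i : ℤ) - 1)]; simp
  exact hall i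

theorem DataAssumption.integral_pair {τ₀ : ℝ} (h1 : DataAssumption μ X U τ₀)
    {g : Regr p × ℝ → ℝ} (hg : Measurable g) (i : ℤ) :
    ∫ ω, g (X i ω, U i ω) ∂μ = ∫ z, g z ∂(margin μ X U) := by
  rw [← h1.map_pair i, integral_map (h1.measurable_pair i).aemeasurable
    hg.aestronglyMeasurable]

theorem DataAssumption.integrable_pair {τ₀ : ℝ} (h1 : DataAssumption μ X U τ₀)
    {g : Regr p × ℝ → ℝ} (hg : Measurable g) (i : ℤ) :
    Integrable (fun ω => g (X i ω, U i ω)) μ ↔ Integrable g (margin μ X U) := by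
  rw [← h1.map_pair i, integrable_map_measure hg.aestronglyMeasurable
    (h1.measurable_pair i).aemeasurable]
  rfl

theorem DataAssumption.memLp_pair {τ₀ : ℝ} (h1 : DataAssumption μ X U τ₀)
    {g : Regr p × ℝ → ℝ} (hg : Measurable g) (i : ℤ) (q : ENNReal) :
    MemLp (fun ω => g (X i ω, U i ω)) q μ ↔ MemLp g q (margin μ X U) := by
  rw [← h1.map_pair i, memLp_map_measure_iff hg.aestronglyMeasurable
    (h1.measurable_pair i).aemeasurable]
  rfl

theorem DataAssumption.isProbabilityMeasure_margin [IsProbabilityMeasure μ] {τ₀ : ℝ}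
    (h1 : DataAssumption μ X U τ₀) : IsProbabilityMeasure (margin μ X U) :=
  Measure.isProbabilityMeasure_map (h1.measurable_pair 0).aemeasurable

theorem DataAssumption.infoBefore_le {τ₀ : ℝ} (h1 : DataAssumption μ X U τ₀) (i : ℤ) :
    infoBefore X U i ≤ (inferInstance : MeasurableSpace Ω) :=
  sup_le (iSup₂_le fun j _ => (h1.measurable_X j).comap_le)
    (iSup₂_le fun j _ => (h1.measurable_U j).comap_le)

theorem measurable_X_infoBefore {Ω : Type*} {X : ℤ → Ω → Regr p} {U : ℤ → Ω → ℝ} {i j : ℤ}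
    (hj : j ≤ i) : Measurable[infoBefore X U i] (X j) :=
  Measurable.mono (comap_measurable _) (le_sup_of_le_left (le_iSup₂_of_le j hj le_rfl)) le_rfl

theorem measurable_U_infoBefore {Ω : Type*} {X : ℤ → Ω → Regr p} {U : ℤ → Ω → ℝ} {i j : ℤ}
    (hj : j < i) : Measurable[infoBefore X U i] (U j) :=
  Measurable.mono (comap_measurable _) (le_sup_of_le_right (le_iSup₂_of_le j hj le_rfl)) le_rfl

/-- The errors are orthogonal to everything that is known before they are realized. -/
theorem DataAssumption.integral_mul_error_eq_zero [IsProbabilityMeasure μ] {τ₀ : ℝ}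
    (h1 : DataAssumption μ X U τ₀)
    {i : ℤ} {F : Ω → ℝ} (hF : Measurable[infoBefore X U i] F) (hU : Integrable (U i) μ)
    (hFU : Integrable (fun ω => F ω * U i ω) μ) : ∫ ω, F ω * U i ω ∂μ = 0 := by
  have hle := h1.infoBefore_le i
  rw [← integral_condExp hle]
  have h := condExp_mul_of_stronglyMeasurable_left (μ := μ) (m := infoBefore X U i)
    (f := F) (g := U i) hF.stronglyMeasurable hFU hU
  have h2 : μ[fun ω => F ω * U i ω | infoBefore X U i] =ᵐ[μ] 0 := by
    refine h.trans ?_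
    filter_upwards [h1.martingale_diff i] with ω hω
    simp [hω]
  rw [integral_congr_ae h2]
  simp

end Moments

/-! ### Second and fourth moments of dependent sums -/

section PartialSums

theorem sum_range_lag_le {r : ℕ → ℝ} (hr : ∀ m, 0 ≤ r m) (hs : Summable fun m => r (m + 1))
    (k : ℕ) : ∑ j ∈ Finset.range k, r (k - j) ≤ ∑' m, r (m + 1) := by
  have h : ∑ j ∈ Finset.range k, r (k - j) = ∑ j ∈ Finset.range k, r (j + 1) := by
    rw [← Finset.sum_range_reflect]
    refine Finset.sum_congr rfl fun j hj => ?_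
    rw [Finset.mem_range] at hj
    congr 1
    omega
  rw [h]
  exact hs.sum_le_tsum _ fun m _ => hr _

variable {Ω : Type*} [MeasurableSpace Ω] {μ : Measure Ω} [IsProbabilityMeasure μ]

/-- Adding the `k`-th term costs its own variance plus twice its covariance with the past, and the
latter is at most `v` times the sum of the mixing rates. -/
theorem variance_sum_le {Z : ℕ → Ω → ℝ} {r : ℕ → ℝ} {v : ℝ} (hr : ∀ m, 0 ≤ r m)
    (hs : Summable fun m => r (m + 1)) (hv : 0 ≤ v) (hZ : ∀ i, MemLp (Z i) 2 μ)
    (hZv : ∀ i, ∫ ω, Z i ω ^ 2 ∂μ ≤ v)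
    (hcov : ∀ j k, j < k → |cov[Z j, Z k; μ]| ≤ r (k - j) * v) (n : ℕ) :
    Var[fun ω => ∑ i ∈ Finset.range n, Z i ω; μ] ≤ n * ((1 + 2 * ∑' m, r (m + 1)) * v) := by
  induction n with
  | zero =>
    simp only [Finset.range_zero, Finset.sum_empty, Nat.cast_zero, zero_mul]
    exact (variance_zero μ).le
  | succ k ih =>
    have hS : MemLp (fun ω => ∑ i ∈ Finset.range k, Z i ω) 2 μ :=
      memLp_finsetSum _ fun i _ => hZ i
    have h1 : Var[fun ω => ∑ i ∈ Finset.range (k + 1), Z i ω; μ] =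
        Var[fun ω => ∑ i ∈ Finset.range k, Z i ω; μ] +
          2 * cov[fun ω => ∑ i ∈ Finset.range k, Z i ω, Z k; μ] + Var[Z k; μ] := by
      rw [← variance_fun_add hS (hZ k)]
      simp_rw [Finset.sum_range_succ]
    have h2 : cov[fun ω => ∑ i ∈ Finset.range k, Z i ω, Z k; μ] ≤ (∑' m, r (m + 1)) * v := by
      rw [covariance_fun_sum_left' (fun i _ => hZ i) (hZ k)]
      calc ∑ i ∈ Finset.range k, cov[Z i, Z k; μ] ≤ ∑ i ∈ Finset.range k, r (k - i) * v :=
            Finset.sum_le_sum fun i hi =>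
              (le_abs_self _).trans (hcov i k (Finset.mem_range.1 hi))
        _ = (∑ i ∈ Finset.range k, r (k - i)) * v := by rw [Finset.sum_mul]
        _ ≤ _ := mul_le_mul_of_nonneg_right (sum_range_lag_le hr hs k) hv
    have h3 : Var[Z k; μ] ≤ v := (variance_le_expectation_sq (hZ k).1).trans (hZv k)
    rw [h1]
    push_cast
    linarith

/-- With `M = max 1 |f| |g|`, any monomial of degree at most four is bounded by `M⁴ ≤ 1 + f⁴ + g⁴`.
-/
theorem integrable_pow_mul_pow {f g : Ω → ℝ} (hf : MemLp f 4 μ) (hg : MemLp g 4 μ) {i j : ℕ}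
    (hij : i + j ≤ 4) : Integrable (fun ω => f ω ^ i * g ω ^ j) μ := by
  have h4 : ∀ {f : Ω → ℝ}, MemLp f 4 μ → Integrable (fun ω => f ω ^ 4) μ := by
    intro f hf
    have := hf.integrable_norm_pow (p := 4) (by norm_num)
    refine this.congr (Eventually.of_forall fun ω => ?_)
    simp [Even.pow_abs (by decide : Even 4)]
  refine Integrable.mono' (((integrable_const (1 : ℝ)).add (h4 hf)).add (h4 hg))
    ((hf.1.pow i).mul (hg.1.pow j)) (Eventually.of_forall fun ω => ?_)
  rw [Real.norm_eq_abs, abs_mul, abs_pow, abs_pow]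
  set M := max 1 (max |f ω| |g ω|)
  have hM1 : 1 ≤ M := le_max_left _ _
  have hfM : |f ω| ≤ M := (le_max_left _ _).trans (le_max_right _ _)
  have hgM : |g ω| ≤ M := (le_max_right _ _).trans (le_max_right _ _)
  have hM : M ^ 4 ≤ 1 + f ω ^ 4 + g ω ^ 4 := by
    have e1 : |f ω| ^ 4 = f ω ^ 4 := Even.pow_abs (by decide) _
    have e2 : |g ω| ^ 4 = g ω ^ 4 := Even.pow_abs (by decide) _
    have p1 : 0 ≤ f ω ^ 4 := by positivity
    have p2 : 0 ≤ g ω ^ 4 := by positivity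
    rcases max_choice 1 (max |f ω| |g ω|) with h | h
    · simp only [M, h]; linarith
    · rcases max_choice |f ω| |g ω| with h' | h'
      · simp only [M, h, h', e1]; linarith
      · simp only [M, h, h', e2]; linarith
  calc |f ω| ^ i * |g ω| ^ j ≤ M ^ i * M ^ j := by gcongr
    _ = M ^ (i + j) := (pow_add _ _ _).symm
    _ ≤ M ^ 4 := pow_le_pow_right₀ hM1 hij
    _ ≤ _ := hM

/-- A fourth moment inequality for partial sums of `ξ` with conditional mean zero, with the
dependence of the squares controlled by mixing rates `r`. -/
theorem integral_partialSum_pow_four_le {ξ : ℕ → Ω → ℝ} {r : ℕ → ℝ} {v g R : ℝ}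
    (hr : ∀ m, 0 ≤ r m) (hs : Summable fun m => r (m + 1)) (hR : ∑' m, r (m + 1) ≤ R)
    (hξ : ∀ i, MemLp (ξ i) 4 μ)
    (hv : ∀ i, ∫ ω, ξ i ω ^ 2 ∂μ = v) (hg : ∀ i, ∫ ω, ξ i ω ^ 4 ∂μ = g)
    (horth1 : ∀ k, ∫ ω, (∑ i ∈ Finset.range k, ξ i ω) * ξ k ω ∂μ = 0)
    (horth3 : ∀ k, ∫ ω, (∑ i ∈ Finset.range k, ξ i ω) ^ 3 * ξ k ω ∂μ = 0)
    (hcov : ∀ j k, j < k →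
      |cov[fun ω => 2 * (∑ i ∈ Finset.range j, ξ i ω) * ξ j ω + ξ j ω ^ 2,
        fun ω => ξ k ω ^ 2; μ]| ≤ r (k - j) *
        (Real.sqrt (∫ ω, (2 * (∑ i ∈ Finset.range j, ξ i ω) * ξ j ω + ξ j ω ^ 2) ^ 2 ∂μ) *
          Real.sqrt (∫ ω, (ξ k ω ^ 2) ^ 2 ∂μ))) (n : ℕ) :
    ∫ ω, (∑ i ∈ Finset.range n, ξ i ω) ^ 4 ∂μ ≤
      (16 * (8 * R ^ 2 + 2 * R) + 16) * ((n : ℝ) ^ 2 * v ^ 2 + n * g) := by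
  have hR0 : 0 ≤ R := (tsum_nonneg fun m => hr _).trans hR
  have hv0 : 0 ≤ v := by rw [← hv 0]; exact integral_nonneg fun ω => by positivity
  have hg0 : 0 ≤ g := by rw [← hg 0]; exact integral_nonneg fun ω => by positivity
  set S : ℕ → Ω → ℝ := fun k ω => ∑ i ∈ Finset.range k, ξ i ω with hSdef
  have hS : ∀ k, MemLp (S k) 4 μ := fun k => memLp_finsetSum _ fun i _ => hξ i
  have hSs : ∀ k ω, S (k + 1) ω = S k ω + ξ k ω := fun k ω => Finset.sum_range_succ _ _
  change ∀ k, ∫ ω, S k ω * ξ k ω ∂μ = 0 at horth1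
  change ∀ k, ∫ ω, S k ω ^ 3 * ξ k ω ∂μ = 0 at horth3
  have hint : ∀ (i j k l : ℕ), i + j ≤ 4 → Integrable (fun ω => S k ω ^ i * ξ l ω ^ j) μ :=
    fun i j k l h => integrable_pow_mul_pow (hS k) (hξ l) h
  have hmul : ∀ k, Integrable (fun ω => S k ω * ξ k ω) μ := fun k => by
    simpa using hint 1 1 k k (by norm_num)
  have hS2 : ∀ k, Integrable (fun ω => S k ω ^ 2) μ := fun k => by
    simpa using hint 2 0 k k (by norm_num)
  have hξ2 : ∀ k, Integrable (fun ω => ξ k ω ^ 2) μ := fun k => by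
    simpa using hint 0 2 k k (by norm_num)
  have hS4 : ∀ k, Integrable (fun ω => S k ω ^ 4) μ := fun k => by
    simpa using hint 4 0 k k (by norm_num)
  have hξ4 : ∀ k, Integrable (fun ω => ξ k ω ^ 4) μ := fun k => by
    simpa using hint 0 4 k k (by norm_num)
  have hsec : ∀ k : ℕ, ∫ ω, S k ω ^ 2 ∂μ = k * v := by
    intro k
    induction k with
    | zero => simp [S]
    | succ k ih =>
      have : ∀ ω, S (k + 1) ω ^ 2 = (S k ω ^ 2 + 2 * (S k ω * ξ k ω)) + ξ k ω ^ 2 := by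
        intro ω; rw [hSs]; ring
      simp_rw [this]
      have hadd : Integrable (fun ω => S k ω ^ 2 + 2 * (S k ω * ξ k ω)) μ :=
        (hS2 k).add ((hmul k).const_mul 2)
      rw [integral_add hadd (hξ2 k),
        integral_add (hS2 k) ((hmul k).const_mul 2), integral_const_mul, horth1, ih, hv]
      push_cast; ring
  -- The increment `S_{j+1}² - S_j²`. It involves only indices up to `j`, so its covariance with
  -- `ξ_k²` decays with the lag `k - j`.
  set T : ℕ → Ω → ℝ := fun j ω => 2 * S j ω * ξ j ω + ξ j ω ^ 2 with hTdef
  have hT2i : ∀ j, Integrable (fun ω => T j ω ^ 2) μ := by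
    intro j
    have : ∀ ω, T j ω ^ 2 = 4 * (S j ω ^ 2 * ξ j ω ^ 2) + 4 * (S j ω ^ 1 * ξ j ω ^ 3) +
        ξ j ω ^ 4 := by
      intro ω; simp only [T]; ring
    simp_rw [this]
    exact (((hint 2 2 j j le_rfl).const_mul 4).add ((hint 1 3 j j le_rfl).const_mul 4)).add
      (hξ4 j)
  have hTL : ∀ j, MemLp (T j) 2 μ := by
    intro j
    refine (memLp_two_iff_integrable_sq ?_).2 (hT2i j)
    exact (((hS j).1.const_mul 2).mul (hξ j).1).add ((hξ j).1.pow 2)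
  have hξL : ∀ k, MemLp (fun ω => ξ k ω ^ 2) 2 μ := by
    intro k
    refine (memLp_two_iff_integrable_sq ((hξ k).1.pow 2)).2 ?_
    simpa [← pow_mul] using hξ4 k
  have hSL : ∀ k, MemLp (fun ω => S k ω ^ 2) 2 μ := by
    intro k
    refine (memLp_two_iff_integrable_sq ((hS k).1.pow 2)).2 ?_
    simpa [← pow_mul] using hS4 k
  set B : ℕ → ℝ := fun k => ∫ ω, S k ω ^ 2 * ξ k ω ^ 2 ∂μ with hBdef
  have hT2 : ∀ j, ∫ ω, T j ω ^ 2 ∂μ ≤ 8 * B j + 2 * g := by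
    intro j
    have h : ∫ ω, T j ω ^ 2 ∂μ ≤ ∫ ω, (8 * (S j ω ^ 2 * ξ j ω ^ 2) + 2 * ξ j ω ^ 4) ∂μ := by
      refine integral_mono (hT2i j)
        (((hint 2 2 j j le_rfl).const_mul 8).add ((hξ4 j).const_mul 2)) fun ω => ?_
      simp only [T]
      nlinarith [sq_nonneg (2 * S j ω * ξ j ω - ξ j ω ^ 2)]
    rw [integral_add ((hint 2 2 j j le_rfl).const_mul 8) ((hξ4 j).const_mul 2),
      integral_const_mul, integral_const_mul, hg] at h
    exact h
  set c := 8 * R ^ 2 + 2 * R with hc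
  have hc0 : 0 ≤ c := by positivity
  -- The mixed moments `B k` are bounded through themselves: the induction yields `B k ≤ M/2 + c g +
  -- n v²`, and `M` is the fixed point of the right-hand side. The value of `c` ensures `8R² ≤ c`
  -- and `2R² ≤ c²`.
  set M := 2 * n * v ^ 2 + 2 * c * g with hM
  have hM0 : 0 ≤ M := by positivity
  have hBM : ∀ k, k ≤ n → B k ≤ M := by
    intro k
    induction k using Nat.strong_induction_on with
    | _ k ih =>
      intro hk
      have hST : (fun ω => S k ω ^ 2) = fun ω => ∑ j ∈ Finset.range k, T j ω := by
        funext ω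
        have : ∀ k, S k ω ^ 2 = ∑ j ∈ Finset.range k, T j ω := by
          intro k
          induction k with
          | zero => simp [S]
          | succ k ih => rw [Finset.sum_range_succ, ← ih, hSs]; simp only [T]; ring
        exact this k
      have h1 : B k = cov[fun ω => S k ω ^ 2, fun ω => ξ k ω ^ 2; μ] + k * v * v := by
        rw [covariance_eq_sub (hSL k) (hξL k)]
        have e : (∫ ω, (fun ω => S k ω ^ 2) ω ∂μ) * (∫ ω, (fun ω => ξ k ω ^ 2) ω ∂μ) =
            k * v * v := by
          simp only [hsec, hv]
        rw [e]
        simp only [Pi.mul_apply, hBdef]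
        ring
      have h2 : ∀ j ∈ Finset.range k, cov[T j, fun ω => ξ k ω ^ 2; μ] ≤
          r (k - j) * Real.sqrt ((8 * M + 2 * g) * g) := by
        intro j hj
        rw [Finset.mem_range] at hj
        refine (le_abs_self _).trans ((hcov j k hj).trans ?_)
        refine mul_le_mul_of_nonneg_left ?_ (hr _)
        rw [Real.sqrt_mul (by positivity)]
        refine mul_le_mul (Real.sqrt_le_sqrt ?_) (Real.sqrt_le_sqrt ?_) (by positivity)
          (by positivity)
        · exact (hT2 j).trans (by linarith [ih j hj (by omega)])
        · simp [← pow_mul, hg]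
      have h3 : cov[fun ω => S k ω ^ 2, fun ω => ξ k ω ^ 2; μ] ≤
          R * Real.sqrt ((8 * M + 2 * g) * g) := by
        rw [hST, covariance_fun_sum_left' (fun i _ => hTL i) (hξL k)]
        refine (Finset.sum_le_sum h2).trans ?_
        rw [← Finset.sum_mul]
        exact mul_le_mul_of_nonneg_right ((sum_range_lag_le hr hs k).trans hR)
          (Real.sqrt_nonneg _)
      have h4 : R * Real.sqrt ((8 * M + 2 * g) * g) ≤ M / 2 + c * g := by
        have : R * Real.sqrt ((8 * M + 2 * g) * g) = Real.sqrt (R ^ 2 * ((8 * M + 2 * g) * g)) := by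
          rw [Real.sqrt_mul (sq_nonneg R), Real.sqrt_sq hR0]
        rw [this]
        refine Real.sqrt_le_iff.2 ⟨by positivity, ?_⟩
        have hc1 : 8 * R ^ 2 ≤ c := by rw [hc]; linarith
        have hc2 : 2 * R ^ 2 ≤ c ^ 2 := by
          rw [hc]
          nlinarith [mul_nonneg hR0 hR0, mul_nonneg (mul_nonneg hR0 hR0) hR0,
            mul_nonneg (mul_nonneg hR0 hR0) (mul_nonneg hR0 hR0)]
        nlinarith [mul_le_mul_of_nonneg_right hc1 (mul_nonneg hM0 hg0),
          mul_le_mul_of_nonneg_right hc2 (mul_nonneg hg0 hg0), mul_nonneg hM0 hM0]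
      have h5 : (k : ℝ) * v * v ≤ n * v ^ 2 := by
        have : (k : ℝ) ≤ n := by exact_mod_cast hk
        nlinarith [mul_nonneg hv0 hv0]
      rw [h1]
      have : M / 2 + c * g + n * v ^ 2 = M := by rw [hM]; ring
      linarith
  have hfin : ∀ k, k ≤ n → ∫ ω, S k ω ^ 4 ∂μ ≤ k * (8 * M + 3 * g) := by
    intro k
    induction k with
    | zero => simp [S]
    | succ k ih =>
      intro hk
      -- Binomial expansion with `4 S ξ³ ≤ 2 S² ξ² + 2 ξ⁴`, which turns the coefficients 6 and 1
      -- into 8 and 3. The `S³ ξ` term integrates to zero.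
      have h : ∫ ω, S (k + 1) ω ^ 4 ∂μ ≤ ∫ ω, (S k ω ^ 4 + 4 * (S k ω ^ 3 * ξ k ω) +
          8 * (S k ω ^ 2 * ξ k ω ^ 2) + 3 * ξ k ω ^ 4) ∂μ := by
        refine integral_mono (hS4 (k + 1)) ?_ fun ω => ?_
        · have := hint 3 1 k k le_rfl
          simp only [pow_one] at this
          exact (((hS4 k).add (this.const_mul 4)).add ((hint 2 2 k k le_rfl).const_mul 8)).add
            ((hξ4 k).const_mul 3)
        · simp only [hSs]
          nlinarith [sq_nonneg (S k ω * ξ k ω - ξ k ω ^ 2)]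
      have h31 := hint 3 1 k k le_rfl
      simp only [pow_one] at h31
      have ha1 : Integrable (fun ω => S k ω ^ 4 + 4 * (S k ω ^ 3 * ξ k ω)) μ :=
        (hS4 k).add (h31.const_mul 4)
      have ha2 : Integrable (fun ω => S k ω ^ 4 + 4 * (S k ω ^ 3 * ξ k ω) +
          8 * (S k ω ^ 2 * ξ k ω ^ 2)) μ := ha1.add ((hint 2 2 k k le_rfl).const_mul 8)
      rw [integral_add ha2 ((hξ4 k).const_mul 3),
        integral_add ha1 ((hint 2 2 k k le_rfl).const_mul 8),
        integral_add (hS4 k) (h31.const_mul 4), integral_const_mul, integral_const_mul,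
        integral_const_mul, horth3, hg] at h
      have hB := hBM k (by omega)
      have := ih (by omega)
      simp only [hBdef] at hB
      push_cast
      linarith
  refine (hfin n le_rfl).trans ?_
  have hn0 : (0 : ℝ) ≤ n := Nat.cast_nonneg n
  rw [hM]
  nlinarith [mul_nonneg hn0 hg0, mul_nonneg (mul_nonneg hn0 hn0) (mul_nonneg hv0 hv0),
    mul_nonneg hc0 (mul_nonneg (mul_nonneg hn0 hn0) (mul_nonneg hv0 hv0)),
    mul_nonneg hc0 (mul_nonneg hn0 hg0)]

end PartialSums

/-! ### Moment and deviation bounds for sums over the sample -/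

section Sample

variable {Ω : Type*} [MeasurableSpace Ω] {μ : Measure Ω} [IsProbabilityMeasure μ]
  {p : ℕ} {X : ℤ → Ω → Regr p} {U : ℤ → Ω → ℝ} {τ₀ : ℝ}

/-- The sum of the mixing coefficients. -/
noncomputable def rhoSum (μ : Measure Ω) (X : ℤ → Ω → Regr p) (U : ℤ → Ω → ℝ) : ℝ :=
  ∑' m, rhoMix μ X U (m + 1)

omit [IsProbabilityMeasure μ] in
theorem rhoSum_nonneg : 0 ≤ rhoSum μ X U := tsum_nonneg fun _ => rhoMix_nonneg _ _ _ _

theorem DataAssumption.variance_sum_pair_le (h1 : DataAssumption μ X U τ₀)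
    {g : Regr p × ℝ → ℝ} (hg : Measurable g) (hg2 : MemLp g 2 (margin μ X U)) (n : ℕ) :
    Var[fun ω => ∑ k ∈ Finset.range n, g (X (k + 1) ω, U (k + 1) ω); μ] ≤
      n * ((1 + 2 * rhoSum μ X U) * ∫ z, g z ^ 2 ∂(margin μ X U)) := by
  have hL : ∀ i : ℕ, MemLp (fun ω => g (X (i + 1) ω, U (i + 1) ω)) 2 μ := fun i =>
    (h1.memLp_pair hg _ 2).2 hg2
  have hsq : ∀ i : ℤ, ∫ ω, g (X i ω, U i ω) ^ 2 ∂μ = ∫ z, g z ^ 2 ∂(margin μ X U) := fun i =>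
    h1.integral_pair (hg.pow_const 2) i
  have hv : 0 ≤ ∫ z, g z ^ 2 ∂(margin μ X U) := integral_nonneg fun _ => sq_nonneg _
  refine variance_sum_le (fun m => rhoMix_nonneg μ X U m) h1.summable_rhoMix hv hL
    (fun i => (hsq _).le) ?_ n
  intro j k hjk
  have h := abs_covariance_le_rhoMix (μ := μ) (X := X) (U := U) (k := (j : ℤ) + 1) (m := k - j)
    (Z := fun ω => g (X (j + 1) ω, U (j + 1) ω)) (W := fun ω => g (X (k + 1) ω, U (k + 1) ω))
    (hg.comp (measurable_pair_sigmaOf (Set.mem_Iic.2 le_rfl)))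
    (hg.comp (measurable_pair_sigmaOf (Set.mem_Ici.2 (by omega)))) (hL j) (hL k)
  rw [hsq, hsq, Real.mul_self_sqrt hv] at h
  exact h

/-- Chebyshev's inequality with the mixing variance bound. This is the law of large numbers, with
rate, behind all quadratic terms. -/
theorem DataAssumption.meas_sum_pair_deviation_le (h1 : DataAssumption μ X U τ₀)
    {g : Regr p × ℝ → ℝ} (hg : Measurable g) (hg2 : MemLp g 2 (margin μ X U)) (n : ℕ) {η : ℝ}
    (hη : 0 < η) :
    μ {ω | η * n < |∑ k ∈ Finset.range n, g (X (k + 1) ω, U (k + 1) ω) -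
        n * ∫ z, g z ∂(margin μ X U)|} ≤
      ENNReal.ofReal ((1 + 2 * rhoSum μ X U) * (∫ z, g z ^ 2 ∂(margin μ X U)) / (η ^ 2 * n)) := by
  rcases Nat.eq_zero_or_pos n with rfl | hn
  · simp
  have hn' : (0 : ℝ) < n := by exact_mod_cast hn
  have hL : ∀ i : ℕ, MemLp (fun ω => g (X (i + 1) ω, U (i + 1) ω)) 2 μ := fun i =>
    (h1.memLp_pair hg _ 2).2 hg2
  have hS : MemLp (fun ω => ∑ k ∈ Finset.range n, g (X (k + 1) ω, U (k + 1) ω)) 2 μ :=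
    memLp_finsetSum _ fun i _ => hL i
  have hmean : ∫ ω, ∑ k ∈ Finset.range n, g (X (k + 1) ω, U (k + 1) ω) ∂μ =
      n * ∫ z, g z ∂(margin μ X U) := by
    rw [integral_finsetSum _ fun i _ => (hL i).integrable (by norm_num)]
    simp_rw [h1.integral_pair hg]
    simp
  have hc : 0 < η * n := by positivity
  have h := meas_ge_le_variance_div_sq hS hc
  rw [hmean] at h
  refine (measure_mono fun ω hω => ?_).trans (h.trans (ENNReal.ofReal_le_ofReal ?_))
  · simp only [Set.mem_ofPred_eq] at hω ⊢
    exact hω.le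
  · rw [div_le_div_iff₀ (by positivity) (by positivity)]
    have := h1.variance_sum_pair_le hg hg2 n
    calc _ ≤ (n * ((1 + 2 * rhoSum μ X U) * ∫ z, g z ^ 2 ∂(margin μ X U))) * (η ^ 2 * n) := by
          gcongr
      _ = _ := by ring

theorem norm_ge_one {x : Regr p} (hx : x 0 = 1) : 1 ≤ ‖x‖ := by
  have := PiLp.norm_apply_le x 0
  rw [hx] at this
  simpa using this

omit [IsProbabilityMeasure μ] in
theorem DataAssumption.memLp_error_smul (h1 : DataAssumption μ X U τ₀) :
    MemLp (fun z : Regr p × ℝ => z.2 • z.1) 4 (margin μ X U) := by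
  have hm : Measurable fun z : Regr p × ℝ => z.2 • z.1 := measurable_snd.smul measurable_fst
  refine (integrable_norm_rpow_iff hm.aestronglyMeasurable (by norm_num) (by norm_num)).1 ?_
  have h := (h1.integrable_pair (g := fun z : Regr p × ℝ => ‖z.2 • z.1‖ ^ 4)
    (hm.norm.pow_const 4) 0).1 h1.moment_XU
  refine h.congr (Eventually.of_forall fun z => ?_)
  simp only [ENNReal.toReal_ofNat]
  norm_cast

omit [IsProbabilityMeasure μ] in
-- The constant regressor makes `‖X‖ ≥ 1`, so `|U| ≤ ‖U X‖`.
theorem DataAssumption.memLp_error (h1 : DataAssumption μ X U τ₀) (hX : ∀ i ω, X i ω 0 = 1) :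
    MemLp (fun z : Regr p × ℝ => z.2) 4 (margin μ X U) := by
  have hm : Measurable fun z : Regr p × ℝ => z.2 • z.1 := measurable_snd.smul measurable_fst
  have h : MemLp (fun ω => U 0 ω • X 0 ω) 4 μ := by
    have := h1.memLp_error_smul
    rw [← h1.map_pair 0, memLp_map_measure_iff hm.aestronglyMeasurable
      (h1.measurable_pair 0).aemeasurable] at this
    exact this
  rw [← h1.memLp_pair measurable_snd 0]
  refine h.mono (h1.measurable_U 0).aestronglyMeasurable (Eventually.of_forall fun ω => ?_)
  rw [norm_smul]
  exact le_mul_of_one_le_right (norm_nonneg _) (norm_ge_one (hX 0 ω))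

/-- The sum `∑ U_i φ(X_i)` over the sample. -/
def noise (X : ℤ → Ω → Regr p) (U : ℤ → Ω → ℝ) (φ : Regr p → ℝ) (n : ℕ) (ω : Ω) : ℝ :=
  ∑ k ∈ Finset.range n, U (k + 1) ω * φ (X (k + 1) ω)

/-- The constant in the fourth moment bound for `noise`. -/
noncomputable def noiseConst (μ : Measure Ω) (X : ℤ → Ω → Regr p) (U : ℤ → Ω → ℝ) : ℝ :=
  16 * (8 * rhoSum μ X U ^ 2 + 2 * rhoSum μ X U) + 16

omit [IsProbabilityMeasure μ] in
theorem noiseConst_pos : 0 < noiseConst μ X U := by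
  have := rhoSum_nonneg (μ := μ) (X := X) (U := U)
  unfold noiseConst
  positivity

omit [IsProbabilityMeasure μ] in
theorem DataAssumption.memLp_noise (h1 : DataAssumption μ X U τ₀) {φ : Regr p → ℝ}
    (hφ : Measurable φ) (hφ4 : MemLp (fun z : Regr p × ℝ => z.2 * φ z.1) 4 (margin μ X U))
    (n : ℕ) : MemLp (noise X U φ n) 4 μ := by
  have hgm : Measurable fun z : Regr p × ℝ => z.2 * φ z.1 :=
    measurable_snd.mul (hφ.comp measurable_fst)
  exact memLp_finsetSum _ fun i _ => (h1.memLp_pair hgm _ 4).2 hφ4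

/-- The factor `φ(X_i)` is known before `U_i` is realized, so every power of the past sum times
`φ(X_i)` is orthogonal to `U_i`; this gives both orthogonality hypotheses of the fourth moment
inequality. The covariance hypothesis is ρ-mixing at lag `k - j`. -/
theorem DataAssumption.integral_noise_pow_four_le (h1 : DataAssumption μ X U τ₀)
    (hX : ∀ i ω, X i ω 0 = 1) {φ : Regr p → ℝ} (hφ : Measurable φ)
    (hφ4 : MemLp (fun z : Regr p × ℝ => z.2 * φ z.1) 4 (margin μ X U)) (n : ℕ) :
    ∫ ω, noise X U φ n ω ^ 4 ∂μ ≤ noiseConst μ X U *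
      ((n : ℝ) ^ 2 * (∫ z, (z.2 * φ z.1) ^ 2 ∂(margin μ X U)) ^ 2 +
        n * ∫ z, (z.2 * φ z.1) ^ 4 ∂(margin μ X U)) := by
  have hgm : Measurable fun z : Regr p × ℝ => z.2 * φ z.1 :=
    measurable_snd.mul (hφ.comp measurable_fst)
  have hξ : ∀ i : ℕ, MemLp (fun ω => U (i + 1) ω * φ (X (i + 1) ω)) 4 μ := fun i =>
    (h1.memLp_pair hgm _ 4).2 hφ4
  have hU : ∀ i, Integrable (U i) μ := fun i =>
    ((h1.memLp_pair measurable_snd i 4).2 (h1.memLp_error hX)).integrable (by norm_num)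
  have hSm : ∀ k : ℕ, Measurable[infoBefore X U (k + 1)]
      fun ω => ∑ i ∈ Finset.range k, U (i + 1) ω * φ (X (i + 1) ω) := by
    intro k
    refine Finset.measurable_fun_sum _ fun i hi => ?_
    rw [Finset.mem_range] at hi
    exact (measurable_U_infoBefore (by omega)).mul
      (hφ.comp (measurable_X_infoBefore (by omega)))
  have hS : ∀ k : ℕ, MemLp (fun ω => ∑ i ∈ Finset.range k, U (i + 1) ω * φ (X (i + 1) ω)) 4 μ :=
    fun k => memLp_finsetSum _ fun i _ => hξ i
  have horth : ∀ (k a : ℕ), a ≤ 3 →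
      ∫ ω, (∑ i ∈ Finset.range k, U (i + 1) ω * φ (X (i + 1) ω)) ^ a *
        (U (k + 1) ω * φ (X (k + 1) ω)) ∂μ = 0 := by
    intro k a ha
    have e : ∀ ω, (∑ i ∈ Finset.range k, U (i + 1) ω * φ (X (i + 1) ω)) ^ a *
        (U (k + 1) ω * φ (X (k + 1) ω)) =
        ((∑ i ∈ Finset.range k, U (i + 1) ω * φ (X (i + 1) ω)) ^ a * φ (X (k + 1) ω)) *
          U (k + 1) ω := fun ω => by ring
    simp_rw [e]
    refine h1.integral_mul_error_eq_zero
      (((hSm k).pow_const a).mul (hφ.comp (measurable_X_infoBefore le_rfl))) (hU _) ?_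
    simp_rw [← e]
    simpa using integrable_pow_mul_pow (hS k) (hξ k) (i := a) (j := 1) (by omega)
  refine integral_partialSum_pow_four_le (ξ := fun i ω => U (i + 1) ω * φ (X (i + 1) ω))
    (fun m => rhoMix_nonneg μ X U m) h1.summable_rhoMix le_rfl hξ
    (fun i => h1.integral_pair (hgm.pow_const 2) _) (fun i => h1.integral_pair (hgm.pow_const 4) _)
    (fun k => by simpa using horth k 1 (by norm_num)) (fun k => horth k 3 le_rfl) ?_ n
  intro j k hjk
  have hm : ∀ i : ℕ, i ≤ j → Measurable[sigmaOf X U (Set.Iic ((j : ℤ) + 1))]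
      fun ω => U (i + 1) ω * φ (X (i + 1) ω) := fun i hi =>
    hgm.comp (measurable_pair_sigmaOf (Set.mem_Iic.2 (by omega)))
  have hmk : Measurable[sigmaOf X U (Set.Ici ((j : ℤ) + 1 + (k - j : ℕ)))]
      fun ω => U (k + 1) ω * φ (X (k + 1) ω) :=
    hgm.comp (measurable_pair_sigmaOf (Set.mem_Ici.2 (by omega)))
  have hξ4 := fun i => integrable_pow_mul_pow (hξ i) (hξ i) (i := 4) (j := 0) le_rfl
  have h22 := integrable_pow_mul_pow (hS j) (hξ j) (i := 2) (j := 2) le_rfl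
  have h13 := integrable_pow_mul_pow (hS j) (hξ j) (i := 1) (j := 3) le_rfl
  have h04 := integrable_pow_mul_pow (hS j) (hξ j) (i := 0) (j := 4) le_rfl
  have hsm := Finset.measurable_fun_sum (Finset.range j)
    fun i hi => hm i (Finset.mem_range.1 hi).le
  refine abs_covariance_le_rhoMix (μ := μ) (X := X) (U := U) (k := (j : ℤ) + 1) (m := k - j)
    (((hsm.const_mul 2).mul (hm j le_rfl)).add ((hm j le_rfl).pow_const 2))
    (hmk.pow_const 2) ?_ ?_
  · refine (memLp_two_iff_integrable_sq ?_).2 ?_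
    · exact (((hS j).1.const_mul 2).mul (hξ j).1).add ((hξ j).1.pow 2)
    · refine (((h22.const_mul 4).add (h13.const_mul 4)).add h04).congr
        (Eventually.of_forall fun ω => ?_)
      simp only [Pi.add_apply]
      ring
  · refine (memLp_two_iff_integrable_sq ((hξ k).1.pow 2)).2 ?_
    refine (hξ4 k).congr (Eventually.of_forall fun ω => ?_)
    simp only [Pi.pow_apply]
    ring

end Sample

/-! ### Indicators of threshold intervals and their weighted masses -/

section Slab

variable {p : ℕ}

theorem measurable_thr : Measurable (thr : Regr p → ℝ) := by
  unfold thr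
  fun_prop

/-- The indicator of `s < Q ≤ t` as a function of the regressor. -/
noncomputable def slab (s t : ℝ) (x : Regr p) : ℝ := (Set.Ioc s t).indicator (fun _ => 1) (thr x)

theorem measurable_slab (s t : ℝ) : Measurable (slab s t : Regr p → ℝ) :=
  (measurable_const.indicator measurableSet_Ioc).comp measurable_thr

theorem slab_nonneg (s t : ℝ) (x : Regr p) : 0 ≤ slab s t x :=
  Set.indicator_nonneg (fun _ _ => zero_le_one) _

theorem slab_le_one (s t : ℝ) (x : Regr p) : slab s t x ≤ 1 :=
  Set.indicator_apply_le' (fun _ => le_rfl) fun _ => zero_le_one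

theorem slab_sq (s t : ℝ) (x : Regr p) : slab s t x ^ 2 = slab s t x := by
  unfold slab
  by_cases h : thr x ∈ Set.Ioc s t <;> simp [h]

theorem slab_add {s u t : ℝ} (h1 : s ≤ u) (h2 : u ≤ t) (x : Regr p) :
    slab s t x = slab s u x + slab u t x := by
  unfold slab
  rw [← Set.Ioc_union_Ioc_eq_Ioc h1 h2, Set.indicator_union_of_disjoint]
  rw [Set.disjoint_left]
  intro a ha hb
  exact absurd ha.2 (not_le.2 hb.1)

theorem slab_mono {s t s' t' : ℝ} (h1 : s' ≤ s) (h2 : t ≤ t') (x : Regr p) :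
    slab s t x ≤ slab s' t' x :=
  Set.indicator_le_indicator_of_subset (Set.Ioc_subset_Ioc h1 h2) (fun _ => zero_le_one) _

theorem slab_self (s : ℝ) (x : Regr p) : slab s s x = 0 := by simp [slab]

theorem continuousAt_slab {s t : ℝ} {x : Regr p} (h : thr x ≠ t) :
    ContinuousAt (fun u => slab s u x) t := by
  rcases lt_or_gt_of_ne h with h | h
  · refine (continuousAt_const (y := (Set.Ioi s).indicator (fun _ => (1 : ℝ)) (thr x))).congr ?_
    filter_upwards [lt_mem_nhds h] with u hu
    unfold slab
    by_cases hs : s < thr x <;> simp [Set.indicator, hs, hu.le]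
  · refine (continuousAt_const (y := (0 : ℝ))).congr ?_
    filter_upwards [gt_mem_nhds h] with u hu
    unfold slab
    rw [Set.indicator_of_notMem]
    exact fun hh => absurd hh.2 (not_le.2 hu)

/-- The weight of `s < Q ≤ t`. -/
noncomputable def slabMass (L : Measure (Regr p × ℝ)) (w : Regr p × ℝ → ℝ) (s t : ℝ) : ℝ :=
  ∫ z, w z * slab s t z.1 ∂L

variable {L : Measure (Regr p × ℝ)} {w : Regr p × ℝ → ℝ}

theorem integrable_mul_slab (hw : Integrable w L) (s t : ℝ) :
    Integrable (fun z => w z * slab s t z.1) L := by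
  refine Integrable.mono hw
    (hw.1.mul ((measurable_slab s t).comp measurable_fst).aestronglyMeasurable)
    (Eventually.of_forall fun z => ?_)
  rw [norm_mul, Real.norm_of_nonneg (slab_nonneg s t z.1)]
  exact mul_le_of_le_one_right (norm_nonneg _) (slab_le_one _ _ _)

theorem slabMass_nonneg (h0 : ∀ z, 0 ≤ w z) (s t : ℝ) : 0 ≤ slabMass L w s t :=
  integral_nonneg fun z => mul_nonneg (h0 z) (slab_nonneg _ _ _)

theorem slabMass_le (hw : Integrable w L) (h0 : ∀ z, 0 ≤ w z) (s t : ℝ) :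
    slabMass L w s t ≤ ∫ z, w z ∂L :=
  integral_mono (integrable_mul_slab hw s t) hw fun z =>
    mul_le_of_le_one_right (h0 z) (slab_le_one _ _ _)

theorem slabMass_add (hw : Integrable w L) {s u t : ℝ} (h1 : s ≤ u) (h2 : u ≤ t) :
    slabMass L w s t = slabMass L w s u + slabMass L w u t := by
  unfold slabMass
  rw [← integral_add (integrable_mul_slab hw s u) (integrable_mul_slab hw u t)]
  refine integral_congr_ae (Eventually.of_forall fun z => ?_)
  simp only [slab_add h1 h2, mul_add]

theorem continuous_slabMass (hL : ∀ t, ∀ᵐ z ∂L, thr z.1 ≠ t) (hw : Integrable w L) (s : ℝ) :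
    Continuous (slabMass L w s) := by
  rw [continuous_iff_continuousAt]
  intro t
  refine continuousAt_of_dominated (bound := fun z => ‖w z‖)
    (Eventually.of_forall fun u => (integrable_mul_slab hw s u).1)
    (Eventually.of_forall fun u => Eventually.of_forall fun z => ?_) hw.norm ?_
  · rw [norm_mul, Real.norm_of_nonneg (slab_nonneg s u z.1)]
    exact mul_le_of_le_one_right (norm_nonneg _) (slab_le_one _ _ _)
  · filter_upwards [hL t] with z hz
    exact continuousAt_const.mul (continuousAt_slab hz)

/-- Without atoms in the law of `Q` the mass is continuous in the endpoint, so the intermediate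
value theorem provides a bisecting point. Bisecting mass rather than length lets the chaining run
without any bound on the density. -/
theorem exists_slabMass_half (hL : ∀ t, ∀ᵐ z ∂L, thr z.1 ≠ t) (hw : Integrable w L)
    (h0 : ∀ z, 0 ≤ w z) {s t : ℝ} (hst : s ≤ t) :
    ∃ u ∈ Set.Icc s t, slabMass L w s u = slabMass L w s t / 2 ∧
      slabMass L w u t = slabMass L w s t / 2 := by
  have h := intermediate_value_Icc hst (continuous_slabMass hL hw s).continuousOn
  have hs : slabMass L w s s = 0 := by simp [slabMass, slab_self]
  have h' : slabMass L w s t / 2 ∈ Set.Icc (slabMass L w s s) (slabMass L w s t) := by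
    have := slabMass_nonneg (L := L) h0 s t
    rw [hs]
    constructor <;> linarith
  obtain ⟨u, hu, hue⟩ := h h'
  refine ⟨u, hu, hue, ?_⟩
  have := slabMass_add hw hu.1 hu.2
  linarith

end Slab

/-- Convexity with weights 1/10 and 9/10; the factor on `b⁴` is `(10/9)³ < 7/5`. The chaining needs
this factor, call it `q`, to satisfy both `q/2 < 1` and `q² < 2`. -/
theorem add_pow_four_le (a b : ℝ) : (a + b) ^ 4 ≤ 1000 * a ^ 4 + 7 / 5 * b ^ 4 := by
  have h := (Even.convexOn_pow (𝕜 := ℝ) (n := 4) (by decide)).2 (Set.mem_univ (10 * a))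
    (Set.mem_univ (10 / 9 * b)) (by norm_num : (0 : ℝ) ≤ 1 / 10) (by norm_num : (0 : ℝ) ≤ 9 / 10)
    (by norm_num)
  simp only [smul_eq_mul] at h
  have e : 1 / 10 * (10 * a) + 9 / 10 * (10 / 9 * b) = a + b := by ring
  rw [e] at h
  have : 0 ≤ b ^ 4 := by positivity
  nlinarith

/-! ### Dyadic chaining for the noise over intervals of `Q` -/

section Maximal

variable {Ω : Type*} [MeasurableSpace Ω] {μ : Measure Ω} [IsProbabilityMeasure μ]
  {p : ℕ} {X : ℤ → Ω → Regr p} {U : ℤ → Ω → ℝ} {τ₀ : ℝ}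

/-- The weight `1 + ‖X U‖²`. -/
noncomputable def weight (z : Regr p × ℝ) : ℝ := 1 + ‖z.2 • z.1‖ ^ 2

theorem weight_nonneg (z : Regr p × ℝ) : 0 ≤ weight z := by unfold weight; positivity

theorem DataAssumption.integrable_weight (h1 : DataAssumption μ X U τ₀) :
    Integrable (weight : Regr p × ℝ → ℝ) (margin μ X U) := by
  have := h1.isProbabilityMeasure_margin
  have h := (h1.memLp_error_smul.mono_exponent (p := 2) (by norm_num)).integrable_norm_pow
    (p := 2) (by norm_num)
  exact (integrable_const 1).add h

omit [IsProbabilityMeasure μ] in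
theorem DataAssumption.integrable_fourth (h1 : DataAssumption μ X U τ₀) :
    Integrable (fun z : Regr p × ℝ => ‖z.2 • z.1‖ ^ 4) (margin μ X U) :=
  h1.memLp_error_smul.integrable_norm_pow (p := 4) (by norm_num)

theorem abs_error_mul_le {ψ : Regr p → ℝ} (hψ : ∀ x, |ψ x| ≤ ‖x‖) (z : Regr p × ℝ) :
    |z.2 * ψ z.1| ≤ ‖z.2 • z.1‖ := by
  rw [abs_mul, norm_smul, Real.norm_eq_abs]
  exact mul_le_mul_of_nonneg_left (hψ _) (abs_nonneg _)

omit [IsProbabilityMeasure μ] in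
theorem DataAssumption.memLp_error_mul (h1 : DataAssumption μ X U τ₀) {ψ : Regr p → ℝ}
    (hψm : Measurable ψ) (hψ : ∀ x, |ψ x| ≤ ‖x‖) :
    MemLp (fun z : Regr p × ℝ => z.2 * ψ z.1) 4 (margin μ X U) :=
  h1.memLp_error_smul.mono
    (measurable_snd.mul (hψm.comp measurable_fst)).aestronglyMeasurable
    (Eventually.of_forall fun z => abs_error_mul_le hψ z)

theorem abs_mul_slab_le {ψ : Regr p → ℝ} (hψ : ∀ x, |ψ x| ≤ ‖x‖) (s t : ℝ) (x : Regr p) :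
    |ψ x * slab s t x| ≤ ‖x‖ := by
  rw [abs_mul, abs_of_nonneg (slab_nonneg s t x)]
  exact (mul_le_of_le_one_right (abs_nonneg _) (slab_le_one _ _ _)).trans (hψ x)

theorem noise_slab_add {Ω : Type*} {X : ℤ → Ω → Regr p} {U : ℤ → Ω → ℝ} (ψ : Regr p → ℝ)
    {s u t : ℝ} (h1 : s ≤ u) (h2 : u ≤ t) (n : ℕ) (ω : Ω) :
    noise X U (fun x => ψ x * slab s t x) n ω =
      noise X U (fun x => ψ x * slab s u x) n ω + noise X U (fun x => ψ x * slab u t x) n ω := by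
  unfold noise
  rw [← Finset.sum_add_distrib]
  refine Finset.sum_congr rfl fun k _ => ?_
  simp only [slab_add h1 h2]
  ring

/-- The second moment is controlled by the mass `m`, which halves at each bisection. The fourth
moment is kept as a slab mass: over disjoint cells these merely add up to at most the total fourth
moment. -/
theorem DataAssumption.integral_noise_slab_le (h1 : DataAssumption μ X U τ₀)
    (hX : ∀ i ω, X i ω 0 = 1) {ψ : Regr p → ℝ} (hψm : Measurable ψ) (hψ : ∀ x, |ψ x| ≤ ‖x‖)
    (s t : ℝ) (n : ℕ) {m : ℝ} (hm : slabMass (margin μ X U) weight s t ≤ m) :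
    ∫ ω, noise X U (fun x => ψ x * slab s t x) n ω ^ 4 ∂μ ≤ noiseConst μ X U *
      ((n : ℝ) ^ 2 * m ^ 2 + n * slabMass (margin μ X U) (fun z => ‖z.2 • z.1‖ ^ 4) s t) := by
  have hmeas : Measurable fun x => ψ x * slab s t x := hψm.mul (measurable_slab s t)
  have h4 := h1.memLp_error_mul hmeas (abs_mul_slab_le hψ s t)
  have hpm := h1.isProbabilityMeasure_margin
  refine (h1.integral_noise_pow_four_le hX hmeas h4 n).trans ?_
  refine mul_le_mul_of_nonneg_left ?_ noiseConst_pos.le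
  have hb2 : ∫ z, (z.2 * (ψ z.1 * slab s t z.1)) ^ 2 ∂(margin μ X U) ≤ m := by
    refine le_trans (integral_mono (h4.mono_exponent (p := 2) (by norm_num)).integrable_sq
      (integrable_mul_slab h1.integrable_weight s t) fun z => ?_) hm
    have e : (z.2 * (ψ z.1 * slab s t z.1)) ^ 2 = |z.2 * ψ z.1| ^ 2 * slab s t z.1 := by
      rw [sq_abs, ← mul_assoc, mul_pow, slab_sq]
    simp only [e]
    refine mul_le_mul_of_nonneg_right ?_ (slab_nonneg _ _ _)
    have := pow_le_pow_left₀ (abs_nonneg _) (abs_error_mul_le hψ z) 2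
    unfold weight
    linarith
  have hb4 : ∫ z, (z.2 * (ψ z.1 * slab s t z.1)) ^ 4 ∂(margin μ X U) ≤
      slabMass (margin μ X U) (fun z => ‖z.2 • z.1‖ ^ 4) s t := by
    have hi : Integrable (fun z : Regr p × ℝ => (z.2 * (ψ z.1 * slab s t z.1)) ^ 4)
        (margin μ X U) := by
      simpa using integrable_pow_mul_pow h4 h4 (i := 4) (j := 0) le_rfl
    refine integral_mono hi (integrable_mul_slab h1.integrable_fourth s t) fun z => ?_
    have e : (z.2 * (ψ z.1 * slab s t z.1)) ^ 4 = |z.2 * ψ z.1| ^ 4 * slab s t z.1 := by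
      have e1 : slab s t z.1 ^ 4 = slab s t z.1 := by
        have := slab_sq s t z.1
        calc slab s t z.1 ^ 4 = (slab s t z.1 ^ 2) ^ 2 := by ring
          _ = _ := by rw [this, this]
      rw [Even.pow_abs (by decide), ← mul_assoc, mul_pow, e1]
    simp only [e]
    exact mul_le_mul_of_nonneg_right (pow_le_pow_left₀ (abs_nonneg _) (abs_error_mul_le hψ z) 4)
      (slab_nonneg _ _ _)
  have h0 : 0 ≤ ∫ z, (z.2 * (ψ z.1 * slab s t z.1)) ^ 2 ∂(margin μ X U) :=
    integral_nonneg fun z => sq_nonneg _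
  gcongr

/-- Controls the remainder on a cell that is not subdivided further: with absolute values inside,
the sum is monotone in `τ`, so the full cell dominates every smaller one. The second moment is
variance plus squared mean, and `|a| ≤ 1 + a²` bounds both by the mass of `weight`. -/
theorem DataAssumption.integral_abs_sum_slab_sq_le (h1 : DataAssumption μ X U τ₀)
    {ψ : Regr p → ℝ} (hψm : Measurable ψ) (hψ : ∀ x, |ψ x| ≤ ‖x‖)
    (s t : ℝ) (n : ℕ) {m : ℝ} (hm : slabMass (margin μ X U) weight s t ≤ m) :
    Integrable (fun ω => (∑ k ∈ Finset.range n,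
      |U (k + 1) ω * ψ (X (k + 1) ω)| * slab s t (X (k + 1) ω)) ^ 2) μ ∧
    ∫ ω, (∑ k ∈ Finset.range n,
      |U (k + 1) ω * ψ (X (k + 1) ω)| * slab s t (X (k + 1) ω)) ^ 2 ∂μ ≤
      (1 + 2 * rhoSum μ X U) * (n * m) + (n : ℝ) ^ 2 * m ^ 2 := by
  have hpm := h1.isProbabilityMeasure_margin
  set g : Regr p × ℝ → ℝ := fun z => |z.2 * ψ z.1| * slab s t z.1 with hg
  have hgm : Measurable g := by
    have : Measurable fun z : Regr p × ℝ => z.2 * ψ z.1 :=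
      measurable_snd.mul (hψm.comp measurable_fst)
    exact this.abs.mul ((measurable_slab s t).comp measurable_fst)
  have h4 := (h1.memLp_error_mul hψm hψ).mono_exponent (p := 2) (by norm_num)
  have hg2 : MemLp g 2 (margin μ X U) := by
    refine h4.mono hgm.aestronglyMeasurable (Eventually.of_forall fun z => ?_)
    rw [Real.norm_eq_abs, Real.norm_eq_abs]
    simp only [hg]
    rw [abs_mul, abs_abs, abs_of_nonneg (slab_nonneg s t z.1)]
    exact mul_le_of_le_one_right (abs_nonneg _) (slab_le_one _ _ _)
  have hi := integrable_mul_slab h1.integrable_weight s t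
  have hmean0 : 0 ≤ ∫ z, g z ∂(margin μ X U) :=
    integral_nonneg fun z => mul_nonneg (abs_nonneg _) (slab_nonneg _ _ _)
  have hmean : ∫ z, g z ∂(margin μ X U) ≤ m := by
    refine le_trans (integral_mono (hg2.integrable (by norm_num)) hi fun z => ?_) hm
    refine mul_le_mul_of_nonneg_right ?_ (slab_nonneg _ _ _)
    have := abs_error_mul_le hψ z
    unfold weight
    nlinarith [sq_nonneg (‖z.2 • z.1‖ - 1)]
  have hsec : ∫ z, g z ^ 2 ∂(margin μ X U) ≤ m := by
    refine le_trans (integral_mono hg2.integrable_sq hi fun z => ?_) hm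
    have e : g z ^ 2 = |z.2 * ψ z.1| ^ 2 * slab s t z.1 := by
      simp only [hg]; rw [mul_pow, slab_sq]
    simp only [e]
    refine mul_le_mul_of_nonneg_right ?_ (slab_nonneg _ _ _)
    have := pow_le_pow_left₀ (abs_nonneg _) (abs_error_mul_le hψ z) 2
    unfold weight
    linarith
  have hL : ∀ i : ℕ, MemLp (fun ω => g (X (i + 1) ω, U (i + 1) ω)) 2 μ := fun i =>
    (h1.memLp_pair hgm _ 2).2 hg2
  have hS : MemLp (fun ω => ∑ k ∈ Finset.range n, g (X (k + 1) ω, U (k + 1) ω)) 2 μ :=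
    memLp_finsetSum _ fun i _ => hL i
  refine ⟨hS.integrable_sq, ?_⟩
  have hES : ∫ ω, ∑ k ∈ Finset.range n, g (X (k + 1) ω, U (k + 1) ω) ∂μ =
      n * ∫ z, g z ∂(margin μ X U) := by
    rw [integral_finsetSum _ fun i _ => (hL i).integrable (by norm_num)]
    simp_rw [h1.integral_pair hgm]
    simp
  have hv := variance_eq_sub hS
  rw [hES] at hv
  have hvar := h1.variance_sum_pair_le hgm hg2 n
  have hR := rhoSum_nonneg (μ := μ) (X := X) (U := U)
  have hn0 : (0 : ℝ) ≤ n := Nat.cast_nonneg n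
  have h3 : (n * ((1 + 2 * rhoSum μ X U) * ∫ z, g z ^ 2 ∂(margin μ X U)) : ℝ) ≤
      (1 + 2 * rhoSum μ X U) * (n * m) := by
    calc _ ≤ (n * ((1 + 2 * rhoSum μ X U) * m) : ℝ) := by gcongr
      _ = _ := by ring
  have h5 : (n * ∫ z, g z ∂(margin μ X U)) ^ 2 ≤ (n : ℝ) ^ 2 * m ^ 2 := by
    rw [mul_pow]; gcongr
  have h6 : ∫ ω, (∑ k ∈ Finset.range n, g (X (k + 1) ω, U (k + 1) ω)) ^ 2 ∂μ =
      Var[fun ω => ∑ k ∈ Finset.range n, g (X (k + 1) ω, U (k + 1) ω); μ] +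
        (n * ∫ z, g z ∂(margin μ X U)) ^ 2 := by
    rw [hv]; simp
  change ∫ ω, (∑ k ∈ Finset.range n, g (X (k + 1) ω, U (k + 1) ω)) ^ 2 ∂μ ≤ _
  rw [h6]
  linarith

/-- Dyadic chaining over `τ ∈ [s, t]` with `K` levels: a part bounded in fourth mean and a
remainder bounded in mean square. -/
theorem DataAssumption.exists_chaining (h1 : DataAssumption μ X U τ₀)
    (hX : ∀ i ω, X i ω 0 = 1) (hL : ∀ t, ∀ᵐ z ∂(margin μ X U), thr z.1 ≠ t)
    {ψ : Regr p → ℝ} (hψm : Measurable ψ) (hψ : ∀ x, |ψ x| ≤ ‖x‖) (n K : ℕ) :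
    ∀ (s t m : ℝ), s ≤ t → slabMass (margin μ X U) weight s t ≤ m →
    ∃ R₁ R₂ : Ω → ℝ, Integrable R₁ μ ∧ Integrable R₂ μ ∧ (∀ ω, 0 ≤ R₁ ω) ∧ (∀ ω, 0 ≤ R₂ ω) ∧
      ∫ ω, R₁ ω ∂μ ≤ noiseConst μ X U * (4000 * ((n : ℝ) ^ 2 * m ^ 2) +
        2500 * ((7 / 5) ^ K - 1) *
          (n * slabMass (margin μ X U) (fun z => ‖z.2 • z.1‖ ^ 4) s t)) ∧
      ∫ ω, R₂ ω ∂μ ≤ (1 + 2 * rhoSum μ X U) * (n * m) + (n : ℝ) ^ 2 * m ^ 2 / 2 ^ K ∧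
      ∀ ω, ∀ τ ∈ Set.Icc s t, ∃ A B : ℝ, 0 ≤ A ∧ 0 ≤ B ∧
        |noise X U (fun x => ψ x * slab s τ x) n ω| ≤ A + B ∧ A ^ 4 ≤ R₁ ω ∧ B ^ 2 ≤ R₂ ω := by
  induction K with
  | zero =>
    intro s t m hst hm
    obtain ⟨hi, hb⟩ := h1.integral_abs_sum_slab_sq_le hψm hψ s t n hm
    refine ⟨fun _ => 0, _, integrable_zero _ _ _, hi, fun _ => le_rfl, fun ω => sq_nonneg _, ?_,
      ?_, fun ω τ hτ => ⟨0, _, le_rfl, ?_, ?_, by simp, le_rfl⟩⟩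
    · have := noiseConst_pos (μ := μ) (X := X) (U := U)
      simp only [integral_zero]
      simp only [pow_zero, sub_self, mul_zero, zero_mul, add_zero]
      positivity
    · simpa using hb
    · exact Finset.sum_nonneg fun k _ => mul_nonneg (abs_nonneg _) (slab_nonneg _ _ _)
    · rw [zero_add]
      refine (Finset.abs_sum_le_sum_abs _ _).trans (Finset.sum_le_sum fun k _ => ?_)
      rw [← mul_assoc, abs_mul, abs_of_nonneg (slab_nonneg s τ _)]
      exact mul_le_mul_of_nonneg_left (slab_mono le_rfl hτ.2 _) (abs_nonneg _)
  | succ K ih =>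
    intro s t m hst hm
    obtain ⟨u, hu, hu1, hu2⟩ := exists_slabMass_half hL h1.integrable_weight weight_nonneg hst
    obtain ⟨R₁, R₂, i1, i2, p1, p2, b1, b2, hc⟩ := ih s u (m / 2) hu.1 (by linarith)
    obtain ⟨R₁', R₂', i1', i2', p1', p2', b1', b2', hc'⟩ := ih u t (m / 2) hu.2 (by linarith)
    have hsu := h1.integral_noise_slab_le hX hψm hψ s u n (m := m / 2) (by linarith)
    have hmeas : Measurable fun x => ψ x * slab s u x := hψm.mul (measurable_slab s u)
    have hmem := h1.memLp_noise hmeas (h1.memLp_error_mul hmeas (abs_mul_slab_le hψ s u)) n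
    have hi4 : Integrable (fun ω => noise X U (fun x => ψ x * slab s u x) n ω ^ 4) μ := by
      simpa using integrable_pow_mul_pow hmem hmem (i := 4) (j := 0) le_rfl
    have hG := slabMass_add h1.integrable_fourth hu.1 hu.2
    have hG1 := slabMass_nonneg (L := margin μ X U) (w := fun z => ‖z.2 • z.1‖ ^ 4)
      (fun z => by positivity) s u
    have hG2 := slabMass_nonneg (L := margin μ X U) (w := fun z => ‖z.2 • z.1‖ ^ 4)
      (fun z => by positivity) u t
    have hC := noiseConst_pos (μ := μ) (X := X) (U := U)
    have hsum : Integrable (fun ω => R₁ ω + R₁' ω) μ := i1.add i1'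
    -- For `τ` beyond the midpoint the noise is that of the whole left half plus a piece of the
    -- right half; before the midpoint only the left half matters. Adding the two children's bounds
    -- replaces the maximum over the halves.
    refine ⟨fun ω => 1000 * noise X U (fun x => ψ x * slab s u x) n ω ^ 4 +
      7 / 5 * (R₁ ω + R₁' ω), fun ω => R₂ ω + R₂' ω,
      (hi4.const_mul _).add (hsum.const_mul _), i2.add i2',
      fun ω => ?_, fun ω => add_nonneg (p2 ω) (p2' ω), ?_, ?_, fun ω τ hτ => ?_⟩
    · have := p1 ω
      have := p1' ω
      positivity
    · rw [integral_add (hi4.const_mul _) (hsum.const_mul _), integral_const_mul,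
        integral_const_mul, integral_add i1 i1', hG]
      set G1 := slabMass (margin μ X U) (fun z => ‖z.2 • z.1‖ ^ 4) s u
      set G2 := slabMass (margin μ X U) (fun z => ‖z.2 • z.1‖ ^ 4) u t
      set C := noiseConst μ X U
      -- For the squared masses, `1000/4 + 2 · (7/5) · 4000/4 = 3050 ≤ 4000`. For the fourth
      -- moments, `a ↦ 7/5 a + 1000` maps `2500 ((7/5)^K - 1)` to the same expression with `K + 1`.
      have e1 : C * ((n : ℝ) ^ 2 * (m / 2) ^ 2 + n * G1) * 1000 +
          7 / 5 * (C * (4000 * ((n : ℝ) ^ 2 * (m / 2) ^ 2) +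
              2500 * ((7 / 5) ^ K - 1) * (n * G1)) +
            C * (4000 * ((n : ℝ) ^ 2 * (m / 2) ^ 2) + 2500 * ((7 / 5) ^ K - 1) * (n * G2))) =
          C * (3050 * ((n : ℝ) ^ 2 * m ^ 2) +
            2500 * ((7 / 5) ^ (K + 1) - 1) * (n * (G1 + G2)) - 1000 * (n * G2)) := by
        rw [pow_succ]; ring
      have e2 : C * (3050 * ((n : ℝ) ^ 2 * m ^ 2) +
            2500 * ((7 / 5) ^ (K + 1) - 1) * (n * (G1 + G2)) - 1000 * (n * G2)) ≤
          C * (4000 * ((n : ℝ) ^ 2 * m ^ 2) +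
            2500 * ((7 / 5) ^ (K + 1) - 1) * (n * (G1 + G2))) := by
        refine mul_le_mul_of_nonneg_left ?_ hC.le
        have : (0 : ℝ) ≤ n * G2 := by positivity
        have : (0 : ℝ) ≤ (n : ℝ) ^ 2 * m ^ 2 := by positivity
        linarith
      linarith
    · rw [integral_add i2 i2']
      -- The linear terms of the two halves add up, while the quadratic ones sum to one half: this
      -- is the gain `2^K` in the squared mean.
      have e : (1 + 2 * rhoSum μ X U) * (n * (m / 2)) + (n : ℝ) ^ 2 * (m / 2) ^ 2 / 2 ^ K +
          ((1 + 2 * rhoSum μ X U) * (n * (m / 2)) + (n : ℝ) ^ 2 * (m / 2) ^ 2 / 2 ^ K) =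
          (1 + 2 * rhoSum μ X U) * (n * m) + (n : ℝ) ^ 2 * m ^ 2 / 2 ^ (K + 1) := by
        rw [pow_succ]; field_simp; ring
      linarith
    · have q1 := p1 ω
      have q2 := p1' ω
      have q3 := p2 ω
      have q4 := p2' ω
      rcases le_total τ u with hτu | hτu
      · obtain ⟨A, B, hA, hB, hAB, hA4, hB2⟩ := hc ω τ ⟨hτ.1, hτu⟩
        refine ⟨A, B, hA, hB, hAB, ?_, by linarith⟩
        have : 0 ≤ noise X U (fun x => ψ x * slab s u x) n ω ^ 4 := by positivity
        linarith
      · obtain ⟨A, B, hA, hB, hAB, hA4, hB2⟩ := hc' ω τ ⟨hτu, hτ.2⟩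
        refine ⟨|noise X U (fun x => ψ x * slab s u x) n ω| + A, B, by positivity, hB, ?_, ?_,
          by linarith⟩
        · rw [noise_slab_add ψ hu.1 hτu]
          refine (abs_add_le _ _).trans ?_
          linarith
        · refine (add_pow_four_le _ _).trans ?_
          rw [Even.pow_abs (by decide)]
          linarith

end Maximal

/-! ### Tail bounds for the noise -/

section Tail

variable {Ω : Type*} [MeasurableSpace Ω] {μ : Measure Ω} [IsProbabilityMeasure μ]
  {p : ℕ} {X : ℤ → Ω → Regr p} {U : ℤ → Ω → ℝ} {τ₀ : ℝ}

omit [IsProbabilityMeasure μ] in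
theorem meas_ge_le_integral_div {R : Ω → ℝ} (hR : Integrable R μ) (h0 : ∀ ω, 0 ≤ R ω)
    {a b : ℝ} (ha : 0 < a) (hb : ∫ ω, R ω ∂μ ≤ b) :
    μ {ω | a ≤ R ω} ≤ ENNReal.ofReal (b / a) := by
  have h := mul_meas_ge_le_lintegral₀ hR.1.aemeasurable.ennreal_ofReal (ENNReal.ofReal a)
  rw [← ofReal_integral_eq_lintegral_ofReal hR (Eventually.of_forall h0)] at h
  have hs : {ω | a ≤ R ω} ⊆ {ω | ENNReal.ofReal a ≤ ENNReal.ofReal (R ω)} := fun ω hω =>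
    ENNReal.ofReal_le_ofReal hω
  rw [ENNReal.ofReal_div_of_pos ha, ENNReal.le_div_iff_mul_le (Or.inl (by simpa using ha))
    (Or.inl ENNReal.ofReal_ne_top), mul_comm]
  exact ((mul_le_mul_right (measure_mono hs) _).trans h).trans (ENNReal.ofReal_le_ofReal hb)

/-- The maximal inequality for the noise over slabs `s < Q ≤ τ`, `τ ∈ [s, t]`. -/
theorem DataAssumption.exists_meas_noise_slab_le (h1 : DataAssumption μ X U τ₀)
    (hX : ∀ i ω, X i ω 0 = 1) (hL : ∀ t, ∀ᵐ z ∂(margin μ X U), thr z.1 ≠ t) :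
    ∃ C : ℝ, 0 < C ∧ ∀ (ψ : Regr p → ℝ), Measurable ψ → (∀ x, |ψ x| ≤ ‖x‖) →
      ∀ (n : ℕ) (s t m lam : ℝ), 1 ≤ n → s ≤ t → slabMass (margin μ X U) weight s t ≤ m →
        0 < m → 1 ≤ n * m ^ 3 → 1 ≤ lam →
        μ {ω | ∃ τ ∈ Set.Icc s t,
          lam * Real.sqrt (n * m) < |noise X U (fun x => ψ x * slab s τ x) n ω|} ≤
          ENNReal.ofReal (C / lam ^ 2) := by
  set G := ∫ z, ‖z.2 • z.1‖ ^ 4 ∂(margin μ X U) with hG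
  have hG0 : 0 ≤ G := integral_nonneg fun z => by positivity
  have hC := noiseConst_pos (μ := μ) (X := X) (U := U)
  have hR := rhoSum_nonneg (μ := μ) (X := X) (U := U)
  set C₁ := noiseConst μ X U * (4000 + 5000 * G) with hC₁
  set C₂ := 2 + 2 * rhoSum μ X U with hC₂
  have hC₁0 : 0 < C₁ := by positivity
  have hC₂0 : 0 < C₂ := by positivity
  refine ⟨16 * C₁ + 4 * C₂, by positivity, ?_⟩
  intro ψ hψm hψ n s t m lam hn hst hm hm0 hnm hlam
  have hn1 : (1 : ℝ) ≤ n := by exact_mod_cast hn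
  have hn0 : (0 : ℝ) < n := by linarith
  have hnm1 : 1 ≤ n * m := by
    rcases le_total 1 m with h | h
    · nlinarith
    · refine hnm.trans (mul_le_mul_of_nonneg_left ?_ hn0.le)
      simpa using pow_le_pow_of_le_one hm0.le h (by norm_num : 1 ≤ 3)
  -- The depth is chosen with `2^K` of the order of `n m`, so that the remainder `n² m² / 2^K` is at
  -- most `n m`.
  obtain ⟨k, hk1, hk2⟩ := exists_nat_pow_near hnm1 (by norm_num : (1 : ℝ) < 2)
  set K := k + 1
  have hKl : n * m ≤ 2 ^ K := hk2.le
  have hKu : (2 : ℝ) ^ K ≤ 2 * (n * m) := by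
    simp only [K, pow_succ]; linarith
  obtain ⟨R₁, R₂, i1, i2, p1, p2, b1, b2, hc⟩ :=
    h1.exists_chaining hX hL hψm hψ n K s t m hst hm
  -- Since `(7/5)² < 2`, the left side is at most `√(2 n m)`, and `n m³ ≥ 1` turns this into `2 n
  -- m²`. Thus the fourth moment term, for which only the total mass `G` is available, is still of
  -- order `n² m²`.
  have hpow : ((7 : ℝ) / 5) ^ K ≤ 2 * n * m ^ 2 := by
    refine le_of_sq_le_sq ?_ (by positivity)
    calc (((7 : ℝ) / 5) ^ K) ^ 2 = (49 / 25) ^ K := by rw [← pow_mul, mul_comm, pow_mul]; norm_num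
      _ ≤ 2 ^ K := pow_le_pow_left₀ (by norm_num) (by norm_num) K
      _ ≤ 2 * (n * m) := hKu
      _ ≤ 4 * (n * m) * (n * m ^ 3) := by nlinarith
      _ = (2 * n * m ^ 2) ^ 2 := by ring
  have hGle : slabMass (margin μ X U) (fun z => ‖z.2 • z.1‖ ^ 4) s t ≤ G :=
    slabMass_le h1.integrable_fourth (fun z => by positivity) s t
  have hG0' := slabMass_nonneg (L := margin μ X U) (w := fun z => ‖z.2 • z.1‖ ^ 4)
    (fun z => by positivity) s t
  have hB1 : ∫ ω, R₁ ω ∂μ ≤ C₁ * ((n : ℝ) ^ 2 * m ^ 2) := by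
    refine b1.trans ?_
    rw [hC₁, mul_assoc (noiseConst μ X U) (4000 + 5000 * G)]
    refine mul_le_mul_of_nonneg_left ?_ hC.le
    have : 2500 * (((7 : ℝ) / 5) ^ K - 1) *
        (n * slabMass (margin μ X U) (fun z => ‖z.2 • z.1‖ ^ 4) s t) ≤
        2500 * (2 * n * m ^ 2) * (n * G) := by
      have : ((7 : ℝ) / 5) ^ K - 1 ≤ 2 * n * m ^ 2 := by linarith
      gcongr
    nlinarith
  have hB2 : ∫ ω, R₂ ω ∂μ ≤ C₂ * (n * m) := by
    refine b2.trans ?_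
    have : (n : ℝ) ^ 2 * m ^ 2 / 2 ^ K ≤ n * m := by
      rw [div_le_iff₀ (by positivity)]
      calc (n : ℝ) ^ 2 * m ^ 2 = n * m * (n * m) := by ring
        _ ≤ n * m * 2 ^ K := by gcongr
    rw [hC₂]
    linarith
  have hlam0 : 0 < lam := by linarith
  have hnm0 : 0 < n * m := by positivity
  have hsub : {ω | ∃ τ ∈ Set.Icc s t,
      lam * Real.sqrt (n * m) < |noise X U (fun x => ψ x * slab s τ x) n ω|} ⊆
      {ω | (lam / 2) ^ 4 * ((n : ℝ) ^ 2 * m ^ 2) ≤ R₁ ω} ∪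
        {ω | (lam / 2) ^ 2 * (n * m) ≤ R₂ ω} := by
    rintro ω ⟨τ, hτ, hlt⟩
    obtain ⟨A, B, hA, hB, hAB, hA4, hB2⟩ := hc ω τ hτ
    have hsq : Real.sqrt (n * m) ^ 2 = n * m := Real.sq_sqrt hnm0.le
    -- One of the two parts must exceed half the level. Markov's inequality is then applied with
    -- power four to the chain and power two to the remainder.
    rcases le_total (lam / 2 * Real.sqrt (n * m)) A with h | h
    · left
      refine le_trans ?_ hA4
      calc (lam / 2) ^ 4 * ((n : ℝ) ^ 2 * m ^ 2) = (lam / 2) ^ 4 * (Real.sqrt (n * m) ^ 2) ^ 2 := by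
            rw [hsq]; ring
        _ = (lam / 2 * Real.sqrt (n * m)) ^ 4 := by ring
        _ ≤ A ^ 4 := pow_le_pow_left₀ (by positivity) h 4
    · right
      refine le_trans ?_ hB2
      calc (lam / 2) ^ 2 * (n * m) = (lam / 2 * Real.sqrt (n * m)) ^ 2 := by rw [mul_pow, hsq]
        _ ≤ B ^ 2 := pow_le_pow_left₀ (by positivity) (by linarith) 2
  refine (measure_mono hsub).trans ((measure_union_le _ _).trans ?_)
  have t1 := meas_ge_le_integral_div i1 p1 (a := (lam / 2) ^ 4 * ((n : ℝ) ^ 2 * m ^ 2))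
    (by positivity) hB1
  have t2 := meas_ge_le_integral_div i2 p2 (a := (lam / 2) ^ 2 * (n * m)) (by positivity) hB2
  refine (add_le_add t1 t2).trans ?_
  rw [← ENNReal.ofReal_add (by positivity) (by positivity)]
  refine ENNReal.ofReal_le_ofReal ?_
  have e1 : C₁ * ((n : ℝ) ^ 2 * m ^ 2) / ((lam / 2) ^ 4 * ((n : ℝ) ^ 2 * m ^ 2)) =
      16 * C₁ / lam ^ 4 := by field_simp; norm_num
  have e2 : C₂ * (n * m) / ((lam / 2) ^ 2 * (n * m)) = 4 * C₂ / lam ^ 2 := by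
    field_simp; norm_num
  have e3 : 16 * C₁ / lam ^ 4 ≤ 16 * C₁ / lam ^ 2 := by
    gcongr
    norm_num
  rw [e1, e2, add_div]
  linarith

/-- Tail bound for the noise with a fixed weight function. -/
theorem DataAssumption.exists_meas_noise_le (h1 : DataAssumption μ X U τ₀)
    (hX : ∀ i ω, X i ω 0 = 1) :
    ∃ C : ℝ, 0 < C ∧ ∀ (ψ : Regr p → ℝ), Measurable ψ → (∀ x, |ψ x| ≤ ‖x‖) →
      ∀ (n : ℕ) (lam : ℝ), 1 ≤ n → 1 ≤ lam →
        μ {ω | lam * Real.sqrt n < |noise X U ψ n ω|} ≤ ENNReal.ofReal (C / lam ^ 2) := by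
  have hpm := h1.isProbabilityMeasure_margin
  set G := ∫ z, ‖z.2 • z.1‖ ^ 4 ∂(margin μ X U) with hG
  set V := ∫ z, ‖z.2 • z.1‖ ^ 2 ∂(margin μ X U) with hV
  have hG0 : 0 ≤ G := integral_nonneg fun z => by positivity
  have hV0 : 0 ≤ V := integral_nonneg fun z => by positivity
  have hC := noiseConst_pos (μ := μ) (X := X) (U := U)
  refine ⟨noiseConst μ X U * (V ^ 2 + G + 1), by positivity, ?_⟩
  intro ψ hψm hψ n lam hn hlam
  have hn1 : (1 : ℝ) ≤ n := by exact_mod_cast hn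
  have h4 := h1.memLp_error_mul hψm hψ
  have hmem := h1.memLp_noise hψm h4 n
  have hi4 : Integrable (fun ω => noise X U ψ n ω ^ 4) μ := by
    simpa using integrable_pow_mul_pow hmem hmem (i := 4) (j := 0) le_rfl
  have hb := h1.integral_noise_pow_four_le hX hψm h4 n
  have hb2 : ∫ z, (z.2 * ψ z.1) ^ 2 ∂(margin μ X U) ≤ V := by
    refine integral_mono (h4.mono_exponent (p := 2) (by norm_num)).integrable_sq
      ((h1.memLp_error_smul.mono_exponent (p := 2) (by norm_num)).integrable_norm_pow
        (p := 2) (by norm_num)) fun z => ?_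
    have := pow_le_pow_left₀ (abs_nonneg _) (abs_error_mul_le hψ z) 2
    rwa [sq_abs] at this
  have hb4 : ∫ z, (z.2 * ψ z.1) ^ 4 ∂(margin μ X U) ≤ G := by
    have hi : Integrable (fun z : Regr p × ℝ => (z.2 * ψ z.1) ^ 4) (margin μ X U) := by
      simpa using integrable_pow_mul_pow h4 h4 (i := 4) (j := 0) le_rfl
    refine integral_mono hi h1.integrable_fourth fun z => ?_
    have := pow_le_pow_left₀ (abs_nonneg _) (abs_error_mul_le hψ z) 4
    rwa [Even.pow_abs (by decide)] at this
  have h0 : 0 ≤ ∫ z, (z.2 * ψ z.1) ^ 2 ∂(margin μ X U) := integral_nonneg fun z => sq_nonneg _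
  have hbd : ∫ ω, noise X U ψ n ω ^ 4 ∂μ ≤
      noiseConst μ X U * (V ^ 2 + G + 1) * (n : ℝ) ^ 2 := by
    refine hb.trans ?_
    rw [mul_assoc]
    refine mul_le_mul_of_nonneg_left ?_ hC.le
    have e1 : (n : ℝ) ^ 2 * (∫ z, (z.2 * ψ z.1) ^ 2 ∂(margin μ X U)) ^ 2 ≤ (n : ℝ) ^ 2 * V ^ 2 := by
      gcongr
    have e2 : (n : ℝ) * ∫ z, (z.2 * ψ z.1) ^ 4 ∂(margin μ X U) ≤ (n : ℝ) ^ 2 * G := by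
      have : (n : ℝ) ≤ (n : ℝ) ^ 2 := by nlinarith
      calc _ ≤ (n : ℝ) * G := by gcongr
        _ ≤ _ := by gcongr
    nlinarith
  have hlam0 : 0 < lam := by linarith
  have t := meas_ge_le_integral_div hi4 (fun ω => by positivity)
    (a := lam ^ 4 * (n : ℝ) ^ 2) (by positivity) hbd
  refine (measure_mono fun ω hω => ?_).trans (t.trans (ENNReal.ofReal_le_ofReal ?_))
  · simp only [Set.mem_ofPred_eq] at hω ⊢
    have h := pow_le_pow_left₀ (by positivity) hω.le 4
    rw [Even.pow_abs (by decide), mul_pow] at h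
    have e : Real.sqrt n ^ 4 = (n : ℝ) ^ 2 := by
      calc Real.sqrt n ^ 4 = (Real.sqrt n ^ 2) ^ 2 := by ring
        _ = _ := by rw [Real.sq_sqrt (by linarith)]
    rwa [e] at h
  · rw [mul_div_mul_right _ _ (by positivity)]
    gcongr
    norm_num

end Tail

/-! ### Integration against the density and conditional means of `Q` -/

section Density

variable {Ω : Type*} [MeasurableSpace Ω] {μ : Measure Ω} [IsProbabilityMeasure μ]
  {p : ℕ} {X : ℤ → Ω → Regr p} {U : ℤ → Ω → ℝ} {τ₀ : ℝ} {T : Set ℝ}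

omit [IsProbabilityMeasure μ] in
/-- Integrals against the law of `q` when `q` has the density `f`. -/
theorem IsDensity.integral_comp {q : Ω → ℝ} (hq : Measurable q) {f : ℝ → ℝ}
    (hf : IsDensity μ q f) {g : ℝ → ℝ} (hg : Measurable g) :
    ∫ ω, g (q ω) ∂μ = ∫ t, f t * g t := by
  rw [← integral_map hq.aemeasurable hg.aestronglyMeasurable, hf.2.2,
    integral_withDensity_eq_integral_toReal_smul hf.1.ennreal_ofReal
      (Eventually.of_forall fun _ => ENNReal.ofReal_lt_top)]
  refine integral_congr_ae (Eventually.of_forall fun t => ?_)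
  simp [ENNReal.toReal_ofReal (hf.2.1 t)]

omit [IsProbabilityMeasure μ] in
theorem IsDensity.integrable_comp {q : Ω → ℝ} (hq : Measurable q) {f : ℝ → ℝ}
    (hf : IsDensity μ q f) {g : ℝ → ℝ} (hg : Measurable g) :
    Integrable (fun ω => g (q ω)) μ ↔ Integrable fun t => f t * g t := by
  have h : Integrable (fun ω => g (q ω)) μ ↔ Integrable g (μ.map q) :=
    (integrable_map_measure hg.aestronglyMeasurable hq.aemeasurable).symm
  rw [h, hf.2.2, integrable_withDensity_iff_integrable_smul' hf.1.ennreal_ofReal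
      (Eventually.of_forall fun _ => ENNReal.ofReal_lt_top)]
  refine integrable_congr (Eventually.of_forall fun t => ?_)
  simp [ENNReal.toReal_ofReal (hf.2.1 t)]

/-- For a version `h` of `E(Z | q)`: `E Z g(q) = ∫ f h g`. -/
theorem IsCondMean.integral_mul_comp {q Z : Ω → ℝ} {h : ℝ → ℝ} (hZ : IsCondMean μ q Z h)
    (hq : Measurable q) (hZi : Integrable Z μ) {g : ℝ → ℝ} (hg : Measurable g)
    (hgb : ∃ c, ∀ t, |g t| ≤ c) :
    ∫ ω, g (q ω) * Z ω ∂μ = ∫ ω, g (q ω) * h (q ω) ∂μ := by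
  have hle : MeasurableSpace.comap q inferInstance ≤ (inferInstance : MeasurableSpace Ω) :=
    hq.comap_le
  have hgm : StronglyMeasurable[MeasurableSpace.comap q inferInstance] fun ω => g (q ω) :=
    (hg.comp (comap_measurable q)).stronglyMeasurable
  obtain ⟨c, hc⟩ := hgb
  have hint : Integrable (fun ω => g (q ω) * Z ω) μ :=
    hZi.bdd_mul (c := c) (hg.comp hq).aestronglyMeasurable
      (Eventually.of_forall fun ω => hc (q ω))
  rw [← integral_condExp hle]
  refine integral_congr_ae ?_
  have hp := condExp_mul_of_stronglyMeasurable_left hgm hint hZi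
  refine hp.trans ?_
  filter_upwards [hZ.2] with ω hω
  simp only [Pi.mul_apply]
  rw [← hω]

end Density

/-! ### Masses of intervals near the threshold -/

section Density

variable {Ω : Type*} [MeasurableSpace Ω] {μ : Measure Ω} [IsProbabilityMeasure μ]
  {p : ℕ} {X : ℤ → Ω → Regr p} {U : ℤ → Ω → ℝ} {τ₀ : ℝ} {T : Set ℝ}

theorem integral_mul_indicator_Ioc_le {g : ℝ → ℝ} {a b c : ℝ} (hab : a ≤ b) (hc : 0 ≤ c)
    (hg : ∀ t ∈ Set.Ioc a b, g t ≤ c) :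
    ∫ t, g t * (Set.Ioc a b).indicator (fun _ => 1) t ≤ c * (b - a) := by
  have hi : Integrable fun t : ℝ => c * (Set.Ioc a b).indicator (fun _ => (1 : ℝ)) t :=
    ((integrable_indicator_iff measurableSet_Ioc).2
      (integrableOn_const (by simp) (by simp))).const_mul c
  have e : ∫ t : ℝ, c * (Set.Ioc a b).indicator (fun _ => (1 : ℝ)) t = c * (b - a) := by
    rw [integral_const_mul, integral_indicator measurableSet_Ioc]
    simp [hab]
  by_cases h : Integrable fun t => g t * (Set.Ioc a b).indicator (fun _ => 1) t
  · rw [← e]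
    refine integral_mono h hi fun t => ?_
    by_cases ht : t ∈ Set.Ioc a b
    · simpa [Set.indicator_of_mem ht] using hg t ht
    · simp [Set.indicator_of_notMem ht]
  -- A non-integrable integrand has integral 0 by convention, so the upper bound persists.
  · rw [integral_undef h]
    have := sub_nonneg.2 hab
    positivity

theorem le_integral_mul_indicator_Ioc {g : ℝ → ℝ} {a b c : ℝ} (hab : a ≤ b)
    (hi : Integrable fun t => g t * (Set.Ioc a b).indicator (fun _ => 1) t)
    (hg : ∀ t ∈ Set.Ioc a b, c ≤ g t) :
    c * (b - a) ≤ ∫ t, g t * (Set.Ioc a b).indicator (fun _ => 1) t := by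
  have hi' : Integrable fun t : ℝ => c * (Set.Ioc a b).indicator (fun _ => (1 : ℝ)) t :=
    ((integrable_indicator_iff measurableSet_Ioc).2
      (integrableOn_const (by simp) (by simp))).const_mul c
  have e : ∫ t : ℝ, c * (Set.Ioc a b).indicator (fun _ => (1 : ℝ)) t = c * (b - a) := by
    rw [integral_const_mul, integral_indicator measurableSet_Ioc]
    simp [hab]
  rw [← e]
  refine integral_mono hi' hi fun t => ?_
  by_cases ht : t ∈ Set.Ioc a b
  · simpa [Set.indicator_of_mem ht] using hg t ht
  · simp [Set.indicator_of_notMem ht]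

theorem measurable_indicator_Ioc (a b : ℝ) :
    Measurable ((Set.Ioc a b).indicator (fun _ => (1 : ℝ))) :=
  measurable_const.indicator measurableSet_Ioc

theorem abs_indicator_Ioc_le (a b t : ℝ) : |(Set.Ioc a b).indicator (fun _ => (1 : ℝ)) t| ≤ 1 := by
  by_cases ht : t ∈ Set.Ioc a b <;> simp [ht]

omit [IsProbabilityMeasure μ] in
theorem DataAssumption.measurable_thr (h1 : DataAssumption μ X U τ₀) :
    Measurable fun ω => thr (X 0 ω) :=
  KinkThreshold.measurable_thr.comp (h1.measurable_X 0)

omit [IsProbabilityMeasure μ] in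
theorem DataAssumption.ae_thr_ne (h1 : DataAssumption μ X U τ₀) {f : ℝ → ℝ}
    (hf : IsDensity μ (fun ω => thr (X 0 ω)) f) (t : ℝ) :
    ∀ᵐ z ∂(margin μ X U), thr z.1 ≠ t := by
  have h : ∀ᵐ s ∂(μ.map fun ω => thr (X 0 ω)), s ≠ t := by
    rw [hf.2.2]
    exact (withDensity_absolutelyContinuous _ _).ae_le (Measure.ae_ne volume t)
  unfold margin
  have hm : MeasurableSet {s : ℝ | s ≠ t} := (measurableSet_singleton t).compl
  have hm' : MeasurableSet {z : Regr p × ℝ | thr z.1 ≠ t} :=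
    (KinkThreshold.measurable_thr.comp measurable_fst) hm
  rw [ae_map_iff (h1.measurable_pair 0).aemeasurable hm']
  exact (ae_map_iff h1.measurable_thr.aemeasurable hm).1 h

omit [IsProbabilityMeasure μ] in
theorem DataAssumption.slabMass_eq (h1 : DataAssumption μ X U τ₀) {w : Regr p × ℝ → ℝ}
    (hw : Measurable w) (s t : ℝ) :
    slabMass (margin μ X U) w s t =
      ∫ ω, w (X 0 ω, U 0 ω) * (Set.Ioc s t).indicator (fun _ => 1) (thr (X 0 ω)) ∂μ := by
  have := h1.integral_pair (g := fun z => w z * slab s t z.1)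
    (hw.mul ((measurable_slab s t).comp measurable_fst)) 0
  exact this.symm

theorem DataAssumption.slabMass_one_eq (h1 : DataAssumption μ X U τ₀) {f : ℝ → ℝ}
    (hf : IsDensity μ (fun ω => thr (X 0 ω)) f) (s t : ℝ) :
    slabMass (margin μ X U) (fun _ => 1) s t =
      ∫ q, f q * (Set.Ioc s t).indicator (fun _ => 1) q ∧
    Integrable fun q => f q * (Set.Ioc s t).indicator (fun _ => 1) q := by
  rw [h1.slabMass_eq measurable_const]
  simp only [one_mul]
  refine ⟨hf.integral_comp h1.measurable_thr (measurable_indicator_Ioc s t), ?_⟩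
  rw [← hf.integrable_comp h1.measurable_thr (measurable_indicator_Ioc s t)]
  exact Integrable.of_bound ((measurable_indicator_Ioc s t).comp
    h1.measurable_thr).aestronglyMeasurable 1
    (Eventually.of_forall fun ω => abs_indicator_Ioc_le _ _ _)

/-- The mass of small intervals around the threshold is at most proportional to their length. -/
theorem exists_slabMass_weight_le (h1 : DataAssumption μ X U τ₀)
    (h2 : ThresholdAssumption μ X U T τ₀) :
    ∃ C : ℝ, 1 ≤ C ∧ ∀ h : ℝ, 0 ≤ h →
      slabMass (margin μ X U) weight (τ₀ - h) (τ₀ + h) ≤ C * h := by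
  obtain ⟨f, D, V, S, m₄, u₄, hf, -, hV, -, -, -, ⟨hfc, hVc, -⟩, -⟩ := h2
  have hq := h1.measurable_thr
  have hVa : ∀ a, ContinuousAt (fun t => V t a a) τ₀ := fun a => by
    have h := continuousAt_pi.1 hVc a
    exact continuousAt_pi.1 h a
  have hsum : ContinuousAt (fun t => f t * (1 + ∑ a, V t a a)) τ₀ :=
    hfc.mul (continuousAt_const.add (tendsto_finsetSum _ fun a _ => hVa a))
  -- Conditioning on `Q` shows that the weight `1 + ‖X U‖²` has density `f (1 + tr V)` in `Q`.
  -- Continuity at `τ₀` bounds it by `B` nearby.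
  set B := |f τ₀ * (1 + ∑ a, V τ₀ a a)| + 1 with hB
  have hB0 : 0 < B := by positivity
  have hev : ∀ᶠ t in 𝓝 τ₀, f t * (1 + ∑ a, V t a a) < B :=
    hsum.eventually_lt_const (by rw [hB]; linarith [le_abs_self (f τ₀ * (1 + ∑ a, V τ₀ a a))])
  obtain ⟨ε, hε, hball⟩ := Metric.eventually_nhds_iff.1 hev
  have hrep : ∀ s t, slabMass (margin μ X U) weight s t =
      ∫ q, (f q * (1 + ∑ a, V q a a)) * (Set.Ioc s t).indicator (fun _ => 1) q := by
    intro s t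
    have hmI := measurable_indicator_Ioc s t
    have hmw : Measurable (weight : Regr p × ℝ → ℝ) := by
      unfold weight; fun_prop
    rw [h1.slabMass_eq hmw]
    have hXU : ∀ a, Integrable (fun ω => X 0 ω a * X 0 ω a * U 0 ω ^ 2) μ := by
      intro a
      have hm : Measurable fun z : Regr p × ℝ => z.1 a * z.1 a * z.2 ^ 2 := by fun_prop
      rw [h1.integrable_pair hm 0]
      refine Integrable.mono' h1.integrable_weight hm.aestronglyMeasurable
        (Eventually.of_forall fun z => ?_)
      have e : z.1 a * z.1 a * z.2 ^ 2 = (‖(z.2 • z.1) a‖) ^ 2 := by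
        simp only [PiLp.smul_apply, smul_eq_mul, Real.norm_eq_abs, sq_abs]; ring
      rw [e, Real.norm_of_nonneg (by positivity)]
      have := pow_le_pow_left₀ (norm_nonneg _) (PiLp.norm_apply_le (z.2 • z.1) a) 2
      unfold weight
      linarith
    have hVm : ∀ a, Measurable fun t => V t a a := fun a => (hV a a).1
    have hVi : ∀ a, Integrable (fun ω => V (thr (X 0 ω)) a a) μ := fun a =>
      integrable_condExp.congr (hV a a).2.symm
    have hbd : ∀ {Z : Ω → ℝ}, Integrable Z μ → Integrable (fun ω =>
        (Set.Ioc s t).indicator (fun _ => (1 : ℝ)) (thr (X 0 ω)) * Z ω) μ := fun hZ =>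
      hZ.bdd_mul (c := 1) (hmI.comp hq).aestronglyMeasurable
        (Eventually.of_forall fun ω => abs_indicator_Ioc_le s t _)
    have e1 : ∀ ω, weight (X 0 ω, U 0 ω) * (Set.Ioc s t).indicator (fun _ => 1) (thr (X 0 ω)) =
        (Set.Ioc s t).indicator (fun _ => 1) (thr (X 0 ω)) * 1 +
          ∑ a, (Set.Ioc s t).indicator (fun _ => 1) (thr (X 0 ω)) *
            (X 0 ω a * X 0 ω a * U 0 ω ^ 2) := by
      intro ω
      rw [← Finset.mul_sum, ← mul_add, mul_comm]
      congr 1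
      unfold weight
      rw [EuclideanSpace.norm_sq_eq]
      congr 1
      refine Finset.sum_congr rfl fun a _ => ?_
      simp only [PiLp.smul_apply, smul_eq_mul, Real.norm_eq_abs, sq_abs]
      ring
    have e2 : ∀ ω, (1 + ∑ a, V (thr (X 0 ω)) a a) *
          (Set.Ioc s t).indicator (fun _ => 1) (thr (X 0 ω)) =
        (Set.Ioc s t).indicator (fun _ => 1) (thr (X 0 ω)) * 1 +
          ∑ a, (Set.Ioc s t).indicator (fun _ => 1) (thr (X 0 ω)) * V (thr (X 0 ω)) a a := by
      intro ω
      rw [← Finset.mul_sum, ← mul_add, mul_comm]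
    have e3 := hf.integral_comp hq (g := fun t' => (1 + ∑ a, V t' a a) *
      (Set.Ioc s t).indicator (fun _ => 1) t')
      ((measurable_const.add (Finset.measurable_fun_sum _ fun a _ => hVm a)).mul hmI)
    simp only [← mul_assoc] at e3
    rw [← e3]
    simp_rw [e1, e2]
    rw [integral_add (hbd (integrable_const 1)) (integrable_finsetSum _ fun a _ => hbd (hXU a)),
      integral_add (hbd (integrable_const 1)) (integrable_finsetSum _ fun a _ => hbd (hVi a)),
      integral_finsetSum _ fun a _ => hbd (hXU a), integral_finsetSum _ fun a _ => hbd (hVi a)]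
    congr 1
    refine Finset.sum_congr rfl fun a _ => ?_
    exact (hV a a).integral_mul_comp hq (hXU a) hmI ⟨1, abs_indicator_Ioc_le s t⟩
  set N := ∫ z, weight z ∂(margin μ X U) with hN
  have hN0 : 0 ≤ N := integral_nonneg weight_nonneg
  -- Intervals with `h ≤ ε/2` have length `2h` and density at most `B`; for larger `h` the total
  -- mass `N` is at most `N / (ε/2) * h`. This makes the bound linear for all `h`.
  refine ⟨1 + 2 * B + N / (ε / 2), by have : 0 ≤ N / (ε / 2) := by positivity
                                      linarith, fun h hh => ?_⟩
  rcases le_total h (ε / 2) with hle | hle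
  · rw [hrep]
    refine (integral_mul_indicator_Ioc_le (by linarith) hB0.le fun t ht => ?_).trans ?_
    · refine (hball ?_).le
      rw [Real.dist_eq, abs_lt]
      constructor <;> linarith [ht.1, ht.2]
    · have : 0 ≤ N / (ε / 2) * h := by positivity
      nlinarith
  · refine (slabMass_le h1.integrable_weight weight_nonneg _ _).trans ?_
    have : N ≤ N / (ε / 2) * h := by
      rw [div_mul_eq_mul_div, le_div_iff₀ (by positivity)]
      gcongr
    nlinarith

theorem DataAssumption.exists_mass_ge (h1 : DataAssumption μ X U τ₀) {f : ℝ → ℝ}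
    (hf : IsDensity μ (fun ω => thr (X 0 ω)) f) {t : ℝ} (ht : 0 < f t) (hc : ContinuousAt f t) :
    ∃ ε : ℝ, 0 < ε ∧ ∀ a b, t - ε ≤ a → a ≤ b → b ≤ t + ε →
      f t / 2 * (b - a) ≤ slabMass (margin μ X U) (fun _ => 1) a b := by
  obtain ⟨ε, hε, hball⟩ := Metric.eventually_nhds_iff.1
    (hc.eventually_const_lt (by linarith : f t / 2 < f t))
  refine ⟨ε / 2, by positivity, fun a b ha hab hb => ?_⟩
  obtain ⟨e, hi⟩ := h1.slabMass_one_eq hf a b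
  rw [e]
  refine le_integral_mul_indicator_Ioc hab hi fun s hs => (hball ?_).le
  rw [Real.dist_eq, abs_lt]
  constructor <;> linarith [hs.1, hs.2]

/-- The weight `(Q - τ₀)²`. -/
noncomputable def kinkSq (τ₀ : ℝ) (z : Regr p × ℝ) : ℝ := (thr z.1 - τ₀) ^ 2

theorem measurable_kinkSq : Measurable (kinkSq τ₀ : Regr p × ℝ → ℝ) :=
  ((KinkThreshold.measurable_thr.comp measurable_fst).sub_const τ₀).pow_const 2

theorem kinkSq_slab_le {h : ℝ} {s t : ℝ} (hs : τ₀ - h ≤ s) (ht : t ≤ τ₀ + h)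
    (z : Regr p × ℝ) : kinkSq τ₀ z * slab s t z.1 ≤ h ^ 2 * slab s t z.1 := by
  unfold slab kinkSq
  by_cases hz : thr z.1 ∈ Set.Ioc s t
  · simp only [Set.indicator_of_mem hz, mul_one]
    rw [← sq_abs]
    refine pow_le_pow_left₀ (abs_nonneg _) (abs_le.2 ⟨?_, ?_⟩) 2 <;> linarith [hz.1, hz.2]
  · simp [Set.indicator_of_notMem hz]

theorem slabMass_one_le (h1 : DataAssumption μ X U τ₀) (s t : ℝ) :
    slabMass (margin μ X U) (fun _ => 1) s t ≤ slabMass (margin μ X U) weight s t := by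
  have := h1.isProbabilityMeasure_margin
  refine integral_mono (integrable_mul_slab (integrable_const 1) s t)
    (integrable_mul_slab h1.integrable_weight s t) fun z => ?_
  refine mul_le_mul_of_nonneg_right ?_ (slab_nonneg _ _ _)
  have : 0 ≤ ‖z.2 • z.1‖ ^ 2 := by positivity
  unfold weight
  linarith

theorem slabMass_one_mono (h1 : DataAssumption μ X U τ₀) {s t s' t' : ℝ} (hs : s' ≤ s)
    (ht : t ≤ t') : slabMass (margin μ X U) (fun _ => 1) s t ≤
      slabMass (margin μ X U) (fun _ => 1) s' t' := by
  have := h1.isProbabilityMeasure_margin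
  refine integral_mono (integrable_mul_slab (integrable_const 1) s t)
    (integrable_mul_slab (integrable_const 1) s' t') fun z => ?_
  simpa using slab_mono hs ht z.1

theorem memLp_kinkSq_slab (h1 : DataAssumption μ X U τ₀) (s t : ℝ) :
    MemLp (fun z : Regr p × ℝ => kinkSq τ₀ z * slab s t z.1) 2 (margin μ X U) := by
  have := h1.isProbabilityMeasure_margin
  have hm : Measurable fun z : Regr p × ℝ => kinkSq τ₀ z * slab s t z.1 :=
    measurable_kinkSq.mul ((measurable_slab s t).comp measurable_fst)
  refine MemLp.of_bound hm.aestronglyMeasurable ((|s - τ₀| + |t - τ₀|) ^ 2)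
    (Eventually.of_forall fun z => ?_)
  have h0 : 0 ≤ kinkSq τ₀ z * slab s t z.1 := mul_nonneg (sq_nonneg _) (slab_nonneg _ _ _)
  rw [Real.norm_of_nonneg h0]
  refine (kinkSq_slab_le (h := |s - τ₀| + |t - τ₀|) ?_ ?_ z).trans
    (mul_le_of_le_one_right (sq_nonneg _) (slab_le_one _ _ _))
  · have := neg_abs_le (s - τ₀)
    have := abs_nonneg (t - τ₀)
    linarith
  · have := le_abs_self (t - τ₀)
    have := abs_nonneg (s - τ₀)
    linarith

theorem slabMass_kinkSq_le (h1 : DataAssumption μ X U τ₀) {h s t : ℝ}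
    (hs : τ₀ - h ≤ s) (ht : t ≤ τ₀ + h) :
    slabMass (margin μ X U) (kinkSq τ₀) s t ≤
      h ^ 2 * slabMass (margin μ X U) (fun _ => 1) s t := by
  have := h1.isProbabilityMeasure_margin
  unfold slabMass
  rw [← integral_const_mul]
  refine integral_mono ((memLp_kinkSq_slab h1 s t).integrable (by norm_num))
    ((integrable_mul_slab (integrable_const 1) s t).const_mul _) fun z => ?_
  simpa using kinkSq_slab_le hs ht z

theorem integral_kinkSq_slab_sq_le (h1 : DataAssumption μ X U τ₀) {h s t : ℝ}
    (hs : τ₀ - h ≤ s) (ht : t ≤ τ₀ + h) :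
    ∫ z, (kinkSq τ₀ z * slab s t z.1) ^ 2 ∂(margin μ X U) ≤
      h ^ 4 * slabMass (margin μ X U) (fun _ => 1) s t := by
  have := h1.isProbabilityMeasure_margin
  unfold slabMass
  rw [← integral_const_mul]
  refine integral_mono (memLp_kinkSq_slab h1 s t).integrable_sq
    ((integrable_mul_slab (integrable_const 1) s t).const_mul _) fun z => ?_
  have h0 : 0 ≤ kinkSq τ₀ z * slab s t z.1 := mul_nonneg (sq_nonneg _) (slab_nonneg _ _ _)
  have := pow_le_pow_left₀ h0 (kinkSq_slab_le hs ht z) 2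
  simp only [one_mul]
  refine this.trans (le_of_eq ?_)
  rw [mul_pow, slab_sq]
  ring

theorem le_slabMass_kinkSq (h1 : DataAssumption μ X U τ₀) {s t s' t' r : ℝ} (hs : s ≤ s')
    (ht : t' ≤ t) (hr : 0 ≤ r) (hfar : τ₀ + r ≤ s' ∨ t' ≤ τ₀ - r) :
    r ^ 2 * slabMass (margin μ X U) (fun _ => 1) s' t' ≤
      slabMass (margin μ X U) (kinkSq τ₀) s t := by
  have := h1.isProbabilityMeasure_margin
  unfold slabMass
  rw [← integral_const_mul]
  refine integral_mono ((integrable_mul_slab (integrable_const 1) s' t').const_mul _)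
    ((memLp_kinkSq_slab h1 s t).integrable (by norm_num)) fun z => ?_
  have hle : r ^ 2 * slab s' t' z.1 ≤ kinkSq τ₀ z * slab s' t' z.1 := by
    unfold slab kinkSq
    by_cases hz : thr z.1 ∈ Set.Ioc s' t'
    · simp only [Set.indicator_of_mem hz, mul_one]
      rcases hfar with h | h
      · nlinarith [hz.1]
      · nlinarith [hz.2]
    · simp [Set.indicator_of_notMem hz]
  simp only [one_mul]
  exact hle.trans (mul_le_mul_of_nonneg_left (slab_mono hs ht _) (sq_nonneg _))

/-- `E (Q - τ₀)² 𝟙{s < Q ≤ t}` is of the order `h³` for the one-sided intervals of length `h` at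
the threshold. -/
theorem exists_slabMass_kinkSq_ge (h1 : DataAssumption μ X U τ₀)
    (h2 : ThresholdAssumption μ X U T τ₀) (hτ₀ : τ₀ ∈ T) {H : ℝ} (hH : 0 < H) :
    ∃ c : ℝ, 0 < c ∧ ∀ h : ℝ, 0 < h → h ≤ H →
      c * h ^ 3 ≤ slabMass (margin μ X U) (kinkSq τ₀) τ₀ (τ₀ + h) ∧
      c * h ^ 3 ≤ slabMass (margin μ X U) (kinkSq τ₀) (τ₀ - h) τ₀ := by
  obtain ⟨f, D, V, S, m₄, u₄, hf, -, -, -, -, -, -, hpos, -⟩ := h2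
  obtain ⟨⟨hf0, hfc⟩, -⟩ := hpos τ₀ hτ₀
  obtain ⟨ε, hε, hmass⟩ := h1.exists_mass_ge hf hf0 hfc
  -- Shrinking `h` by `κ` keeps `κ h` within the neighbourhood where the density exceeds `f τ₀ / 2`,
  -- for every `h ≤ H`.
  set κ := min 1 (ε / H) with hκ
  have hκ0 : 0 < κ := lt_min one_pos (by positivity)
  -- On the outer half of the interval of length `κ h` the weight is at least `(κ h / 2)²`, and this
  -- half has mass at least `f τ₀ / 2 · κ h / 2`.
  refine ⟨κ ^ 3 * f τ₀ / 16, by positivity, fun h hh hhH => ?_⟩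
  have hk : κ * h ≤ h := mul_le_of_le_one_left hh.le (min_le_left _ _)
  have hkε : κ * h ≤ ε := by
    calc κ * h ≤ ε / H * H := by
          gcongr
          exact min_le_right _ _
      _ = ε := by field_simp
  have hκh : 0 < κ * h := by positivity
  have e : κ ^ 3 * f τ₀ / 16 * h ^ 3 = (κ * h / 2) ^ 2 * (f τ₀ / 2 * (κ * h - κ * h / 2)) := by
    ring
  rw [e]
  constructor
  · refine le_trans ?_ (le_slabMass_kinkSq h1 (s' := τ₀ + κ * h / 2) (t' := τ₀ + κ * h)
      (r := κ * h / 2) (by linarith) (by linarith) (by linarith) (Or.inl le_rfl))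
    refine mul_le_mul_of_nonneg_left ?_ (sq_nonneg _)
    have := hmass (τ₀ + κ * h / 2) (τ₀ + κ * h) (by linarith) (by linarith) (by linarith)
    refine le_trans (le_of_eq ?_) this
    ring
  · refine le_trans ?_ (le_slabMass_kinkSq h1 (s' := τ₀ - κ * h) (t' := τ₀ - κ * h / 2)
      (r := κ * h / 2) (by linarith) (by linarith) (by linarith) (Or.inr le_rfl))
    refine mul_le_mul_of_nonneg_left ?_ (sq_nonneg _)
    have := hmass (τ₀ - κ * h) (τ₀ - κ * h / 2) (by linarith) (by linarith) (by linarith)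
    refine le_trans (le_of_eq ?_) this
    ring

end Density

/-! ### Quadratic forms in the regressors: positivity and empirical lower bounds -/

section Forms

variable {Ω : Type*} [MeasurableSpace Ω] {μ : Measure Ω} [IsProbabilityMeasure μ]
  {p : ℕ} {X : ℤ → Ω → Regr p} {U : ℤ → Ω → ℝ} {τ₀ : ℝ} {T : Set ℝ}

theorem inner_regr (x e : Regr p) : inner ℝ x e = ∑ a, e a * x a := by
  simp [PiLp.inner_apply]

theorem inner_regr_split (x e : Regr p) :
    inner ℝ x e = e 0 * x 0 + (∑ j, mid e j * mid x j) + thr e * thr x := by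
  rw [inner_regr, Fin.sum_univ_succ, Fin.sum_univ_castSucc]
  simp only [mid, thr, Fin.succ_last]
  ring

theorem inner_sq_regr (x e : Regr p) :
    inner ℝ x e ^ 2 = ∑ a, ∑ b, e a * e b * (x a * x b) := by
  rw [inner_regr, sq, Finset.sum_mul_sum]
  refine Finset.sum_congr rfl fun a _ => Finset.sum_congr rfl fun b _ => ?_
  ring

omit [IsProbabilityMeasure μ] in
theorem DataAssumption.memLp_regressor (h1 : DataAssumption μ X U τ₀) :
    MemLp (fun z : Regr p × ℝ => z.1) 4 (margin μ X U) := by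
  refine (integrable_norm_rpow_iff measurable_fst.aestronglyMeasurable (by norm_num)
    (by norm_num)).1 ?_
  have h := (h1.integrable_pair (g := fun z : Regr p × ℝ => ‖z.1‖ ^ 4)
    (measurable_fst.norm.pow_const 4) 0).1 h1.moment_X
  refine h.congr (Eventually.of_forall fun z => ?_)
  simp only [ENNReal.toReal_ofNat]
  norm_cast

omit [IsProbabilityMeasure μ] in
theorem DataAssumption.memLp_coord (h1 : DataAssumption μ X U τ₀) (a : Fin (p + 2)) :
    MemLp (fun z : Regr p × ℝ => z.1 a) 4 (margin μ X U) := by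
  have hm : Measurable fun z : Regr p × ℝ => z.1 a := by fun_prop
  exact h1.memLp_regressor.mono hm.aestronglyMeasurable
    (Eventually.of_forall fun z => PiLp.norm_apply_le z.1 a)

theorem DataAssumption.memLp_weighted (h1 : DataAssumption μ X U τ₀) {w : Regr p → ℝ}
    (hw : Measurable w) (hwb : ∀ x, |w x| ≤ 1) (a b : Fin (p + 2)) :
    MemLp (fun z : Regr p × ℝ => w z.1 * (z.1 a * z.1 b)) 2 (margin μ X U) := by
  have := h1.isProbabilityMeasure_margin
  have hm : Measurable fun z : Regr p × ℝ => z.1 a * z.1 b := by fun_prop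
  have hab : MemLp (fun z : Regr p × ℝ => z.1 a * z.1 b) 2 (margin μ X U) := by
    refine (memLp_two_iff_integrable_sq hm.aestronglyMeasurable).2 ?_
    refine (integrable_pow_mul_pow (h1.memLp_coord a) (h1.memLp_coord b) (i := 2) (j := 2)
      le_rfl).congr (Eventually.of_forall fun z => ?_)
    simp only
    ring
  refine hab.mono ((hw.comp measurable_fst).mul hm).aestronglyMeasurable
    (Eventually.of_forall fun z => ?_)
  rw [norm_mul]
  exact mul_le_of_le_one_left (norm_nonneg _) (hwb z.1)

theorem DataAssumption.integral_form (h1 : DataAssumption μ X U τ₀) {w : Regr p → ℝ}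
    (hw : Measurable w) (hwb : ∀ x, |w x| ≤ 1) (e : Regr p) :
    ∫ z, w z.1 * inner ℝ z.1 e ^ 2 ∂(margin μ X U) =
      ∑ a, ∑ b, e a * e b * ∫ z, w z.1 * (z.1 a * z.1 b) ∂(margin μ X U) := by
  have := h1.isProbabilityMeasure_margin
  have hi : ∀ a b, Integrable (fun z : Regr p × ℝ => e a * e b * (w z.1 * (z.1 a * z.1 b)))
      (margin μ X U) := fun a b =>
    ((h1.memLp_weighted hw hwb a b).integrable (by norm_num)).const_mul _
  have e1 : ∀ z : Regr p × ℝ, w z.1 * inner ℝ z.1 e ^ 2 =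
      ∑ a, ∑ b, e a * e b * (w z.1 * (z.1 a * z.1 b)) := by
    intro z
    rw [inner_sq_regr, Finset.mul_sum]
    refine Finset.sum_congr rfl fun a _ => ?_
    rw [Finset.mul_sum]
    refine Finset.sum_congr rfl fun b _ => ?_
    ring
  simp_rw [e1]
  rw [integral_finsetSum _ fun a _ => integrable_finsetSum _ fun b _ => hi a b]
  refine Finset.sum_congr rfl fun a _ => ?_
  rw [integral_finsetSum _ fun b _ => hi a b]
  refine Finset.sum_congr rfl fun b _ => ?_
  rw [integral_const_mul]

/-- A strictly positive continuous quadratic form is bounded below on the unit sphere. -/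
theorem exists_form_lower_bound {m : Fin (p + 2) → Fin (p + 2) → ℝ}
    (hpos : ∀ e : Regr p, e ≠ 0 → 0 < ∑ a, ∑ b, e a * e b * m a b) :
    ∃ c : ℝ, 0 < c ∧ ∀ e : Regr p, c * ‖e‖ ^ 2 ≤ ∑ a, ∑ b, e a * e b * m a b := by
  set q : Regr p → ℝ := fun e => ∑ a, ∑ b, e a * e b * m a b with hq
  have hcont : Continuous q := by
    rw [hq]
    fun_prop
  have hsph : IsCompact (Metric.sphere (0 : Regr p) 1) := isCompact_sphere 0 1
  have hne : (Metric.sphere (0 : Regr p) 1).Nonempty := NormedSpace.sphere_nonempty.2 zero_le_one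
  obtain ⟨e₀, he₀, hmin⟩ := hsph.exists_isMinOn hne hcont.continuousOn
  have he₀0 : e₀ ≠ 0 := by
    rintro rfl
    simp at he₀
  refine ⟨q e₀, hpos e₀ he₀0, fun e => ?_⟩
  rcases eq_or_ne e 0 with rfl | he
  · simp
  have hn : 0 < ‖e‖ := norm_pos_iff.2 he
  have h := hmin (show ‖e‖⁻¹ • e ∈ Metric.sphere (0 : Regr p) 1 by
    simp [norm_smul, hn.ne'])
  simp only [Set.mem_ofPred_eq] at h
  have hs : q (‖e‖⁻¹ • e) = (‖e‖ ^ 2)⁻¹ * q e := by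
    simp only [hq, PiLp.smul_apply, smul_eq_mul, Finset.mul_sum]
    refine Finset.sum_congr rfl fun a _ => Finset.sum_congr rfl fun b _ => ?_
    field_simp
  rw [hs] at h
  calc q e₀ * ‖e‖ ^ 2 ≤ (‖e‖ ^ 2)⁻¹ * q e * ‖e‖ ^ 2 := by gcongr
    _ = q e := by field_simp

theorem sum_abs_sq_le (e : Regr p) : (∑ a, |e a|) ^ 2 ≤ (p + 2) * ‖e‖ ^ 2 := by
  have h := sq_sum_le_card_mul_sum_sq (s := (Finset.univ : Finset (Fin (p + 2))))
    (f := fun a => |e a|)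
  rw [EuclideanSpace.norm_sq_eq]
  simpa using h

/-- Empirical quadratic forms are bounded below with large probability. -/
theorem DataAssumption.exists_meas_form_le (h1 : DataAssumption μ X U τ₀) {w : Regr p → ℝ}
    (hw : Measurable w) (hwb : ∀ x, |w x| ≤ 1)
    (hpos : ∀ e : Regr p, e ≠ 0 → 0 < ∫ z, w z.1 * inner ℝ z.1 e ^ 2 ∂(margin μ X U)) :
    ∃ c C : ℝ, 0 < c ∧ 0 < C ∧ ∀ n : ℕ, 1 ≤ n →
      μ {ω | ¬ ∀ e : Regr p, c * n * ‖e‖ ^ 2 ≤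
        ∑ k ∈ Finset.range n, w (X (k + 1) ω) * inner ℝ (X (k + 1) ω) e ^ 2} ≤
      ENNReal.ofReal (C / n) := by
  set m : Fin (p + 2) → Fin (p + 2) → ℝ :=
    fun a b => ∫ z, w z.1 * (z.1 a * z.1 b) ∂(margin μ X U) with hm
  obtain ⟨c, hc, hcl⟩ := exists_form_lower_bound (m := m) fun e he => by
    rw [← h1.integral_form hw hwb]
    exact hpos e he
  set d : ℝ := p + 2 with hd
  have hd0 : 0 < d := by positivity
  have hR := rhoSum_nonneg (μ := μ) (X := X) (U := U)
  set s2 : Fin (p + 2) → Fin (p + 2) → ℝ :=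
    fun a b => ∫ z, (w z.1 * (z.1 a * z.1 b)) ^ 2 ∂(margin μ X U) with hs2
  have hs20 : ∀ a b, 0 ≤ s2 a b := fun a b => integral_nonneg fun z => sq_nonneg _
  -- If all entries of the empirical matrix are within `η n` of their means, the form changes by at
  -- most `η n (∑ |e a|)² ≤ η n d ‖e‖²`, which is half the population bound.
  set η := c / (2 * d) with hη
  have hη0 : 0 < η := by positivity
  refine ⟨c / 2, (∑ a, ∑ b, (1 + 2 * rhoSum μ X U) * s2 a b / η ^ 2) + 1, by positivity, ?_,
    fun n hn => ?_⟩
  · have : 0 ≤ ∑ a, ∑ b, (1 + 2 * rhoSum μ X U) * s2 a b / η ^ 2 :=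
      Finset.sum_nonneg fun a _ => Finset.sum_nonneg fun b _ => by
        have := hs20 a b
        positivity
    linarith
  have hn0 : (0 : ℝ) < n := by exact_mod_cast hn
  set E : Fin (p + 2) → Fin (p + 2) → Set Ω := fun a b =>
    {ω | η * n < |∑ k ∈ Finset.range n, w (X (k + 1) ω) * (X (k + 1) ω a * X (k + 1) ω b) -
      n * m a b|} with hE
  have hEm : ∀ a b, μ (E a b) ≤
      ENNReal.ofReal ((1 + 2 * rhoSum μ X U) * s2 a b / (η ^ 2 * n)) := by
    intro a b
    have hgm : Measurable fun z : Regr p × ℝ => w z.1 * (z.1 a * z.1 b) := by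
      have : Measurable fun z : Regr p × ℝ => z.1 a * z.1 b := by fun_prop
      exact (hw.comp measurable_fst).mul this
    exact h1.meas_sum_pair_deviation_le hgm (h1.memLp_weighted hw hwb a b) n hη0
  have hsub : {ω | ¬ ∀ e : Regr p, c / 2 * n * ‖e‖ ^ 2 ≤
        ∑ k ∈ Finset.range n, w (X (k + 1) ω) * inner ℝ (X (k + 1) ω) e ^ 2} ⊆
      ⋃ a ∈ (Finset.univ : Finset (Fin (p + 2))), ⋃ b ∈ (Finset.univ : Finset (Fin (p + 2))),
        E a b := by
    intro ω hω
    by_contra hcon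
    refine hω fun e => ?_
    have hsmall : ∀ a b, |∑ k ∈ Finset.range n,
        w (X (k + 1) ω) * (X (k + 1) ω a * X (k + 1) ω b) - n * m a b| ≤ η * n := by
      intro a b
      by_contra hlt
      refine hcon ?_
      simp only [Set.mem_iUnion]
      exact ⟨a, Finset.mem_univ a, b, Finset.mem_univ b, not_le.1 hlt⟩
    have hexp : ∑ k ∈ Finset.range n, w (X (k + 1) ω) * inner ℝ (X (k + 1) ω) e ^ 2 =
        ∑ a, ∑ b, e a * e b * ∑ k ∈ Finset.range n,
          w (X (k + 1) ω) * (X (k + 1) ω a * X (k + 1) ω b) := by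
      simp_rw [Finset.mul_sum]
      rw [Finset.sum_congr rfl fun a _ => Finset.sum_comm, Finset.sum_comm]
      refine Finset.sum_congr rfl fun k _ => ?_
      rw [inner_sq_regr, Finset.mul_sum]
      refine Finset.sum_congr rfl fun a _ => ?_
      rw [Finset.mul_sum]
      refine Finset.sum_congr rfl fun b _ => ?_
      ring
    have hdiff : n * (∑ a, ∑ b, e a * e b * m a b) - ∑ k ∈ Finset.range n,
        w (X (k + 1) ω) * inner ℝ (X (k + 1) ω) e ^ 2 ≤ η * n * (∑ a, |e a|) ^ 2 := by
      rw [hexp, Finset.mul_sum, ← Finset.sum_sub_distrib, sq, Finset.sum_mul_sum, Finset.mul_sum]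
      refine Finset.sum_le_sum fun a _ => ?_
      rw [Finset.mul_sum, ← Finset.sum_sub_distrib, Finset.mul_sum]
      refine Finset.sum_le_sum fun b _ => ?_
      have h := hsmall a b
      rw [abs_sub_comm] at h
      calc n * (e a * e b * m a b) - e a * e b * ∑ k ∈ Finset.range n,
            w (X (k + 1) ω) * (X (k + 1) ω a * X (k + 1) ω b)
          = e a * e b * (n * m a b - ∑ k ∈ Finset.range n,
            w (X (k + 1) ω) * (X (k + 1) ω a * X (k + 1) ω b)) := by ring
        _ ≤ |e a * e b| * (η * n) := by
            refine (le_abs_self _).trans ?_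
            rw [abs_mul]
            exact mul_le_mul_of_nonneg_left h (abs_nonneg _)
        _ = η * n * (|e a| * |e b|) := by rw [abs_mul]; ring
    have h3 : η * n * (∑ a, |e a|) ^ 2 ≤ c / 2 * n * ‖e‖ ^ 2 := by
      calc η * n * (∑ a, |e a|) ^ 2 ≤ η * n * (d * ‖e‖ ^ 2) := by
            have := sum_abs_sq_le e
            gcongr
        _ = c / 2 * n * ‖e‖ ^ 2 := by rw [hη]; field_simp
    have h4 : n * (c * ‖e‖ ^ 2) ≤ n * ∑ a, ∑ b, e a * e b * m a b :=
      mul_le_mul_of_nonneg_left (hcl e) hn0.le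
    linarith
  refine (measure_mono hsub).trans ((measure_biUnion_finset_le _ _).trans ?_)
  refine (Finset.sum_le_sum fun a _ => (measure_biUnion_finset_le _ _).trans
    (Finset.sum_le_sum fun b _ => hEm a b)).trans ?_
  have hnn : ∀ a b, 0 ≤ (1 + 2 * rhoSum μ X U) * s2 a b / (η ^ 2 * n) := fun a b => by
    have := hs20 a b
    positivity
  rw [Finset.sum_congr rfl fun a _ => (ENNReal.ofReal_sum_of_nonneg fun b _ => hnn a b).symm,
    ← ENNReal.ofReal_sum_of_nonneg fun a _ => Finset.sum_nonneg fun b _ => hnn a b]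
  refine ENNReal.ofReal_le_ofReal ?_
  have e : ∑ a, ∑ b, (1 + 2 * rhoSum μ X U) * s2 a b / (η ^ 2 * n) =
      (∑ a, ∑ b, (1 + 2 * rhoSum μ X U) * s2 a b / η ^ 2) / (n : ℝ) := by
    simp_rw [Finset.sum_div, div_div]
  rw [e]
  gcongr
  linarith

open Classical in
theorem integral_lower_form_pos (h1 : DataAssumption μ X U τ₀) {l : ℝ}
    (hl : (lowerMoment μ X l).PosDef) {e : Regr p} (he : e ≠ 0) :
    0 < ∫ z, (Set.Iic l).indicator (fun _ => 1) (thr z.1) * inner ℝ z.1 e ^ 2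
      ∂(margin μ X U) := by
  have hw : Measurable fun x : Regr p => (Set.Iic l).indicator (fun _ => (1 : ℝ)) (thr x) :=
    (measurable_const.indicator measurableSet_Iic).comp measurable_thr
  have hwb : ∀ x : Regr p, |(Set.Iic l).indicator (fun _ => (1 : ℝ)) (thr x)| ≤ 1 := fun x => by
    by_cases hx : thr x ∈ Set.Iic l <;> simp [hx]
  have hne : (fun a => e a) ≠ 0 := fun h => he (by ext a; exact congrFun h a)
  have hpos := (Matrix.posDef_iff_dotProduct_mulVec.1 hl).2 hne
  rw [h1.integral_form hw hwb]
  refine hpos.trans_eq ?_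
  simp only [dotProduct, Matrix.mulVec, Finset.mul_sum, lowerMoment, Matrix.of_apply]
  refine Finset.sum_congr rfl fun a _ => Finset.sum_congr rfl fun b _ => ?_
  have hgm : Measurable fun z : Regr p × ℝ =>
      (Set.Iic l).indicator (fun _ => (1 : ℝ)) (thr z.1) * (z.1 a * z.1 b) := by
    have : Measurable fun z : Regr p × ℝ => z.1 a * z.1 b := by fun_prop
    exact (hw.comp measurable_fst).mul this
  rw [← h1.integral_pair hgm 0]
  have : ∀ ω, (if thr (X 0 ω) ≤ l then X 0 ω a * X 0 ω b else 0) =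
      (Set.Iic l).indicator (fun _ => (1 : ℝ)) (thr (X 0 ω)) * (X 0 ω a * X 0 ω b) := by
    intro ω
    by_cases h : thr (X 0 ω) ≤ l <;> simp [h]
  simp_rw [this]
  simp only [Pi.star_apply, star_trivial]
  ring

/-- Positivity is assumed only for the moment matrix below the threshold; above it, it comes from
the conditional variance. If `X'e` vanished on `{Q > u}`, the `X₂` part of the form would be a
function of `Q` there, so its conditional variance would vanish just to the right of `u`. As `S` is
positive definite and continuous at `u` and `f u > 0`, the `X₂` coefficients are zero. An affine
function of `Q` vanishing on an atomless event of positive mass is zero too. -/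
theorem integral_upper_form_pos (h1 : DataAssumption μ X U τ₀) (hX : ∀ i ω, X i ω 0 = 1)
    (h2 : ThresholdAssumption μ X U T τ₀) {u : ℝ} (hu : u ∈ T) {e : Regr p} (he : e ≠ 0) :
    0 < ∫ z, (Set.Ioi u).indicator (fun _ => 1) (thr z.1) * inner ℝ z.1 e ^ 2
      ∂(margin μ X U) := by
  obtain ⟨f, D, V, S, m₄, u₄, hf, -, -, hS, -, -, -, hpos, -⟩ := h2
  obtain ⟨⟨hf0, hfc⟩, -, hSp, hSc⟩ := hpos u hu
  have hpm := h1.isProbabilityMeasure_margin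
  have hq := h1.measurable_thr
  have hw : Measurable fun x : Regr p => (Set.Ioi u).indicator (fun _ => (1 : ℝ)) (thr x) :=
    (measurable_const.indicator measurableSet_Ioi).comp measurable_thr
  have hwb : ∀ x : Regr p, |(Set.Ioi u).indicator (fun _ => (1 : ℝ)) (thr x)| ≤ 1 := fun x => by
    by_cases hx : thr x ∈ Set.Ioi u <;> simp [hx]
  have hgm : Measurable fun z : Regr p × ℝ =>
      (Set.Ioi u).indicator (fun _ => (1 : ℝ)) (thr z.1) * inner ℝ z.1 e ^ 2 := by
    have : Measurable fun z : Regr p × ℝ => inner ℝ z.1 e ^ 2 := by fun_prop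
    exact (hw.comp measurable_fst).mul this
  have hgi : Integrable (fun z : Regr p × ℝ =>
      (Set.Ioi u).indicator (fun _ => (1 : ℝ)) (thr z.1) * inner ℝ z.1 e ^ 2)
      (margin μ X U) := by
    have hin : MemLp (fun z : Regr p × ℝ => inner ℝ z.1 e) 2 (margin μ X U) := by
      simp_rw [inner_regr]
      exact memLp_finsetSum _ fun a _ =>
        ((h1.memLp_coord a).mono_exponent (by norm_num)).const_mul _
    exact hin.integrable_sq.bdd_mul (c := 1) (hw.comp measurable_fst).aestronglyMeasurable
      (Eventually.of_forall fun z => hwb z.1)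
  have hnn : ∀ z : Regr p × ℝ,
      0 ≤ (Set.Ioi u).indicator (fun _ => (1 : ℝ)) (thr z.1) * inner ℝ z.1 e ^ 2 := fun z =>
    mul_nonneg (Set.indicator_nonneg (fun _ _ => zero_le_one) _) (sq_nonneg _)
  refine lt_of_le_of_ne (integral_nonneg hnn) fun h0 => he ?_
  -- the linear form vanishes on `{Q > u}`
  have hz : ∀ᵐ ω ∂μ, u < thr (X 0 ω) → inner ℝ (X 0 ω) e = 0 := by
    rw [← h1.integral_pair hgm 0] at h0
    have h := (integral_eq_zero_iff_of_nonneg (fun ω => hnn (X 0 ω, U 0 ω))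
      ((h1.integrable_pair hgm 0).2 hgi)).1 h0.symm
    filter_upwards [h] with ω hω hlt
    simpa [Set.mem_Ioi.2 hlt] using hω
  have hle : MeasurableSpace.comap (fun ω => thr (X 0 ω)) inferInstance ≤
      (inferInstance : MeasurableSpace Ω) := hq.comap_le
  have hmid : ∀ j, MemLp (fun ω => mid (X 0 ω) j) 2 μ := fun j =>
    ((h1.memLp_pair (g := fun z : Regr p × ℝ => z.1 j.castSucc.succ) (by fun_prop) 0 4).2
      (h1.memLp_coord _)).mono_exponent (by norm_num)
  set Y : Ω → ℝ := fun ω => ∑ j, mid e j * mid (X 0 ω) j with hY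
  have hYi : Integrable Y μ :=
    integrable_finsetSum _ fun j _ => ((hmid j).integrable (by norm_num)).const_mul _
  have hYc : μ[Y | MeasurableSpace.comap (fun ω => thr (X 0 ω)) inferInstance] =ᵐ[μ]
        fun ω => ∑ j, mid e j * (μ[fun ω => mid (X 0 ω) j |
          MeasurableSpace.comap (fun ω => thr (X 0 ω)) inferInstance]) ω := by
    have hYs : Y = ∑ j, (mid e j) • fun ω => mid (X 0 ω) j := by
      funext ω
      simp [hY, Finset.sum_apply]
    rw [hYs]
    have hs := condExp_finsetSum (μ := μ) (s := Finset.univ)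
      (f := fun j => mid e j • fun ω => mid (X 0 ω) j)
      (fun j _ => ((hmid j).integrable (by norm_num)).smul (mid e j))
      (MeasurableSpace.comap (fun ω => thr (X 0 ω)) inferInstance)
    have hall : ∀ᵐ ω ∂μ, ∀ j, (μ[mid e j • fun ω => mid (X 0 ω) j |
          MeasurableSpace.comap (fun ω => thr (X 0 ω)) inferInstance]) ω =
        mid e j * (μ[fun ω => mid (X 0 ω) j |
          MeasurableSpace.comap (fun ω => thr (X 0 ω)) inferInstance]) ω := by
      rw [ae_all_iff]
      intro j
      filter_upwards [condExp_smul (μ := μ) (mid e j) (fun ω => mid (X 0 ω) j)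
        (MeasurableSpace.comap (fun ω => thr (X 0 ω)) inferInstance)] with ω hω
      simpa using hω
    filter_upwards [hs, hall] with ω h1' h2'
    rw [h1', Finset.sum_apply]
    exact Finset.sum_congr rfl fun j _ => h2' j
  -- On `{Q > u}`, an event in the σ-algebra of `Q`, the combination `Y` equals a `Q`-measurable
  -- affine function, hence coincides there with its own conditional expectation.
  have hcz : ∀ᵐ ω ∂μ, u < thr (X 0 ω) →
      ∑ j, mid e j * centered μ (fun ω => thr (X 0 ω)) (fun ω => mid (X 0 ω) j) ω = 0 := by
    set A : Set Ω := {ω | u < thr (X 0 ω)} with hA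
    have hAm : MeasurableSet[MeasurableSpace.comap (fun ω => thr (X 0 ω)) inferInstance] A :=
      ⟨Set.Ioi u, measurableSet_Ioi, rfl⟩
    have hAm' : MeasurableSet A := hle _ hAm
    set l : Ω → ℝ := fun ω => -(e 0 + thr e * thr (X 0 ω)) with hl
    have hlm : Measurable[MeasurableSpace.comap (fun ω => thr (X 0 ω)) inferInstance] l :=
      ((comap_measurable _).const_mul (thr e) |>.const_add (e 0)).neg
    have hYl : A.indicator Y =ᵐ[μ] A.indicator l := by
      filter_upwards [hz] with ω hω
      by_cases hωA : ω ∈ A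
      · rw [Set.indicator_of_mem hωA, Set.indicator_of_mem hωA]
        have := hω hωA
        rw [inner_regr_split, hX] at this
        simp only [hY, hl]
        linarith
      · rw [Set.indicator_of_notMem hωA, Set.indicator_of_notMem hωA]
    have hli : Integrable (A.indicator l) μ := (hYi.indicator hAm').congr hYl
    have hc1 : μ[A.indicator Y | MeasurableSpace.comap (fun ω => thr (X 0 ω)) inferInstance] =ᵐ[μ]
        A.indicator l := by
      refine (condExp_congr_ae hYl).trans ?_
      rw [condExp_of_stronglyMeasurable hle (hlm.indicator hAm).stronglyMeasurable hli]
    have hc2 := condExp_indicator (μ := μ) 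
      (m := MeasurableSpace.comap (fun ω => thr (X 0 ω)) inferInstance) hYi hAm
    filter_upwards [hc1, hc2, hYl, hYc] with ω g1 g2 g3 g4 hωu
    have hωA : ω ∈ A := hωu
    rw [g1, Set.indicator_of_mem hωA, Set.indicator_of_mem hωA] at g2
    rw [Set.indicator_of_mem hωA, Set.indicator_of_mem hωA] at g3
    rw [g4] at g2
    simp only [centered, mul_sub, Finset.sum_sub_distrib]
    simp only [hY] at g3
    rw [g3, g2, sub_self]
  -- the conditional variance of `X₂' e₂` is positive to the right of `u` unless `e₂ = 0`
  have hmide : ∀ j, mid e j = 0 := by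
    by_contra hcon
    set v : Fin p → ℝ := fun j => mid e j with hv
    have hv0 : v ≠ 0 := fun h => hcon fun j => congrFun h j
    set G : ℝ → ℝ := fun t => ∑ j, ∑ k, v j * v k * S t j k with hG
    have hGu : 0 < G u := by
      have h := (Matrix.posDef_iff_dotProduct_mulVec.1 hSp).2 hv0
      refine h.trans_eq ?_
      simp only [dotProduct, Matrix.mulVec, Finset.mul_sum, hG, Pi.star_apply, star_trivial]
      refine Finset.sum_congr rfl fun a _ => Finset.sum_congr rfl fun b _ => ?_
      ring
    have hGc : ContinuousAt G u := by
      have hSjk : ∀ j k, ContinuousAt (fun t => S t j k) u := fun j k => by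
        have h := continuousAt_pi.1 hSc j
        exact continuousAt_pi.1 h k
      exact tendsto_finsetSum _ fun j _ => tendsto_finsetSum _ fun k _ =>
        (hSjk j k).const_mul _
    have hfG : 0 < f u * G u := mul_pos hf0 hGu
    obtain ⟨ε, hε, hball⟩ := Metric.eventually_nhds_iff.1
      ((hfc.mul hGc).eventually_const_lt (by linarith : f u * G u / 2 < f u * G u))
    set I : ℝ → ℝ := (Set.Ioc u (u + ε / 2)).indicator (fun _ => 1) with hI
    have hIm : Measurable I := measurable_indicator_Ioc _ _
    have hIb : ∀ t, |I t| ≤ 1 := abs_indicator_Ioc_le _ _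
    have hcent : ∀ j, MemLp (centered μ (fun ω => thr (X 0 ω)) (fun ω => mid (X 0 ω) j)) 2 μ :=
      fun j => (hmid j).sub ((hmid j).condExp (by norm_num))
    have hZi : ∀ j k, Integrable (fun ω =>
        centered μ (fun ω => thr (X 0 ω)) (fun ω => mid (X 0 ω) j) ω *
          centered μ (fun ω => thr (X 0 ω)) (fun ω => mid (X 0 ω) k) ω) μ := fun j k =>
      (hcent j).integrable_mul (hcent k)
    have hSi : ∀ j k, Integrable (fun ω => I (thr (X 0 ω)) * S (thr (X 0 ω)) j k) μ := fun j k =>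
      (integrable_condExp.congr (hS j k).2.symm).bdd_mul (c := 1)
        (hIm.comp hq).aestronglyMeasurable (Eventually.of_forall fun ω => hIb _)
    have hZi' : ∀ j k, Integrable (fun ω => I (thr (X 0 ω)) *
        (centered μ (fun ω => thr (X 0 ω)) (fun ω => mid (X 0 ω) j) ω *
          centered μ (fun ω => thr (X 0 ω)) (fun ω => mid (X 0 ω) k) ω)) μ := fun j k =>
      (hZi j k).bdd_mul (c := 1)
        (hIm.comp hq).aestronglyMeasurable (Eventually.of_forall fun ω => hIb _)
    have hGm : Measurable G :=
      Finset.measurable_fun_sum _ fun j _ => Finset.measurable_fun_sum _ fun k _ =>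
        (hS j k).1.const_mul _
    have eG : ∀ ω, G (thr (X 0 ω)) * I (thr (X 0 ω)) =
        ∑ j, ∑ k, v j * v k * (I (thr (X 0 ω)) * S (thr (X 0 ω)) j k) := by
      intro ω
      simp only [hG, Finset.sum_mul]
      refine Finset.sum_congr rfl fun j _ => Finset.sum_congr rfl fun k _ => ?_
      ring
    have hGI : Integrable (fun ω => G (thr (X 0 ω)) * I (thr (X 0 ω))) μ := by
      simp_rw [eG]
      exact integrable_finsetSum _ fun j _ => integrable_finsetSum _ fun k _ =>
        (hSi j k).const_mul _
    have hlow : f u * G u / 2 * (u + ε / 2 - u) ≤ ∫ t, (f t * G t) * I t := by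
      refine le_integral_mul_indicator_Ioc (by linarith) ?_ fun t ht => (hball ?_).le
      · have := (hf.integrable_comp hq (g := fun t => G t * I t) (hGm.mul hIm)).1 hGI
        simpa only [mul_assoc] using this
      · rw [Real.dist_eq, abs_lt]
        constructor <;> linarith [ht.1, ht.2]
    have hcomp := hf.integral_comp hq (g := fun t => G t * I t) (hGm.mul hIm)
    simp only [← mul_assoc] at hcomp
    -- Replacing each `S j k` by the product of centred regressors makes the integrand a perfect
    -- square, which vanishes by `hcz`.
    have hzero : ∫ ω, G (thr (X 0 ω)) * I (thr (X 0 ω)) ∂μ = 0 := by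
      simp_rw [eG]
      rw [integral_finsetSum _ fun j _ => integrable_finsetSum _ fun k _ =>
        (hSi j k).const_mul _]
      have e1 : ∀ j, ∫ ω, ∑ k, v j * v k * (I (thr (X 0 ω)) * S (thr (X 0 ω)) j k) ∂μ =
          ∑ k, v j * v k * ∫ ω, I (thr (X 0 ω)) *
            (centered μ (fun ω => thr (X 0 ω)) (fun ω => mid (X 0 ω) j) ω *
              centered μ (fun ω => thr (X 0 ω)) (fun ω => mid (X 0 ω) k) ω) ∂μ := by
        intro j
        rw [integral_finsetSum _ fun k _ => (hSi j k).const_mul _]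
        refine Finset.sum_congr rfl fun k _ => ?_
        rw [integral_const_mul, (hS j k).integral_mul_comp hq (hZi j k) hIm ⟨1, hIb⟩]
      simp_rw [e1, ← integral_const_mul]
      rw [Finset.sum_congr rfl fun j _ => (integral_finsetSum _
        fun k _ => (hZi' j k).const_mul (v j * v k)).symm,
        ← integral_finsetSum _ fun j _ => integrable_finsetSum _ fun k _ =>
          (hZi' j k).const_mul (v j * v k)]
      refine integral_eq_zero_of_ae ?_
      filter_upwards [hcz] with ω hω
      have e2 : ∑ j, ∑ k, v j * v k * (I (thr (X 0 ω)) *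
          (centered μ (fun ω => thr (X 0 ω)) (fun ω => mid (X 0 ω) j) ω *
            centered μ (fun ω => thr (X 0 ω)) (fun ω => mid (X 0 ω) k) ω)) =
          I (thr (X 0 ω)) * ((∑ j, mid e j *
            centered μ (fun ω => thr (X 0 ω)) (fun ω => mid (X 0 ω) j) ω) *
            ∑ j, mid e j *
              centered μ (fun ω => thr (X 0 ω)) (fun ω => mid (X 0 ω) j) ω) := by
        rw [Finset.sum_mul_sum, Finset.mul_sum]
        refine Finset.sum_congr rfl fun j _ => ?_
        rw [Finset.mul_sum]
        refine Finset.sum_congr rfl fun k _ => ?_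
        simp only [hv]
        ring
      rw [e2]
      by_cases hlt : u < thr (X 0 ω)
      · rw [hω hlt]
        simp
      · have : I (thr (X 0 ω)) = 0 := Set.indicator_of_notMem (fun h => hlt h.1) _
        rw [this]
        simp
    rw [hcomp] at hzero
    rw [hzero] at hlow
    have : 0 < f u * G u / 2 * (u + ε / 2 - u) := by
      have : 0 < u + ε / 2 - u := by linarith
      positivity
    linarith
  -- the remaining affine function of `Q` has at most one zero
  have haff : ∀ᵐ ω ∂μ, u < thr (X 0 ω) → e 0 + thr e * thr (X 0 ω) = 0 := by
    filter_upwards [hz] with ω hω hlt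
    have := hω hlt
    rw [inner_regr_split, hX] at this
    simpa [hmide] using this
  obtain ⟨ε, hε, hmass⟩ := h1.exists_mass_ge hf hf0 hfc
  have hm := hmass u (u + ε) (by linarith) (by linarith) le_rfl
  have hmpos : 0 < slabMass (margin μ X U) (fun _ => 1) u (u + ε) := by
    refine lt_of_lt_of_le ?_ hm
    have : 0 < u + ε - u := by linarith
    positivity
  have h00 : e 0 = 0 ∧ thr e = 0 := by
    by_contra hcon
    have hne : ∀ᵐ ω ∂μ, e 0 + thr e * thr (X 0 ω) ≠ 0 := by
      by_cases ht : thr e = 0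
      · refine Eventually.of_forall fun ω h => hcon ⟨?_, ht⟩
        simpa [ht] using h
      · have h := h1.ae_thr_ne hf (-(e 0) / thr e)
        have hms : MeasurableSet {z : Regr p × ℝ | thr z.1 ≠ -(e 0) / thr e} :=
          (measurable_thr.comp measurable_fst) (measurableSet_singleton _).compl
        unfold margin at h
        rw [ae_map_iff (h1.measurable_pair 0).aemeasurable hms] at h
        filter_upwards [h] with ω hω h'
        apply hω
        rw [eq_div_iff ht]
        linarith
    rw [h1.slabMass_eq measurable_const] at hmpos
    refine hmpos.ne' (integral_eq_zero_of_ae ?_)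
    filter_upwards [haff, hne] with ω g1 g2
    have : thr (X 0 ω) ∉ Set.Ioc u (u + ε) := fun h => g2 (g1 h.1)
    simp [this]
  have hin : inner ℝ e e = (0 : ℝ) := by
    rw [inner_regr_split, h00.1, h00.2]
    simp [hmide]
  exact inner_self_eq_zero.1 hin

end Forms

/-! ### Deterministic inequalities on a good sample -/

section Deterministic

variable {p : ℕ}

/-- The indicator of `Q > τ`. -/
noncomputable def above (τ : ℝ) (x : Regr p) : ℝ := (Set.Ioi τ).indicator (fun _ => 1) (thr x)

/-- The indicator of `Q ≤ τ`. -/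
noncomputable def below (τ : ℝ) (x : Regr p) : ℝ := (Set.Iic τ).indicator (fun _ => 1) (thr x)

/-- The first half of a stacked vector. -/
noncomputable def firstHalf (α : Coef p) : Regr p := WithLp.toLp 2 fun j => α (Sum.inl j)

/-- The second half of a stacked vector. -/
noncomputable def secondHalf (α : Coef p) : Regr p := WithLp.toLp 2 fun j => α (Sum.inr j)

theorem norm_sq_coef (α : Coef p) : ‖α‖ ^ 2 = ‖firstHalf α‖ ^ 2 + ‖secondHalf α‖ ^ 2 := by
  simp only [EuclideanSpace.norm_sq_eq, Fintype.sum_sum_type, firstHalf, secondHalf]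

theorem inner_regAt (x : Regr p) (τ : ℝ) (α : Coef p) :
    inner ℝ (regAt x τ) α =
      inner ℝ x (firstHalf α) + above τ x * inner ℝ x (secondHalf α) := by
  simp only [PiLp.inner_apply, Fintype.sum_sum_type, regAt, stack, firstHalf, secondHalf, above,
    Finset.mul_sum]
  by_cases h : thr x > τ <;> simp [h]

theorem above_sub_above {s τ τ' : ℝ} (h : s ≤ τ) (h' : s ≤ τ') (x : Regr p) :
    above τ x - above τ' x = slab s τ' x - slab s τ x := by
  unfold above slab
  by_cases h1 : thr x ≤ s
  · simp [Set.indicator, not_lt.2 h1, not_lt.2 (h1.trans h), not_lt.2 (h1.trans h')]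
  · by_cases h2 : thr x ≤ τ <;> by_cases h3 : thr x ≤ τ' <;>
      simp [Set.indicator, not_le.1 h1, h2, h3, not_lt.2, not_le.1]

/-- The difference `X(τ)'α - X(τ₀)'α₀` of the fits, with `b`, `c` the differences of the slopes. -/
noncomputable def fitGap (τ₀ κ τ : ℝ) (b c x : Regr p) : ℝ :=
  inner ℝ x b + above τ₀ x * inner ℝ x c +
    (above τ x - above τ₀ x) * (inner ℝ x c + κ * (thr x - τ₀))

/-- The hypothesis `hκ` is the kink: the true effect vanishes at `τ₀`, so shifting the threshold
changes the fit by an amount proportional to the distance, not by a jump. -/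
theorem inner_regAt_sub {τ₀ κ τ : ℝ} {x : Regr p} {α α₀ : Coef p}
    (hκ : inner ℝ x (secondHalf α₀) = κ * (thr x - τ₀)) :
    inner ℝ (regAt x τ) α - inner ℝ (regAt x τ₀) α₀ =
      fitGap τ₀ κ τ (firstHalf (α - α₀)) (secondHalf (α - α₀)) x := by
  have h1 : firstHalf (α - α₀) = firstHalf α - firstHalf α₀ := rfl
  have h2 : secondHalf (α - α₀) = secondHalf α - secondHalf α₀ := rfl
  rw [inner_regAt, inner_regAt, fitGap, h1, h2, inner_sub_right, inner_sub_right, hκ]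
  ring

theorem sum_Icc_one_eq_sum_range (F : ℤ → ℝ) (n : ℕ) :
    ∑ i ∈ Finset.Icc (1 : ℤ) n, F i = ∑ k ∈ Finset.range n, F (k + 1) := by
  symm
  refine Finset.sum_bij (fun (k : ℕ) _ => (k : ℤ) + 1) ?_ ?_ ?_ ?_
  · intro k hk
    rw [Finset.mem_range] at hk
    rw [Finset.mem_Icc]
    omega
  · intro a _ b _ h
    omega
  · intro i hi
    rw [Finset.mem_Icc] at hi
    refine ⟨(i - 1).toNat, ?_, ?_⟩
    · rw [Finset.mem_range]; omega
    · omega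
  · intro k _
    rfl

/-- The residual at `(α, τ)` is `u` minus the gap; in the difference of squares `∑ u²` cancels. -/
theorem mul_objective_sub {τ₀ κ τ : ℝ} {n : ℕ} (hn : 1 ≤ n) {x : ℤ → Regr p} {u y : ℤ → ℝ}
    {α α₀ : Coef p} (hκ : ∀ i, inner ℝ (x i) (secondHalf α₀) = κ * (thr (x i) - τ₀))
    (hy : ∀ i, y i = response α₀ τ₀ (x i) (u i)) :
    n * (objective n x y α τ - objective n x y α₀ τ₀) =
      ∑ k ∈ Finset.range n,
        fitGap τ₀ κ τ (firstHalf (α - α₀)) (secondHalf (α - α₀)) (x (k + 1)) ^ 2 -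
      2 * ∑ k ∈ Finset.range n, u (k + 1) *
        fitGap τ₀ κ τ (firstHalf (α - α₀)) (secondHalf (α - α₀)) (x (k + 1)) := by
  have hn0 : (n : ℝ) ≠ 0 := by
    have : 0 < n := hn
    positivity
  unfold objective
  rw [sum_Icc_one_eq_sum_range, sum_Icc_one_eq_sum_range, ← mul_sub, ← mul_assoc,
    mul_one_div_cancel hn0, one_mul, ← Finset.sum_sub_distrib, Finset.mul_sum,
    ← Finset.sum_sub_distrib]
  refine Finset.sum_congr rfl fun k _ => ?_
  rw [← inner_regAt_sub (hκ _), hy, response]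
  ring

/-- The kink `Q - τ₀`, rescaled by `h` and truncated. -/
noncomputable def kink (τ₀ h : ℝ) (x : Regr p) : ℝ := x 0 * max (-1) (min 1 ((thr x - τ₀) / h))

theorem measurable_kink (τ₀ h : ℝ) : Measurable (kink τ₀ h : Regr p → ℝ) := by
  unfold kink thr
  fun_prop

theorem abs_kink_le (τ₀ h : ℝ) (x : Regr p) : |kink τ₀ h x| ≤ ‖x‖ := by
  unfold kink
  rw [abs_mul]
  have h1 : |x 0| ≤ ‖x‖ := by
    have := PiLp.norm_apply_le x 0
    rwa [Real.norm_eq_abs] at this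
  refine le_trans (mul_le_of_le_one_right (abs_nonneg _) ?_) h1
  exact abs_le.2 ⟨le_max_left _ _, max_le (by norm_num) (min_le_left _ _)⟩

/-- The truncation in `kink` is inactive on intervals inside the scale `h`. It is there because the
maximal inequality asks for a weight dominated by `‖x‖` everywhere; the factor `x 0`, equal to 1 in
the sample, serves the same purpose. -/
theorem kink_mul_slab {τ₀ h : ℝ} (hh : 0 < h) {s t : ℝ} (hs : τ₀ - h ≤ s) (ht : t ≤ τ₀ + h)
    {x : Regr p} (hx : x 0 = 1) :
    (thr x - τ₀) * slab s t x = h * (kink τ₀ h x * slab s t x) := by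
  unfold slab kink
  by_cases hz : thr x ∈ Set.Ioc s t
  · rw [Set.indicator_of_mem hz, hx, min_eq_right, max_eq_right]
    · field_simp
    · rw [le_div_iff₀ hh]; linarith [hz.1]
    · rw [div_le_one hh]; linarith [hz.2]
  · simp [Set.indicator_of_notMem hz]

/-- The properties of a sample on which the bounds for the estimator rest. -/
structure GoodSample (x : ℕ → Regr p) (u : ℕ → ℝ) (n : ℕ) (τ₀ l r h H lam c₁ C₂ c₀ C : ℝ) :
    Prop where
  lower_form : ∀ e, c₁ * n * ‖e‖ ^ 2 ≤ ∑ k ∈ Finset.range n, below l (x k) * inner ℝ (x k) e ^ 2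
  upper_form : ∀ e, c₁ * n * ‖e‖ ^ 2 ≤ ∑ k ∈ Finset.range n, above r (x k) * inner ℝ (x k) e ^ 2
  norm_sq : ∑ k ∈ Finset.range n, ‖x k‖ ^ 2 ≤ C₂ * n
  noise_coord : ∀ a, |∑ k ∈ Finset.range n, u k * x k a| ≤ lam * √n
  noise_above : ∀ a, |∑ k ∈ Finset.range n, u k * (x k a * above τ₀ (x k))| ≤ lam * √n
  noise_slab : ∀ (j : ℕ) (a : Fin (p + 2)), ∀ τ ∈ Set.Icc (τ₀ - 2 ^ j * h) (τ₀ + 2 ^ j * h),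
    |∑ k ∈ Finset.range n, u k * (x k a * slab (τ₀ - 2 ^ j * h) τ (x k))| ≤
      lam * 2 ^ j * √(n * (C * h))
  noise_kink : ∀ j : ℕ, ∀ τ ∈ Set.Icc (τ₀ - 2 ^ j * h) (τ₀ + 2 ^ j * h),
    |∑ k ∈ Finset.range n, u k * (kink τ₀ (2 ^ j * h) (x k) * slab (τ₀ - 2 ^ j * h) τ (x k))| ≤
      lam * 2 ^ j * √(n * (C * h))
  right_ge : ∀ j : ℕ, 2 ^ j * h ≤ H → c₀ * n * (2 ^ j * h) ^ 3 ≤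
    ∑ k ∈ Finset.range n, (thr (x k) - τ₀) ^ 2 * slab τ₀ (τ₀ + 2 ^ j * h) (x k)
  left_ge : ∀ j : ℕ, 2 ^ j * h ≤ H → c₀ * n * (2 ^ j * h) ^ 3 ≤
    ∑ k ∈ Finset.range n, (thr (x k) - τ₀) ^ 2 * slab (τ₀ - 2 ^ j * h) τ₀ (x k)
  right_le : ∑ k ∈ Finset.range n, (thr (x k) - τ₀) ^ 2 * slab τ₀ (τ₀ + h) (x k) ≤ C * n * h ^ 3
  left_le : ∑ k ∈ Finset.range n, (thr (x k) - τ₀) ^ 2 * slab (τ₀ - h) τ₀ (x k) ≤ C * n * h ^ 3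

theorem sum_abs_le (e : Regr p) : ∑ a, |e a| ≤ (p + 2) * ‖e‖ := by
  have h := sum_abs_sq_le e
  refine le_of_sq_le_sq (h.trans ?_) (by positivity)
  rw [mul_pow]
  refine mul_le_mul_of_nonneg_right ?_ (sq_nonneg _)
  have : (0 : ℝ) ≤ p := Nat.cast_nonneg p
  nlinarith

theorem abs_sum_mul_inner_le {n : ℕ} {x : ℕ → Regr p} {v : ℕ → ℝ} {B : ℝ}
    (hB : ∀ a, |∑ k ∈ Finset.range n, v k * x k a| ≤ B) (e : Regr p) :
    |∑ k ∈ Finset.range n, v k * inner ℝ (x k) e| ≤ (p + 2) * ‖e‖ * B := by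
  have hB0 : 0 ≤ B := (abs_nonneg _).trans (hB 0)
  have h1 : ∑ k ∈ Finset.range n, v k * inner ℝ (x k) e =
      ∑ a, e a * ∑ k ∈ Finset.range n, v k * x k a := by
    simp_rw [inner_regr, Finset.mul_sum]
    rw [Finset.sum_comm]
    refine Finset.sum_congr rfl fun a _ => Finset.sum_congr rfl fun k _ => ?_
    ring
  rw [h1]
  calc |∑ a, e a * ∑ k ∈ Finset.range n, v k * x k a|
      ≤ ∑ a, |e a| * B := by
        refine (Finset.abs_sum_le_sum_abs _ _).trans (Finset.sum_le_sum fun a _ => ?_)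
        rw [abs_mul]
        exact mul_le_mul_of_nonneg_left (hB a) (abs_nonneg _)
    _ = (∑ a, |e a|) * B := by rw [Finset.sum_mul]
    _ ≤ (p + 2) * ‖e‖ * B := mul_le_mul_of_nonneg_right (sum_abs_le e) hB0

variable {x : ℕ → Regr p} {u : ℕ → ℝ} {n : ℕ} {τ₀ l r h H lam c₁ C₂ c₀ C : ℝ}

/-- Linear in the slopes except for the kink term, where `κ (Q - τ₀)` is `κ 2^j h` times the
normalized kink. The change of indicators is written as a difference of two slabs with common left
end `τ₀ - 2^j h`, so one-sided chaining covers thresholds on both sides; hence the factors 2. -/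
theorem GoodSample.abs_noise_le (hg : GoodSample x u n τ₀ l r h H lam c₁ C₂ c₀ C)
    (hx : ∀ k, x k 0 = 1) (hh : 0 < h) (κ : ℝ) (b c : Regr p) {τ : ℝ} {j : ℕ}
    (hτ : |τ - τ₀| ≤ 2 ^ j * h) :
    |∑ k ∈ Finset.range n, u k * fitGap τ₀ κ τ b c (x k)| ≤
      (p + 2) * ‖b‖ * (lam * √n) + (p + 2) * ‖c‖ * (lam * √n) +
        (p + 2) * ‖c‖ * (2 * (lam * 2 ^ j * √(n * (C * h)))) +
        |κ| * (2 ^ j * h) * (2 * (lam * 2 ^ j * √(n * (C * h)))) := by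
  set hj := 2 ^ j * h with hhj
  have hj0 : 0 < hj := by positivity
  have hτ' := abs_le.1 hτ
  have hmem : τ ∈ Set.Icc (τ₀ - hj) (τ₀ + hj) := ⟨by linarith, by linarith⟩
  have hmem₀ : τ₀ ∈ Set.Icc (τ₀ - hj) (τ₀ + hj) := ⟨by linarith, by linarith⟩
  set B := lam * 2 ^ j * √(n * (C * h)) with hB
  have hD : ∀ k, above τ (x k) - above τ₀ (x k) =
      slab (τ₀ - hj) τ₀ (x k) - slab (τ₀ - hj) τ (x k) := fun k =>
    above_sub_above hmem.1 hmem₀.1 _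
  have e : ∑ k ∈ Finset.range n, u k * fitGap τ₀ κ τ b c (x k) =
      ∑ k ∈ Finset.range n, u k * inner ℝ (x k) b +
      ∑ k ∈ Finset.range n, (u k * above τ₀ (x k)) * inner ℝ (x k) c +
      ∑ k ∈ Finset.range n, (u k * (above τ (x k) - above τ₀ (x k))) * inner ℝ (x k) c +
      κ * hj * (∑ k ∈ Finset.range n, u k * (kink τ₀ hj (x k) * slab (τ₀ - hj) τ₀ (x k)) -
        ∑ k ∈ Finset.range n, u k * (kink τ₀ hj (x k) * slab (τ₀ - hj) τ (x k))) := by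
    rw [← Finset.sum_sub_distrib, Finset.mul_sum, ← Finset.sum_add_distrib,
      ← Finset.sum_add_distrib, ← Finset.sum_add_distrib]
    refine Finset.sum_congr rfl fun k _ => ?_
    have k1 := kink_mul_slab hj0 (le_refl (τ₀ - hj)) hmem₀.2 (hx k)
    have k2 := kink_mul_slab hj0 (le_refl (τ₀ - hj)) hmem.2 (hx k)
    unfold fitGap
    rw [hD]
    linear_combination (u k * κ) * (k1 - k2)
  have t1 := abs_sum_mul_inner_le hg.noise_coord b
  have t2 : |∑ k ∈ Finset.range n, (u k * above τ₀ (x k)) * inner ℝ (x k) c| ≤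
      (p + 2) * ‖c‖ * (lam * √n) := by
    refine abs_sum_mul_inner_le (fun a => ?_) c
    refine le_trans (le_of_eq ?_) (hg.noise_above a)
    congr 1
    exact Finset.sum_congr rfl fun k _ => by ring
  have t3 : |∑ k ∈ Finset.range n, (u k * (above τ (x k) - above τ₀ (x k))) * inner ℝ (x k) c| ≤
      (p + 2) * ‖c‖ * (2 * B) := by
    refine abs_sum_mul_inner_le (fun a => ?_) c
    have e1 : ∑ k ∈ Finset.range n, (u k * (above τ (x k) - above τ₀ (x k))) * x k a =
        ∑ k ∈ Finset.range n, u k * (x k a * slab (τ₀ - hj) τ₀ (x k)) -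
          ∑ k ∈ Finset.range n, u k * (x k a * slab (τ₀ - hj) τ (x k)) := by
      rw [← Finset.sum_sub_distrib]
      refine Finset.sum_congr rfl fun k _ => ?_
      rw [hD]
      ring
    rw [e1]
    refine (abs_sub _ _).trans ?_
    linarith [hg.noise_slab j a τ₀ hmem₀, hg.noise_slab j a τ hmem]
  have t4 : |κ * hj * (∑ k ∈ Finset.range n, u k * (kink τ₀ hj (x k) * slab (τ₀ - hj) τ₀ (x k)) -
        ∑ k ∈ Finset.range n, u k * (kink τ₀ hj (x k) * slab (τ₀ - hj) τ (x k)))| ≤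
      |κ| * hj * (2 * B) := by
    rw [abs_mul, abs_mul, abs_of_pos hj0]
    refine mul_le_mul_of_nonneg_left ?_ (by positivity)
    refine (abs_sub _ _).trans ?_
    linarith [hg.noise_kink j τ₀ hmem₀, hg.noise_kink j τ hmem]
  rw [e]
  refine (abs_add_le _ _).trans (add_le_add ((abs_add_le _ _).trans
    (add_le_add ((abs_add_le _ _).trans (add_le_add t1 t2)) t3)) t4)

/-- The sum of squares of the fit gap controls the slopes. -/
theorem GoodSample.slope_le (hg : GoodSample x u n τ₀ l r h H lam c₁ C₂ c₀ C)
    (κ : ℝ) (b c : Regr p) {τ : ℝ} (hτ : τ ∈ Set.Icc l r) (hτ₀ : τ₀ ∈ Set.Icc l r) :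
    c₁ * n * ‖b‖ ^ 2 ≤ ∑ k ∈ Finset.range n, fitGap τ₀ κ τ b c (x k) ^ 2 ∧
    c₁ * n * ‖b + c‖ ^ 2 ≤ ∑ k ∈ Finset.range n, fitGap τ₀ κ τ b c (x k) ^ 2 := by
  refine ⟨(hg.lower_form b).trans (Finset.sum_le_sum fun k _ => ?_),
    (hg.upper_form (b + c)).trans (Finset.sum_le_sum fun k _ => ?_)⟩
  · by_cases hq : thr (x k) ≤ l
    · have e : fitGap τ₀ κ τ b c (x k) = inner ℝ (x k) b := by
        simp [fitGap, above, Set.indicator, not_lt.2 (hq.trans hτ.1), not_lt.2 (hq.trans hτ₀.1)]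
      rw [e]
      simp [below, hq]
    · simp only [below, Set.indicator, Set.mem_Iic, hq, if_false, zero_mul]
      positivity
  · by_cases hq : r < thr (x k)
    · have e : fitGap τ₀ κ τ b c (x k) = inner ℝ (x k) (b + c) := by
        simp [fitGap, above, Set.indicator, hτ.2.trans_lt hq, hτ₀.2.trans_lt hq, inner_add_right]
      rw [e]
      simp [above, hq]
    · simp only [above, Set.indicator, Set.mem_Ioi, hq, if_false, zero_mul]
      positivity

/-- For an observation between the thresholds the gap is `x'b - κ (Q - τ₀)` or `x'(b + c) + κ (Q -
τ₀)`, according to the side on which `τ` lies. So the kink is the gap up to a slope term, and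
`slope_le` together with the bound on `∑ ‖x‖²` pays for that term with the gap itself. -/
theorem GoodSample.kink_le (hg : GoodSample x u n τ₀ l r h H lam c₁ C₂ c₀ C) (hc₁ : 0 < c₁)
    (hn : 1 ≤ n) (κ : ℝ) (b c : Regr p) {τ : ℝ} (hτ : τ ∈ Set.Icc l r)
    (hτ₀ : τ₀ ∈ Set.Icc l r) :
    κ ^ 2 * ∑ k ∈ Finset.range n, (thr (x k) - τ₀) ^ 2 *
        (slab τ₀ τ (x k) + slab τ τ₀ (x k)) ≤
      (2 + 2 * C₂ / c₁) * ∑ k ∈ Finset.range n, fitGap τ₀ κ τ b c (x k) ^ 2 := by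
  set G := ∑ k ∈ Finset.range n, fitGap τ₀ κ τ b c (x k) ^ 2 with hG
  obtain ⟨hb, hbc⟩ := hg.slope_le κ b c hτ hτ₀
  have hn0 : (0 : ℝ) < n := by exact_mod_cast hn
  have key : ∀ e : Regr p, c₁ * n * ‖e‖ ^ 2 ≤ G →
      (∀ k, κ ^ 2 * ((thr (x k) - τ₀) ^ 2 * (slab τ₀ τ (x k) + slab τ τ₀ (x k))) ≤
        2 * fitGap τ₀ κ τ b c (x k) ^ 2 + 2 * inner ℝ (x k) e ^ 2) →
      κ ^ 2 * ∑ k ∈ Finset.range n, (thr (x k) - τ₀) ^ 2 *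
        (slab τ₀ τ (x k) + slab τ τ₀ (x k)) ≤ (2 + 2 * C₂ / c₁) * G := by
    intro e he hk
    rw [Finset.mul_sum]
    refine (Finset.sum_le_sum fun k _ => hk k).trans ?_
    rw [Finset.sum_add_distrib, ← Finset.mul_sum, ← Finset.mul_sum, ← hG]
    have h1 : ∑ k ∈ Finset.range n, inner ℝ (x k) e ^ 2 ≤ C₂ * n * ‖e‖ ^ 2 := by
      calc ∑ k ∈ Finset.range n, inner ℝ (x k) e ^ 2
          ≤ ∑ k ∈ Finset.range n, ‖x k‖ ^ 2 * ‖e‖ ^ 2 := by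
            refine Finset.sum_le_sum fun k _ => ?_
            rw [← mul_pow, ← sq_abs]
            exact pow_le_pow_left₀ (abs_nonneg _) (abs_real_inner_le_norm _ _) 2
        _ = (∑ k ∈ Finset.range n, ‖x k‖ ^ 2) * ‖e‖ ^ 2 := by rw [Finset.sum_mul]
        _ ≤ C₂ * n * ‖e‖ ^ 2 := mul_le_mul_of_nonneg_right hg.norm_sq (sq_nonneg _)
    have hC₂ : 0 ≤ C₂ := by
      have : 0 ≤ C₂ * n := (Finset.sum_nonneg fun k _ => sq_nonneg _).trans hg.norm_sq
      exact nonneg_of_mul_nonneg_left this hn0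
    have h2 : C₂ * n * ‖e‖ ^ 2 ≤ C₂ / c₁ * G := by
      calc C₂ * n * ‖e‖ ^ 2 = C₂ / c₁ * (c₁ * n * ‖e‖ ^ 2) := by field_simp
        _ ≤ C₂ / c₁ * G := mul_le_mul_of_nonneg_left he (by positivity)
    have e3 : 2 * C₂ / c₁ = 2 * (C₂ / c₁) := by ring
    rw [e3]
    linarith
  rcases le_total τ₀ τ with hle | hle
  · refine key b hb fun k => ?_
    have e0 : slab τ τ₀ (x k) = 0 := by simp [slab, Set.Ioc_eq_empty (not_lt.2 hle)]
    rw [e0, add_zero]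
    by_cases hq : thr (x k) ∈ Set.Ioc τ₀ τ
    · have e : fitGap τ₀ κ τ b c (x k) = inner ℝ (x k) b - κ * (thr (x k) - τ₀) := by
        simp [fitGap, above, Set.indicator, hq.1, not_lt.2 hq.2]
        ring
      rw [e, slab, Set.indicator_of_mem hq]
      nlinarith [sq_nonneg (2 * inner ℝ (x k) b - κ * (thr (x k) - τ₀))]
    · rw [slab, Set.indicator_of_notMem hq]
      simp only [mul_zero]
      positivity
  · refine key (b + c) hbc fun k => ?_
    have e0 : slab τ₀ τ (x k) = 0 := by simp [slab, Set.Ioc_eq_empty (not_lt.2 hle)]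
    rw [e0, zero_add]
    by_cases hq : thr (x k) ∈ Set.Ioc τ τ₀
    · have e : fitGap τ₀ κ τ b c (x k) = inner ℝ (x k) (b + c) + κ * (thr (x k) - τ₀) := by
        simp [fitGap, above, Set.indicator, hq.1, not_lt.2 hq.2, inner_add_right]
        ring
      rw [e, slab, Set.indicator_of_mem hq]
      nlinarith [sq_nonneg (2 * inner ℝ (x k) (b + c) + κ * (thr (x k) - τ₀))]
    · rw [slab, Set.indicator_of_notMem hq]
      simp only [mul_zero]
      positivity

/-- Each of `B y` and `B y √z` gives up `c/4 y²` by completing the square; what is left is at most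
`M z²` because `z ≥ 1`. The cubic `c z³` then forces `z ≤ M / c`, and `y` follows. -/
theorem bounds_of_cubic_inequality {c A B y z : ℝ} (hc : 0 < c) (hA : 0 ≤ A) (hB : 0 ≤ B)
    (hz : 1 ≤ z) (h : c * (y ^ 2 + z ^ 3) ≤ A + B * (y + y * √z + z ^ 2)) :
    z ≤ (A + 2 * B ^ 2 / c + B) / c ∧
      y ^ 2 ≤ 2 * (A + 2 * B ^ 2 / c + B) ^ 3 / c ^ 3 := by
  set M := A + 2 * B ^ 2 / c + B with hM
  have hz0 : 0 ≤ z := by linarith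
  have hsz : √z ^ 2 = z := Real.sq_sqrt hz0
  have e1 : B * y ≤ c / 4 * y ^ 2 + B ^ 2 / c := by
    have : c / 4 * y ^ 2 + B ^ 2 / c - B * y = (c * y / 2 - B) ^ 2 / c := by field_simp; ring
    have : 0 ≤ (c * y / 2 - B) ^ 2 / c := by positivity
    linarith
  have e2 : B * (y * √z) ≤ c / 4 * y ^ 2 + B ^ 2 / c * z := by
    have : c / 4 * y ^ 2 + B ^ 2 / c * z - B * (y * √z) = (c * y / 2 - B * √z) ^ 2 / c := by
      rw [← hsz, Real.sqrt_sq (Real.sqrt_nonneg z)]; field_simp; ring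
    have : 0 ≤ (c * y / 2 - B * √z) ^ 2 / c := by positivity
    linarith
  have hzz : 1 ≤ z ^ 2 := one_le_pow₀ hz
  have hzz' : z ≤ z ^ 2 := by nlinarith
  have hB2 : 0 ≤ B ^ 2 / c := by positivity
  have h3 : c / 2 * y ^ 2 + c * z ^ 3 ≤ M * z ^ 2 := by
    have e3 : M * z ^ 2 = A * z ^ 2 + B ^ 2 / c * z ^ 2 + B ^ 2 / c * z ^ 2 + B * z ^ 2 := by
      rw [hM]; ring
    have e4 : A ≤ A * z ^ 2 := le_mul_of_one_le_right hA hzz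
    have e5 : B ^ 2 / c ≤ B ^ 2 / c * z ^ 2 := le_mul_of_one_le_right hB2 hzz
    have e6 : B ^ 2 / c * z ≤ B ^ 2 / c * z ^ 2 := mul_le_mul_of_nonneg_left hzz' hB2
    nlinarith
  have hM0 : 0 ≤ M := by positivity
  have hzM : z ≤ M / c := by
    rw [le_div_iff₀ hc]
    have hz2 : 0 < z ^ 2 := by linarith
    have : z * c * z ^ 2 ≤ M * z ^ 2 := by nlinarith [sq_nonneg y]
    exact le_of_mul_le_mul_right this hz2
  refine ⟨hzM, ?_⟩
  have h4 : c / 2 * y ^ 2 ≤ M * (M / c) ^ 2 := by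
    have h5 : z ^ 2 ≤ (M / c) ^ 2 := pow_le_pow_left₀ hz0 hzM 2
    have h6 : 0 ≤ c * z ^ 3 := by positivity
    calc c / 2 * y ^ 2 ≤ M * z ^ 2 := by linarith
      _ ≤ M * (M / c) ^ 2 := mul_le_mul_of_nonneg_left h5 hM0
  calc y ^ 2 = 2 / c * (c / 2 * y ^ 2) := by field_simp
    _ ≤ 2 / c * (M * (M / c) ^ 2) := mul_le_mul_of_nonneg_left h4 (by positivity)
    _ = 2 * M ^ 3 / c ^ 3 := by field_simp

end Deterministic

/-! ### From the basic inequality to the rates -/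

section Rates

variable {p : ℕ} {τ₀ l r H lam c₁ C₂ c₀ C κ₀ A : ℝ}

/-- The interval between `τ₀` and `τ` contains the one-sided dyadic interval of length `2^m h`, for
which the sample bound is available. -/
theorem GoodSample.kink_ge {x : ℕ → Regr p} {u : ℕ → ℝ} {n : ℕ} {h : ℝ}
    (hg : GoodSample x u n τ₀ l r h H lam c₁ C₂ c₀ C) {τ : ℝ} {m : ℕ}
    (hm : 2 ^ m * h ≤ |τ - τ₀|) (hH : |τ - τ₀| ≤ H) :
    c₀ * n * (2 ^ m * h) ^ 3 ≤ ∑ k ∈ Finset.range n, (thr (x k) - τ₀) ^ 2 *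
        (slab τ₀ τ (x k) + slab τ τ₀ (x k)) := by
  rcases le_total τ₀ τ with hle | hle
  · rw [abs_of_nonneg (by linarith)] at hm hH
    refine (hg.right_ge m (hm.trans hH)).trans (Finset.sum_le_sum fun k _ => ?_)
    refine mul_le_mul_of_nonneg_left ?_ (sq_nonneg _)
    have h1 := slab_mono (le_refl τ₀) (by linarith : τ₀ + 2 ^ m * h ≤ τ) (x k)
    have h2 := slab_nonneg τ τ₀ (x k)
    linarith
  · rw [abs_of_nonpos (by linarith)] at hm hH
    refine (hg.left_ge m (hm.trans hH)).trans (Finset.sum_le_sum fun k _ => ?_)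
    refine mul_le_mul_of_nonneg_left ?_ (sq_nonneg _)
    have h1 := slab_mono (by linarith : τ ≤ τ₀ - 2 ^ m * h) (le_refl τ₀) (x k)
    have h2 := slab_nonneg τ₀ τ (x k)
    linarith

theorem abs_mul_sqrt_eq {m κ h κ₀ : ℝ} (hm : 0 ≤ m) (hh : 0 ≤ h) (hκ₀ : 0 ≤ κ₀)
    (hκ : m * κ ^ 2 * h ^ 3 = κ₀ ^ 2) : |κ| * h * (√m * √h) = κ₀ := by
  refine (sq_eq_sq₀ (by positivity) hκ₀).1 ?_
  rw [← hκ, mul_pow, mul_pow, mul_pow, sq_abs, Real.sq_sqrt hm, Real.sq_sqrt hh]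
  ring

theorem mul_sqrt_le_sqrt_mul_add {m a b : ℝ} (hm : 0 ≤ m) :
    a * √m ≤ √(m * (a ^ 2 + b ^ 2)) := by
  refine Real.le_sqrt_of_sq_le ?_
  rw [mul_pow, Real.sq_sqrt hm, mul_comm]
  exact mul_le_mul_of_nonneg_left (le_add_of_nonneg_right (sq_nonneg b)) hm

/-- On good samples every near minimizer is close to the true parameter. -/
theorem exists_rate_constants (hc₁ : 0 < c₁) (hc₀ : 0 < c₀) (hC : 0 < C) (hC₂ : 0 ≤ C₂)
    (hκ₀ : 0 < κ₀) (hH : 0 ≤ H) (hlam : 0 ≤ lam) (hA : 0 ≤ A) (p : ℕ) :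
    ∃ Z Y : ℝ, ∀ (x : ℕ → Regr p) (u : ℕ → ℝ) (n : ℕ) (h κ τ : ℝ) (b c : Regr p),
      GoodSample x u n τ₀ l r h H lam c₁ C₂ c₀ C → (∀ k, x k 0 = 1) → 1 ≤ n → 0 < h → h ≤ 1 →
      n * κ ^ 2 * h ^ 3 = κ₀ ^ 2 → τ ∈ Set.Icc l r → τ₀ ∈ Set.Icc l r → |τ - τ₀| ≤ H →
      ∑ k ∈ Finset.range n, fitGap τ₀ κ τ b c (x k) ^ 2 -
        2 * ∑ k ∈ Finset.range n, u k * fitGap τ₀ κ τ b c (x k) ≤ A →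
      |τ - τ₀| ≤ Z * h ∧ n * (‖b‖ ^ 2 + ‖c‖ ^ 2) ≤ Y := by
  set P := 2 + 2 * C₂ / c₁ with hP
  have hP0 : 0 < P := by positivity
  -- Half of `G` pays for `y²`, as `c₁ y² ≤ 5 G`, and the other half for `z³`.
  set c' := min (c₁ / 10) (c₀ * κ₀ ^ 2 / (16 * P)) with hc'
  have hc'0 : 0 < c' := lt_min (by positivity) (by positivity)
  -- The extra constant covers `|τ - τ₀| ≤ h`: there `z = 1`, and no lower bound from the kink is
  -- available.
  set A' := A + c₀ * κ₀ ^ 2 / (16 * P) with hA'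
  have hA'0 : 0 ≤ A' := by positivity
  set B := 4 * (p + 2) * lam + 4 * (p + 2) * lam * √(C * (2 * H + 1)) + 4 * lam * √C * κ₀ with hB
  have hB0 : 0 ≤ B := by positivity
  refine ⟨(A' + 2 * B ^ 2 / c' + B) / c', 2 * (A' + 2 * B ^ 2 / c' + B) ^ 3 / c' ^ 3, ?_⟩
  intro x u n h κ τ b c hg hx hn hh hh1 hκ hτ hτ₀ hτH hbasic
  have hn0 : (0 : ℝ) < n := by exact_mod_cast hn
  set G := ∑ k ∈ Finset.range n, fitGap τ₀ κ τ b c (x k) ^ 2 with hG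
  have hG0 : 0 ≤ G := Finset.sum_nonneg fun k _ => sq_nonneg _
  -- the dyadic scale of `τ - τ₀`
  obtain ⟨j, hj1, hj2, hj3⟩ : ∃ j : ℕ, |τ - τ₀| ≤ 2 ^ j * h ∧ 2 ^ j * h ≤ 2 * H + 1 ∧
      c₀ * κ₀ ^ 2 / 8 * (2 ^ j) ^ 3 ≤ P * G + c₀ * κ₀ ^ 2 / 8 := by
    rcases le_total |τ - τ₀| h with hle | hle
    · refine ⟨0, by simpa using hle, ?_, ?_⟩
      · rw [pow_zero, one_mul]; linarith
      · have : 0 ≤ P * G := by positivity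
        simpa using this
    · obtain ⟨m, hm1, hm2⟩ := exists_nat_pow_near ((one_le_div hh).2 hle)
        (by norm_num : (1 : ℝ) < 2)
      rw [le_div_iff₀ hh] at hm1
      rw [div_lt_iff₀ hh] at hm2
      refine ⟨m + 1, hm2.le, ?_, ?_⟩
      · rw [pow_succ]; linarith
      · have h1 := hg.kink_ge hm1 hτH
        have h2 := hg.kink_le hc₁ hn κ b c hτ hτ₀
        have h3 := mul_le_mul_of_nonneg_left h1 (sq_nonneg κ)
        -- The balance `n κ² h³ = κ₀²` removes `n` and `h`. The 8 comes from passing from the scale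
        -- `m` below `|τ - τ₀|` to the scale `m + 1` above it.
        have e : κ ^ 2 * (c₀ * n * (2 ^ m * h) ^ 3) = c₀ * κ₀ ^ 2 / 8 * (2 ^ (m + 1)) ^ 3 := by
          rw [← hκ, pow_succ]; ring
        rw [e] at h3
        have : 0 ≤ c₀ * κ₀ ^ 2 / 8 := by positivity
        linarith
  set z : ℝ := 2 ^ j with hz
  have hz1 : 1 ≤ z := one_le_pow₀ (by norm_num)
  have hz0 : 0 < z := by linarith
  set y := √(n * (‖b‖ ^ 2 + ‖c‖ ^ 2)) with hy
  have hysq : y ^ 2 = n * (‖b‖ ^ 2 + ‖c‖ ^ 2) := Real.sq_sqrt (by positivity)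
  have hy0 : 0 ≤ y := Real.sqrt_nonneg _
  have hby : ‖b‖ * √n ≤ y := mul_sqrt_le_sqrt_mul_add hn0.le
  have hcy : ‖c‖ * √n ≤ y := by
    rw [hy, add_comm (‖b‖ ^ 2)]
    exact mul_sqrt_le_sqrt_mul_add hn0.le
  have hquad : c₁ * y ^ 2 ≤ 5 * G := by
    obtain ⟨h1, h2⟩ := hg.slope_le κ b c hτ hτ₀
    have h3 : ‖c‖ ^ 2 ≤ 2 * ‖b + c‖ ^ 2 + 2 * ‖b‖ ^ 2 := by
      have h4 : ‖c‖ ≤ ‖b + c‖ + ‖b‖ := by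
        calc ‖c‖ = ‖(b + c) - b‖ := by rw [add_sub_cancel_left]
          _ ≤ _ := norm_sub_le _ _
      have := pow_le_pow_left₀ (norm_nonneg _) h4 2
      nlinarith [sq_nonneg (‖b + c‖ - ‖b‖)]
    have h5 := mul_le_mul_of_nonneg_left h3 (by positivity : 0 ≤ c₁ * n)
    rw [hysq]
    linarith
  have hlow : c' * (y ^ 2 + z ^ 3) ≤ G + c₀ * κ₀ ^ 2 / (16 * P) := by
    have h1 : c' * y ^ 2 ≤ c₁ / 10 * y ^ 2 :=
      mul_le_mul_of_nonneg_right (min_le_left _ _) (sq_nonneg _)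
    have h2 : c' * z ^ 3 ≤ c₀ * κ₀ ^ 2 / (16 * P) * z ^ 3 :=
      mul_le_mul_of_nonneg_right (min_le_right _ _) (by positivity)
    have h3 : c₀ * κ₀ ^ 2 / (16 * P) * z ^ 3 ≤ G / 2 + c₀ * κ₀ ^ 2 / (16 * P) := by
      have e1 : c₀ * κ₀ ^ 2 / (16 * P) * z ^ 3 = (c₀ * κ₀ ^ 2 / 8 * z ^ 3) / (2 * P) := by
        field_simp; norm_num
      have e2 : G / 2 + c₀ * κ₀ ^ 2 / (16 * P) = (P * G + c₀ * κ₀ ^ 2 / 8) / (2 * P) := by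
        field_simp; ring
      rw [e1, e2]
      gcongr
    linarith
  have hnoise := hg.abs_noise_le hx hh κ b c hj1
  rw [← hz] at hnoise
  have hs1 : √(n * (C * h)) = √n * (√C * √h) := by
    rw [Real.sqrt_mul hn0.le, Real.sqrt_mul hC.le]
  -- Here the boundedness of the threshold space enters, as `z h ≤ 2H + 1`.
  have hzh : z * √h ≤ √z * √(2 * H + 1) := by
    calc z * √h = √z * √(z * h) := by
          rw [Real.sqrt_mul hz0.le, ← mul_assoc, Real.mul_self_sqrt hz0.le]
      _ ≤ √z * √(2 * H + 1) := by gcongr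
  have hκs : |κ| * h * (√n * √h) = κ₀ := abs_mul_sqrt_eq hn0.le hh.le hκ₀.le hκ
  have t1 : (p + 2) * ‖b‖ * (lam * √n) ≤ (p + 2) * lam * y := by
    calc (p + 2) * ‖b‖ * (lam * √n) = (p + 2) * lam * (‖b‖ * √n) := by ring
      _ ≤ _ := by gcongr
  have t2 : (p + 2) * ‖c‖ * (lam * √n) ≤ (p + 2) * lam * y := by
    calc (p + 2) * ‖c‖ * (lam * √n) = (p + 2) * lam * (‖c‖ * √n) := by ring
      _ ≤ _ := by gcongr
  have t3 : (p + 2) * ‖c‖ * (2 * (lam * z * √(n * (C * h)))) ≤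
      2 * (p + 2) * lam * √(C * (2 * H + 1)) * (y * √z) := by
    rw [hs1, Real.sqrt_mul hC.le]
    calc (p + 2) * ‖c‖ * (2 * (lam * z * (√n * (√C * √h)))) =
          2 * (p + 2) * lam * √C * (‖c‖ * √n) * (z * √h) := by ring
      _ ≤ 2 * (p + 2) * lam * √C * y * (√z * √(2 * H + 1)) := by gcongr
      _ = _ := by ring
  have t4 : |κ| * (z * h) * (2 * (lam * z * √(n * (C * h)))) = 2 * lam * √C * κ₀ * z ^ 2 := by
    rw [hs1, ← hκs]; ring
  have hup : G ≤ A + B * (y + y * √z + z ^ 2) := by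
    have h1 : G ≤ A + 2 * |∑ k ∈ Finset.range n, u k * fitGap τ₀ κ τ b c (x k)| := by
      linarith [le_abs_self (∑ k ∈ Finset.range n, u k * fitGap τ₀ κ τ b c (x k))]
    rw [t4] at hnoise
    have hyz : 0 ≤ y * √z := by positivity
    have hb1 : 4 * (p + 2) * lam * y ≤ B * y := by
      refine mul_le_mul_of_nonneg_right ?_ hy0
      have : 0 ≤ 4 * (p + 2) * lam * √(C * (2 * H + 1)) := by positivity
      have : 0 ≤ 4 * lam * √C * κ₀ := by positivity
      linarith
    have hb2 : 4 * (p + 2) * lam * √(C * (2 * H + 1)) * (y * √z) ≤ B * (y * √z) := by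
      refine mul_le_mul_of_nonneg_right ?_ hyz
      have : 0 ≤ 4 * (p + 2) * lam := by positivity
      have : 0 ≤ 4 * lam * √C * κ₀ := by positivity
      linarith
    have hb3 : 4 * lam * √C * κ₀ * z ^ 2 ≤ B * z ^ 2 := by
      refine mul_le_mul_of_nonneg_right ?_ (sq_nonneg z)
      have : 0 ≤ 4 * (p + 2) * lam := by positivity
      have : 0 ≤ 4 * (p + 2) * lam * √(C * (2 * H + 1)) := by positivity
      linarith
    linarith
  obtain ⟨r1, r2⟩ := bounds_of_cubic_inequality hc'0 hA'0 hB0 hz1 (by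
    rw [hA']; linarith : c' * (y ^ 2 + z ^ 3) ≤ A' + B * (y + y * √z + z ^ 2))
  refine ⟨hj1.trans (mul_le_mul_of_nonneg_right r1 hh.le), ?_⟩
  rw [← hysq]
  exact r2

/-- On good samples the objective hardly increases when the threshold moves by at most `h`. -/
theorem GoodSample.gap_le {x : ℕ → Regr p} {u : ℕ → ℝ} {n : ℕ} {h κ τ : ℝ}
    (hg : GoodSample x u n τ₀ l r h H lam c₁ C₂ c₀ C) (hx : ∀ k, x k 0 = 1) (hC : 0 < C)
    (hκ₀ : 0 < κ₀) (hh : 0 < h) (hκ : n * κ ^ 2 * h ^ 3 = κ₀ ^ 2) (hτ : |τ - τ₀| ≤ h) :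
    ∑ k ∈ Finset.range n, fitGap τ₀ κ τ 0 0 (x k) ^ 2 -
      2 * ∑ k ∈ Finset.range n, u k * fitGap τ₀ κ τ 0 0 (x k) ≤
      2 * C * κ₀ ^ 2 + 4 * lam * √C * κ₀ := by
  have hn0 : (0 : ℝ) ≤ n := Nat.cast_nonneg n
  have hτ' := abs_le.1 hτ
  have hnoise := hg.abs_noise_le hx hh κ 0 0 (τ := τ) (j := 0) (by simpa using hτ)
  have hs1 : √(n * (C * h)) = √n * (√C * √h) := by
    rw [Real.sqrt_mul hn0, Real.sqrt_mul hC.le]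
  have hκs : |κ| * h * (√n * √h) = κ₀ := abs_mul_sqrt_eq hn0 hh.le hκ₀.le hκ
  have e1 : (p + 2) * ‖(0 : Regr p)‖ * (lam * √n) + (p + 2) * ‖(0 : Regr p)‖ * (lam * √n) +
        (p + 2) * ‖(0 : Regr p)‖ * (2 * (lam * 2 ^ 0 * √(n * (C * h)))) +
        |κ| * (2 ^ 0 * h) * (2 * (lam * 2 ^ 0 * √(n * (C * h)))) = 2 * lam * √C * κ₀ := by
    rw [hs1, ← hκs, norm_zero]; ring
  rw [e1] at hnoise
  have hG : ∑ k ∈ Finset.range n, fitGap τ₀ κ τ 0 0 (x k) ^ 2 ≤ 2 * C * κ₀ ^ 2 := by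
    calc ∑ k ∈ Finset.range n, fitGap τ₀ κ τ 0 0 (x k) ^ 2
        ≤ ∑ k ∈ Finset.range n, κ ^ 2 * ((thr (x k) - τ₀) ^ 2 * slab τ₀ (τ₀ + h) (x k) +
          (thr (x k) - τ₀) ^ 2 * slab (τ₀ - h) τ₀ (x k)) := by
          refine Finset.sum_le_sum fun k _ => ?_
          have hD : (above τ (x k) - above τ₀ (x k)) ^ 2 ≤
              slab τ₀ (τ₀ + h) (x k) + slab (τ₀ - h) τ₀ (x k) := by
            have g1 := slab_nonneg τ₀ (τ₀ + h) (x k)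
            have g2 := slab_nonneg (τ₀ - h) τ₀ (x k)
            rcases le_total τ₀ τ with hle | hle
            · rw [above_sub_above hle le_rfl, slab_self, zero_sub, neg_sq, slab_sq]
              have := slab_mono (le_refl τ₀) (by linarith : τ ≤ τ₀ + h) (x k)
              linarith
            · rw [above_sub_above le_rfl hle, slab_self, sub_zero, slab_sq]
              have := slab_mono (by linarith : τ₀ - h ≤ τ) (le_refl τ₀) (x k)
              linarith
          have e : fitGap τ₀ κ τ 0 0 (x k) ^ 2 = κ ^ 2 * (thr (x k) - τ₀) ^ 2 *
              (above τ (x k) - above τ₀ (x k)) ^ 2 := by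
            simp only [fitGap, inner_zero_right]; ring
          rw [e, ← mul_add, ← mul_assoc]
          exact mul_le_mul_of_nonneg_left hD (by positivity)
      _ ≤ κ ^ 2 * (C * n * h ^ 3 + C * n * h ^ 3) := by
          rw [← Finset.mul_sum, Finset.sum_add_distrib]
          exact mul_le_mul_of_nonneg_left (add_le_add hg.right_le hg.left_le) (sq_nonneg _)
      _ = 2 * C * κ₀ ^ 2 := by rw [← hκ]; ring
  linarith [neg_abs_le (∑ k ∈ Finset.range n, u k * fitGap τ₀ κ τ 0 0 (x k))]

/-- The lower bounds at `j = 0` are strictly positive, so the sums cannot be empty: the sample has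
observations of `Q` within `h` of `τ₀` on either side. -/
theorem GoodSample.exists_mem_slab {x : ℕ → Regr p} {u : ℕ → ℝ} {n : ℕ} {h : ℝ}
    (hg : GoodSample x u n τ₀ l r h H lam c₁ C₂ c₀ C) (hn : 1 ≤ n) (hc₀ : 0 < c₀) (hh : 0 < h)
    (hhH : h ≤ H) : (∃ k < n, thr (x k) ∈ Set.Ioc τ₀ (τ₀ + h)) ∧
      ∃ k < n, thr (x k) ∈ Set.Ioc (τ₀ - h) τ₀ := by
  have hn0 : (0 : ℝ) < n := by exact_mod_cast hn
  have key : ∀ s t : ℝ, c₀ * n * h ^ 3 ≤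
      ∑ k ∈ Finset.range n, (thr (x k) - τ₀) ^ 2 * slab s t (x k) →
      ∃ k < n, thr (x k) ∈ Set.Ioc s t := by
    intro s t hst
    by_contra hcon
    have : ∑ k ∈ Finset.range n, (thr (x k) - τ₀) ^ 2 * slab s t (x k) = 0 := by
      refine Finset.sum_eq_zero fun k hk => ?_
      have : thr (x k) ∉ Set.Ioc s t := fun h => hcon ⟨k, Finset.mem_range.1 hk, h⟩
      rw [slab, Set.indicator_of_notMem this, mul_zero]
    rw [this] at hst
    have : 0 < c₀ * n * h ^ 3 := by positivity
    linarith
  have h1 := hg.right_ge 0 (by simpa using hhH)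
  have h2 := hg.left_ge 0 (by simpa using hhH)
  simp only [pow_zero, one_mul] at h1 h2
  exact ⟨key _ _ h1, key _ _ h2⟩

end Rates

/-! ### Union bounds -/

section Failure

variable {Ω : Type*} [MeasurableSpace Ω] {μ : Measure Ω}

theorem meas_not_and_le {P Q : Ω → Prop} {a b : ℝ} (ha : 0 ≤ a) (hb : 0 ≤ b)
    (hP : μ {ω | ¬ P ω} ≤ ENNReal.ofReal a) (hQ : μ {ω | ¬ Q ω} ≤ ENNReal.ofReal b) :
    μ {ω | ¬ (P ω ∧ Q ω)} ≤ ENNReal.ofReal (a + b) := by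
  rw [ENNReal.ofReal_add ha hb]
  refine le_trans (measure_mono fun ω hω => ?_)
    ((measure_union_le {ω | ¬ P ω} {ω | ¬ Q ω}).trans (add_le_add hP hQ))
  exact not_and_or.1 hω

theorem meas_not_forall_fin_le {d : ℕ} {P : Fin d → Ω → Prop} {K : ℝ}
    (hP : ∀ a, μ {ω | ¬ P a ω} ≤ ENNReal.ofReal K) :
    μ {ω | ¬ ∀ a, P a ω} ≤ ENNReal.ofReal (d * K) := by
  have hsub : {ω | ¬ ∀ a, P a ω} ⊆ ⋃ a ∈ (Finset.univ : Finset (Fin d)), {ω | ¬ P a ω} := by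
    intro ω hω
    obtain ⟨a, ha⟩ := not_forall.1 hω
    exact Set.mem_biUnion (Finset.mem_coe.2 (Finset.mem_univ a)) ha
  refine (measure_mono hsub).trans ((measure_biUnion_finset_le _ _).trans
    ((Finset.sum_le_sum fun a _ => hP a).trans ?_))
  rw [Finset.sum_const, Finset.card_univ, Fintype.card_fin, nsmul_eq_mul,
    ENNReal.ofReal_mul (Nat.cast_nonneg d), ENNReal.ofReal_natCast]

/-- Handles infinitely many dyadic scales at once: geometrically decaying failure probabilities sum
to twice the first one. -/
theorem meas_not_forall_nat_le {P : ℕ → Ω → Prop} {K : ℝ} (hK : 0 ≤ K)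
    (hP : ∀ j, μ {ω | ¬ P j ω} ≤ ENNReal.ofReal (K / 2 ^ j)) :
    μ {ω | ¬ ∀ j, P j ω} ≤ ENNReal.ofReal (2 * K) := by
  have hsub : {ω | ¬ ∀ j, P j ω} ⊆ ⋃ j, {ω | ¬ P j ω} := by
    intro ω hω
    obtain ⟨a, ha⟩ := not_forall.1 hω
    exact Set.mem_iUnion.2 ⟨a, ha⟩
  refine (measure_mono hsub).trans ((measure_iUnion_le _).trans
    ((ENNReal.tsum_le_tsum hP).trans (le_of_eq ?_)))
  have e : ∀ j : ℕ, K / 2 ^ j = K * (1 / 2 : ℝ) ^ j := fun j => by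
    rw [one_div, inv_pow, div_eq_mul_inv]
  simp_rw [e]
  rw [← ENNReal.ofReal_tsum_of_nonneg (fun j => by positivity)
    (summable_geometric_two.mul_left K), tsum_mul_left, tsum_geometric_two, mul_comm]

theorem eventually_const_div_le {a : ℕ → ℝ} (ha : Tendsto a atTop atTop) (K : ℝ) {δ : ℝ}
    (hδ : 0 < δ) : ∀ᶠ n in atTop, K / a n ≤ δ :=
  ((ha.const_div_atTop K).eventually_lt_const hδ).mono fun _ h => h.le

end Failure

/-! ### Good samples have probability close to one -/

section GoodProbability

variable {Ω : Type*} [MeasurableSpace Ω] {μ : Measure Ω} [IsProbabilityMeasure μ]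
  {p : ℕ} {X : ℤ → Ω → Regr p} {U : ℤ → Ω → ℝ} {τ₀ : ℝ} {T : Set ℝ}

theorem measurable_above (τ : ℝ) : Measurable (above τ : Regr p → ℝ) :=
  (measurable_const.indicator measurableSet_Ioi).comp measurable_thr

theorem measurable_below (τ : ℝ) : Measurable (below τ : Regr p → ℝ) :=
  (measurable_const.indicator measurableSet_Iic).comp measurable_thr

theorem abs_above_le (τ : ℝ) (x : Regr p) : |above τ x| ≤ 1 := by
  unfold above
  by_cases hx : thr x ∈ Set.Ioi τ <;> simp [hx]

theorem abs_below_le (τ : ℝ) (x : Regr p) : |below τ x| ≤ 1 := by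
  unfold below
  by_cases hx : thr x ∈ Set.Iic τ <;> simp [hx]

theorem abs_coord_le (a : Fin (p + 2)) (x : Regr p) : |x a| ≤ ‖x‖ := by
  have := PiLp.norm_apply_le x a
  rwa [Real.norm_eq_abs] at this

/-- Law of large numbers for `(Q - τ₀)²` on one-sided intervals at the threshold. -/
theorem meas_kinkSq_deviation_le (h1 : DataAssumption μ X U τ₀) {C : ℝ}
    (hC : ∀ h : ℝ, 0 ≤ h → slabMass (margin μ X U) weight (τ₀ - h) (τ₀ + h) ≤ C * h)
    {h s t η : ℝ} (hh : 0 < h) (hs : τ₀ - h ≤ s) (ht : t ≤ τ₀ + h) (hη : 0 < η) (n : ℕ)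
    (hn : 1 ≤ n) :
    μ {ω | η * h ^ 3 * n < |∑ k ∈ Finset.range n,
        (thr (X (k + 1) ω) - τ₀) ^ 2 * slab s t (X (k + 1) ω) -
        n * slabMass (margin μ X U) (kinkSq τ₀) s t|} ≤
      ENNReal.ofReal ((1 + 2 * rhoSum μ X U) * C / η ^ 2 / (n * h)) := by
  have hR := rhoSum_nonneg (μ := μ) (X := X) (U := U)
  have hn0 : (0 : ℝ) < n := by exact_mod_cast hn
  have hgm : Measurable fun z : Regr p × ℝ => kinkSq τ₀ z * slab s t z.1 :=
    measurable_kinkSq.mul ((measurable_slab s t).comp measurable_fst)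
  refine (h1.meas_sum_pair_deviation_le hgm (memLp_kinkSq_slab h1 s t) n
    (by positivity : 0 < η * h ^ 3)).trans (ENNReal.ofReal_le_ofReal ?_)
  have hsq := integral_kinkSq_slab_sq_le h1 hs ht
  have hone : slabMass (margin μ X U) (fun _ => 1) s t ≤ C * h :=
    ((slabMass_one_mono h1 hs ht).trans (slabMass_one_le h1 _ _)).trans (hC h hh.le)
  have h5 : ∫ z, (kinkSq τ₀ z * slab s t z.1) ^ 2 ∂(margin μ X U) ≤ h ^ 4 * (C * h) :=
    hsq.trans (mul_le_mul_of_nonneg_left hone (by positivity))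
  calc (1 + 2 * rhoSum μ X U) * (∫ z, (kinkSq τ₀ z * slab s t z.1) ^ 2 ∂(margin μ X U)) /
        ((η * h ^ 3) ^ 2 * n)
      ≤ (1 + 2 * rhoSum μ X U) * (h ^ 4 * (C * h)) / ((η * h ^ 3) ^ 2 * n) := by gcongr
    _ = _ := by field_simp

/-- Samples are good with probability close to one. -/
theorem exists_meas_not_goodSample_le (h1 : DataAssumption μ X U τ₀) (hX : ∀ i ω, X i ω 0 = 1)
    (h2 : ThresholdAssumption μ X U T τ₀) (hτ₀ : τ₀ ∈ T) {l r H : ℝ} (hl : l ∈ T) (hr : r ∈ T)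
    (hH : 0 < H) {h : ℕ → ℝ} (hh : ∀ n, 1 ≤ n → 0 < h n) (hnh : ∀ n, 1 ≤ n → 1 ≤ n * h n ^ 3)
    (hlim : Tendsto (fun n : ℕ => n * h n) atTop atTop) :
    ∃ c₁ C₂ c₀ C : ℝ, 0 < c₁ ∧ 0 ≤ C₂ ∧ 0 < c₀ ∧ 0 < C ∧ ∀ ε : ℝ, 0 < ε → ∃ lam : ℝ, 0 ≤ lam ∧
      ∀ᶠ n : ℕ in atTop, μ {ω | ¬ GoodSample (fun k => X (k + 1) ω) (fun k => U (k + 1) ω) n τ₀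
        l r (h n) H lam c₁ C₂ c₀ C} ≤ ENNReal.ofReal ε := by
  have hpm := h1.isProbabilityMeasure_margin
  have hR := rhoSum_nonneg (μ := μ) (X := X) (U := U)
  have hlP : (lowerMoment μ X l).PosDef := by
    obtain ⟨f, D, V, S, m₄, u₄, -, -, -, -, -, -, -, hpos, -⟩ := id h2
    exact (hpos l hl).2.1.1
  have hL : ∀ t, ∀ᵐ z ∂(margin μ X U), thr z.1 ≠ t := by
    obtain ⟨f, D, V, S, m₄, u₄, hf, -⟩ := id h2
    exact h1.ae_thr_ne hf
  obtain ⟨ca, Ka, hca, hKa, hlow⟩ := h1.exists_meas_form_le (measurable_below l)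
    (abs_below_le l) fun e he => integral_lower_form_pos h1 hlP he
  obtain ⟨cb, Kb, hcb, hKb, hupp⟩ := h1.exists_meas_form_le (measurable_above r)
    (abs_above_le r) fun e he => integral_upper_form_pos h1 hX h2 hr he
  obtain ⟨C, hC1, hmass⟩ := exists_slabMass_weight_le h1 h2
  obtain ⟨c, hc, hkink⟩ := exists_slabMass_kinkSq_ge h1 h2 hτ₀ hH
  obtain ⟨Cs, hCs, hslab⟩ := h1.exists_meas_noise_slab_le hX hL
  obtain ⟨Cn, hCn, hnoise⟩ := h1.exists_meas_noise_le hX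
  have hC0 : 0 < C := by linarith
  set M₂ := ∫ z : Regr p × ℝ, ‖z.1‖ ^ 2 ∂(margin μ X U) with hM₂
  have hM₂0 : 0 ≤ M₂ := integral_nonneg fun z => sq_nonneg _
  have hform : ∀ {w : Regr p → ℝ} {c K : ℝ}, min ca cb ≤ c →
      (∀ n : ℕ, 1 ≤ n → μ {ω | ¬ ∀ e : Regr p, c * n * ‖e‖ ^ 2 ≤
        ∑ k ∈ Finset.range n, w (X (k + 1) ω) * inner ℝ (X (k + 1) ω) e ^ 2} ≤
      ENNReal.ofReal (K / n)) → ∀ δ : ℝ, 0 < δ → ∀ᶠ n : ℕ in atTop,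
      μ {ω | ¬ ∀ e : Regr p, min ca cb * n * ‖e‖ ^ 2 ≤
        ∑ k ∈ Finset.range n, w (X (k + 1) ω) * inner ℝ (X (k + 1) ω) e ^ 2} ≤
      ENNReal.ofReal δ := by
    intro w c K hcm hK δ hδ
    filter_upwards [eventually_const_div_le tendsto_natCast_atTop_atTop K hδ,
      eventually_ge_atTop 1] with n hn hn1
    refine (measure_mono fun ω hω => ?_).trans ((hK n hn1).trans (ENNReal.ofReal_le_ofReal hn))
    refine fun hall => hω fun e => le_trans ?_ (hall e)
    gcongr
  have hsqm : Measurable fun z : Regr p × ℝ => ‖z.1‖ ^ 2 := measurable_fst.norm.pow_const 2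
  have hsqL : MemLp (fun z : Regr p × ℝ => ‖z.1‖ ^ 2) 2 (margin μ X U) := by
    refine (memLp_two_iff_integrable_sq hsqm.aestronglyMeasurable).2 ?_
    refine (h1.memLp_regressor.integrable_norm_pow (p := 4) (by norm_num)).congr
      (Eventually.of_forall fun z => ?_)
    simp only
    ring
  refine ⟨min ca cb, M₂ + 1, c / 2, 2 * C, lt_min hca hcb, by positivity, by positivity,
    by positivity, fun ε hε => ?_⟩
  -- One share for each of the eleven properties of a good sample.
  set δ := ε / 11 with hδ
  have hδ0 : 0 < δ := by positivity
  -- Dominates the constants in all noise events after the union over coordinates (`p + 2`) and over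
  -- scales (factor 2).
  set K := (p + 2 : ℕ) * (Cn + 2 * Cs) + 2 * Cs with hK
  have hK0 : 0 < K := by positivity
  set lam := 1 + K / δ with hlam
  have hlam1 : 1 ≤ lam := by
    have : 0 ≤ K / δ := by positivity
    linarith
  have hKlam : K / lam ^ 2 ≤ δ := by
    rw [div_le_iff₀ (by positivity)]
    calc K = δ * (K / δ) := by field_simp
      _ ≤ δ * lam := by
          refine mul_le_mul_of_nonneg_left ?_ hδ0.le
          linarith
      _ ≤ δ * lam ^ 2 := by
          refine mul_le_mul_of_nonneg_left ?_ hδ0.le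
          nlinarith
  have hpd : (1 : ℝ) ≤ (p + 2 : ℕ) := by
    push_cast
    have : (0 : ℝ) ≤ p := Nat.cast_nonneg p
    linarith
  have hKle : ∀ b : ℝ, b ≤ K → ENNReal.ofReal (b / lam ^ 2) ≤ ENNReal.ofReal δ := fun b hb =>
    ENNReal.ofReal_le_ofReal (le_trans (by gcongr) hKlam)
  refine ⟨lam, by linarith, ?_⟩
  -- the maximal inequality on the dyadic scale `j`
  have hscale : ∀ n : ℕ, 1 ≤ n → ∀ (j : ℕ) (ψ : Regr p → ℝ), Measurable ψ →
      (∀ x, |ψ x| ≤ ‖x‖) →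
      μ {ω | ¬ ∀ τ ∈ Set.Icc (τ₀ - 2 ^ j * h n) (τ₀ + 2 ^ j * h n),
        |∑ k ∈ Finset.range n, U (k + 1) ω * (ψ (X (k + 1) ω) *
          slab (τ₀ - 2 ^ j * h n) τ (X (k + 1) ω))| ≤ lam * 2 ^ j * √(n * (2 * C * h n))} ≤
      ENNReal.ofReal (Cs / lam ^ 2 / 2 ^ j) := by
    intro n hn j ψ hψm hψ
    have hn0 : (0 : ℝ) < n := by exact_mod_cast hn
    have hhn := hh n hn
    have h2j : (1 : ℝ) ≤ 2 ^ j := one_le_pow₀ (by norm_num)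
    have h2j0 : (0 : ℝ) < 2 ^ j := by linarith
    have hj0 : 0 < 2 ^ j * h n := by positivity
    have hm : slabMass (margin μ X U) weight (τ₀ - 2 ^ j * h n) (τ₀ + 2 ^ j * h n) ≤
        2 * C * (2 ^ j * h n) := by
      refine (hmass _ hj0.le).trans ?_
      have : 0 ≤ C * (2 ^ j * h n) := by positivity
      linarith
    have hm3 : 1 ≤ n * (2 * C * (2 ^ j * h n)) ^ 3 := by
      refine (hnh n hn).trans ?_
      have : h n ≤ 2 * C * (2 ^ j * h n) := by
        have : 1 ≤ 2 * C * 2 ^ j := by nlinarith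
        nlinarith
      gcongr
    have hs1 : 1 ≤ √(2 ^ j : ℝ) := Real.one_le_sqrt.2 h2j
    -- The level is raised to `lam √(2^j)`: this makes the failure probability summable in `j`, and
    -- together with the mass `2^j h` it yields the factor `2^j` in the noise bounds.
    have := hslab ψ hψm hψ n (τ₀ - 2 ^ j * h n) (τ₀ + 2 ^ j * h n) (2 * C * (2 ^ j * h n))
      (lam * √(2 ^ j)) hn (by linarith) hm (by positivity) hm3 (by nlinarith)
    have e1 : lam * √(2 ^ j) * √(n * (2 * C * (2 ^ j * h n))) =
        lam * 2 ^ j * √(n * (2 * C * h n)) := by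
      have : (n : ℝ) * (2 * C * (2 ^ j * h n)) = 2 ^ j * (n * (2 * C * h n)) := by ring
      rw [this, Real.sqrt_mul h2j0.le]
      calc lam * √(2 ^ j) * (√(2 ^ j) * √(n * (2 * C * h n)))
          = lam * (√(2 ^ j) * √(2 ^ j)) * √(n * (2 * C * h n)) := by ring
        _ = _ := by rw [Real.mul_self_sqrt h2j0.le]
    have e2 : Cs / (lam * √(2 ^ j)) ^ 2 = Cs / lam ^ 2 / 2 ^ j := by
      rw [mul_pow, Real.sq_sqrt h2j0.le, div_div]
    rw [e2] at this
    refine (measure_mono fun ω hω => ?_).trans this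
    simp only [Set.mem_ofPred_eq] at hω ⊢
    push Not at hω
    obtain ⟨τ, hτ, hlt⟩ := hω
    refine ⟨τ, hτ, ?_⟩
    rw [e1]
    exact hlt
  have hdev : ∀ (η s t : ℝ) (n : ℕ) (hn : 1 ≤ n) (j : ℕ), 0 < η →
      τ₀ - 2 ^ j * h n ≤ s → t ≤ τ₀ + 2 ^ j * h n →
      μ {ω | η * (2 ^ j * h n) ^ 3 * n < |∑ k ∈ Finset.range n,
        (thr (X (k + 1) ω) - τ₀) ^ 2 * slab s t (X (k + 1) ω) -
        n * slabMass (margin μ X U) (kinkSq τ₀) s t|} ≤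
      ENNReal.ofReal ((1 + 2 * rhoSum μ X U) * C / η ^ 2 / (n * h n) / 2 ^ j) := by
    intro η s t n hn j hη hs ht
    have hhn := hh n hn
    refine (meas_kinkSq_deviation_le h1 hmass (by positivity) hs ht hη n hn).trans
      (ENNReal.ofReal_le_ofReal (le_of_eq ?_))
    rw [div_div _ _ ((2 : ℝ) ^ j)]
    congr 1
    ring
  -- A deviation by half the mean fails with probability of order `1 / (n h 2^j)`, summable over
  -- scales and vanishing because `n h → ∞`.
  have hside : ∀ (s t : ℕ → ℕ → ℝ), (∀ n, 1 ≤ n → ∀ j, τ₀ - 2 ^ j * h n ≤ s n j) →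
      (∀ n, 1 ≤ n → ∀ j, t n j ≤ τ₀ + 2 ^ j * h n) →
      (∀ n, 1 ≤ n → ∀ j, 2 ^ j * h n ≤ H →
        c * (2 ^ j * h n) ^ 3 ≤ slabMass (margin μ X U) (kinkSq τ₀) (s n j) (t n j)) →
      ∀ᶠ n : ℕ in atTop, μ {ω | ¬ ∀ j : ℕ, 2 ^ j * h n ≤ H → c / 2 * n * (2 ^ j * h n) ^ 3 ≤
        ∑ k ∈ Finset.range n, (thr (X (k + 1) ω) - τ₀) ^ 2 *
          slab (s n j) (t n j) (X (k + 1) ω)} ≤ ENNReal.ofReal δ := by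
    intro s t hs ht hst
    filter_upwards [eventually_const_div_le hlim
      (2 * ((1 + 2 * rhoSum μ X U) * C / (c / 2) ^ 2)) hδ0, eventually_ge_atTop 1] with n hn hn1
    have hn0 : (0 : ℝ) < n := by exact_mod_cast hn1
    have hhn := hh n hn1
    refine le_trans (meas_not_forall_nat_le
      (K := (1 + 2 * rhoSum μ X U) * C / (c / 2) ^ 2 / (n * h n)) (by positivity) fun j => ?_)
      (ENNReal.ofReal_le_ofReal (by rwa [← mul_div_assoc]))
    refine (measure_mono fun ω hω => ?_).trans
      (hdev (c / 2) (s n j) (t n j) n hn1 j (by positivity) (hs n hn1 j) (ht n hn1 j))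
    simp only [Set.mem_ofPred_eq] at hω ⊢
    push Not at hω
    obtain ⟨hjH, hlt⟩ := hω
    have := mul_le_mul_of_nonneg_left (hst n hn1 j hjH) hn0.le
    rw [abs_sub_comm]
    refine lt_of_lt_of_le ?_ (le_abs_self _)
    linarith
  have hside_le : ∀ (s t : ℕ → ℝ), (∀ n, 1 ≤ n → τ₀ - h n ≤ s n) →
      (∀ n, 1 ≤ n → t n ≤ τ₀ + h n) → ∀ᶠ n : ℕ in atTop, μ {ω | ¬ ∑ k ∈ Finset.range n,
        (thr (X (k + 1) ω) - τ₀) ^ 2 * slab (s n) (t n) (X (k + 1) ω) ≤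
          2 * C * n * h n ^ 3} ≤ ENNReal.ofReal δ := by
    intro s t hs ht
    filter_upwards [eventually_const_div_le hlim
      ((1 + 2 * rhoSum μ X U) * C / C ^ 2) hδ0, eventually_ge_atTop 1] with n hn hn1
    have hn0 : (0 : ℝ) < n := by exact_mod_cast hn1
    have hhn := hh n hn1
    have hd := hdev C (s n) (t n) n hn1 0 hC0 (by simpa using hs n hn1) (by simpa using ht n hn1)
    simp only [pow_zero, one_mul, div_one] at hd
    refine (measure_mono fun ω hω => ?_).trans (hd.trans (ENNReal.ofReal_le_ofReal hn))
    simp only [Set.mem_ofPred_eq, not_le] at hω ⊢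
    have hmean : slabMass (margin μ X U) (kinkSq τ₀) (s n) (t n) ≤ h n ^ 2 * (C * h n) :=
      (slabMass_kinkSq_le h1 (hs n hn1) (ht n hn1)).trans (mul_le_mul_of_nonneg_left
        (((slabMass_one_mono h1 (hs n hn1) (ht n hn1)).trans (slabMass_one_le h1 _ _)).trans
          (hmass _ hhn.le)) (sq_nonneg _))
    have := mul_le_mul_of_nonneg_left hmean hn0.le
    refine lt_of_lt_of_le ?_ (le_abs_self _)
    linarith
  have b3 : ∀ᶠ n : ℕ in atTop, μ {ω | ¬ ∑ k ∈ Finset.range n, ‖X (k + 1) ω‖ ^ 2 ≤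
      (M₂ + 1) * n} ≤ ENNReal.ofReal δ := by
    filter_upwards [eventually_const_div_le tendsto_natCast_atTop_atTop
      ((1 + 2 * rhoSum μ X U) * ∫ z : Regr p × ℝ, (‖z.1‖ ^ 2) ^ 2 ∂(margin μ X U)) hδ0] with n hn
    have hd := h1.meas_sum_pair_deviation_le hsqm hsqL n one_pos
    rw [one_pow, one_mul] at hd
    refine (measure_mono fun ω hω => ?_).trans (hd.trans (ENNReal.ofReal_le_ofReal hn))
    simp only [Set.mem_ofPred_eq, not_le] at hω ⊢
    refine lt_of_lt_of_le ?_ (le_abs_self _)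
    linarith
  have hfix : ∀ ψ : Fin (p + 2) → Regr p → ℝ, (∀ a, Measurable (ψ a)) →
      (∀ a x, |ψ a x| ≤ ‖x‖) → ∀ n : ℕ, 1 ≤ n →
      μ {ω | ¬ ∀ a, |∑ k ∈ Finset.range n, U (k + 1) ω * ψ a (X (k + 1) ω)| ≤ lam * √n} ≤
        ENNReal.ofReal δ := by
    intro ψ hψm hψ n hn
    refine le_trans (meas_not_forall_fin_le (K := Cn / lam ^ 2) fun a => ?_) ?_
    · refine (measure_mono fun ω hω => ?_).trans (hnoise (ψ a) (hψm a) (hψ a) n lam hn hlam1)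
      simp only [Set.mem_ofPred_eq, not_le] at hω ⊢
      exact hω
    · rw [← mul_div_assoc]
      refine hKle _ ?_
      rw [hK, mul_add]
      have : 0 ≤ ((p + 2 : ℕ) : ℝ) * (2 * Cs) := by positivity
      linarith
  have b1 := hform (min_le_left _ _) hlow δ hδ0
  have b2 := hform (min_le_right _ _) hupp δ hδ0
  have b8 := hside (fun _ _ => τ₀) (fun n j => τ₀ + 2 ^ j * h n)
    (fun n hn j => by have := hh n hn; have : 0 < 2 ^ j * h n := by positivity
                      linarith) (fun n hn j => le_rfl)
    (fun n hn j hj => (hkink _ (by have := hh n hn; positivity) hj).1)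
  have b9 := hside (fun n j => τ₀ - 2 ^ j * h n) (fun _ _ => τ₀) (fun n hn j => le_rfl)
    (fun n hn j => by have := hh n hn; have : 0 < 2 ^ j * h n := by positivity
                      linarith)
    (fun n hn j hj => (hkink _ (by have := hh n hn; positivity) hj).2)
  have b10 := hside_le (fun _ => τ₀) (fun n => τ₀ + h n)
    (fun n hn => by have := hh n hn; linarith) (fun n hn => le_rfl)
  have b11 := hside_le (fun n => τ₀ - h n) (fun _ => τ₀) (fun n hn => le_rfl)
    (fun n hn => by have := hh n hn; linarith)
  filter_upwards [b1, b2, b3, b8, b9, b10, b11, eventually_ge_atTop 1]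
    with n b1 b2 b3 b8 b9 b10 b11 hn
  have b4 := hfix (fun a x => x a) (fun a => by fun_prop) (fun a x => abs_coord_le a x) n hn
  have b5 := hfix (fun a x => x a * above τ₀ x)
    (fun a => Measurable.mul (by fun_prop) (measurable_above τ₀))
    (fun a x => by
      rw [abs_mul]
      exact (mul_le_of_le_one_right (abs_nonneg _) (abs_above_le _ _)).trans (abs_coord_le a x))
    n hn
  have b6 : μ {ω | ¬ ∀ j : ℕ, ∀ a : Fin (p + 2),
      ∀ τ ∈ Set.Icc (τ₀ - 2 ^ j * h n) (τ₀ + 2 ^ j * h n),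
        |∑ k ∈ Finset.range n, U (k + 1) ω * (X (k + 1) ω a *
          slab (τ₀ - 2 ^ j * h n) τ (X (k + 1) ω))| ≤ lam * 2 ^ j * √(n * (2 * C * h n))} ≤
      ENNReal.ofReal δ := by
    refine le_trans (meas_not_forall_nat_le (K := (p + 2 : ℕ) * (Cs / lam ^ 2)) (by positivity)
      fun j => ?_) ?_
    · refine le_trans (meas_not_forall_fin_le (K := Cs / lam ^ 2 / 2 ^ j)
        fun a => hscale n hn j (fun x => x a) (by fun_prop) (abs_coord_le a)) ?_
      rw [← mul_div_assoc]
    · have e : 2 * (((p + 2 : ℕ) : ℝ) * (Cs / lam ^ 2)) =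
          ((p + 2 : ℕ) : ℝ) * (2 * Cs) / lam ^ 2 := by ring
      rw [e]
      refine hKle _ ?_
      rw [hK, mul_add]
      have : 0 ≤ ((p + 2 : ℕ) : ℝ) * Cn := by positivity
      linarith
  have b7 : μ {ω | ¬ ∀ j : ℕ, ∀ τ ∈ Set.Icc (τ₀ - 2 ^ j * h n) (τ₀ + 2 ^ j * h n),
        |∑ k ∈ Finset.range n, U (k + 1) ω * (kink τ₀ (2 ^ j * h n) (X (k + 1) ω) *
          slab (τ₀ - 2 ^ j * h n) τ (X (k + 1) ω))| ≤ lam * 2 ^ j * √(n * (2 * C * h n))} ≤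
      ENNReal.ofReal δ := by
    refine le_trans (meas_not_forall_nat_le (K := Cs / lam ^ 2) (by positivity)
      fun j => hscale n hn j _ (measurable_kink τ₀ (2 ^ j * h n)) (abs_kink_le _ _)) ?_
    rw [← mul_div_assoc]
    refine hKle _ ?_
    have : 0 ≤ ((p + 2 : ℕ) : ℝ) * (Cn + 2 * Cs) := by positivity
    linarith
  have h11 := meas_not_and_le hδ0.le (by positivity) b1 (meas_not_and_le hδ0.le (by positivity) b2
    (meas_not_and_le hδ0.le (by positivity) b3 (meas_not_and_le hδ0.le (by positivity) b4
    (meas_not_and_le hδ0.le (by positivity) b5 (meas_not_and_le hδ0.le (by positivity) b6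
    (meas_not_and_le hδ0.le (by positivity) b7 (meas_not_and_le hδ0.le (by positivity) b8
    (meas_not_and_le hδ0.le (by positivity) b9 (meas_not_and_le hδ0.le hδ0.le b10 b11)))))))))
  have e11 : δ + (δ + (δ + (δ + (δ + (δ + (δ + (δ + (δ + (δ + δ))))))))) = ε := by
    rw [hδ]; ring
  rw [e11] at h11
  refine (measure_mono fun ω hω => ?_).trans h11
  rintro ⟨g1, g2, g3, g4, g5, g6, g7, g8, g9, g10, g11⟩
  exact hω ⟨g1, g2, g3, g4, g5, g6, g7, g8, g9, g10, g11⟩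

end GoodProbability

/-! ### The two estimators and the basic inequality -/

section Estimator

variable {p : ℕ} {Λ : Set (Coef p)} {T : Set ℝ} {n : ℕ} {x : ℤ → Regr p} {y : ℤ → ℝ}
  {u : ℤ → ℝ} {α α₀ : Coef p} {τ τ₀ l r h H lam c₁ C₂ c₀ C κ κ₀ : ℝ}

/-- Profiling loses nothing: the two-step solution minimizes jointly over `Λ` and the grid. -/
theorem IsTwoStepLSE.objective_le (hest : IsTwoStepLSE Λ T n x y α τ) (hα₀ : α₀ ∈ Λ) {t : ℝ}
    (ht : t ∈ grid T n x) : objective n x y α τ ≤ objective n x y α₀ t := by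
  obtain ⟨a, ha, -, hmin, rfl⟩ := hest
  exact (hmin t ht).trans ((ha t ht).2 α₀ hα₀)

theorem IsTwoStepLSE.mem (hest : IsTwoStepLSE Λ T n x y α τ) : τ ∈ T := by
  obtain ⟨a, -, hτ, -⟩ := hest
  exact hτ.1

/-- A two-sided path whose part at positive times is a good sample. -/
abbrev GoodPath (x : ℤ → Regr p) (u : ℤ → ℝ) (n : ℕ) (τ₀ l r h H lam c₁ C₂ c₀ C : ℝ) : Prop :=
  GoodSample (fun k => x (k + 1)) (fun k => u (k + 1)) n τ₀ l r h H lam c₁ C₂ c₀ C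

theorem GoodSample.exists_mem_grid (hg : GoodPath x u n τ₀ l r h H lam c₁ C₂ c₀ C) (hn : 1 ≤ n)
    (hc₀ : 0 < c₀) (hh : 0 < h) (hhH : h ≤ H)
    (hT : Set.Icc τ₀ (τ₀ + h) ⊆ T ∨ Set.Icc (τ₀ - h) τ₀ ⊆ T) :
    ∃ t ∈ grid T n x, |t - τ₀| ≤ h := by
  obtain ⟨⟨k, hk, hk'⟩, ⟨j, hj, hj'⟩⟩ := hg.exists_mem_slab hn hc₀ hh hhH
  rcases hT with hT | hT
  · refine ⟨thr (x (k + 1)), ⟨hT ⟨hk'.1.le, hk'.2⟩, k + 1, by omega, by omega, rfl⟩, ?_⟩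
    exact abs_le.2 ⟨by linarith [hk'.1], by linarith [hk'.2]⟩
  · refine ⟨thr (x (j + 1)), ⟨hT ⟨hj'.1.le, hj'.2⟩, j + 1, by omega, by omega, rfl⟩, ?_⟩
    exact abs_le.2 ⟨by linarith [hj'.1], by linarith [hj'.2]⟩

/-- `τ₀` need not lie in the grid, so the estimator is compared with `α₀` at a grid point within `h`
of `τ₀`. The price is the gap with zero slope errors, bounded by `gap_le`. -/
theorem GoodSample.twoStep_le (hg : GoodPath x u n τ₀ l r h H lam c₁ C₂ c₀ C)
    (hx : ∀ i, x i 0 = 1) (hn : 1 ≤ n) (hc₀ : 0 < c₀) (hC : 0 < C) (hh : 0 < h) (hhH : h ≤ H)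
    (hκ₀ : 0 < κ₀) (hκ : n * κ ^ 2 * h ^ 3 = κ₀ ^ 2)
    (hkink : ∀ i, inner ℝ (x i) (secondHalf α₀) = κ * (thr (x i) - τ₀))
    (hy : ∀ i, y i = response α₀ τ₀ (x i) (u i))
    (hT : Set.Icc τ₀ (τ₀ + h) ⊆ T ∨ Set.Icc (τ₀ - h) τ₀ ⊆ T) (hα₀ : α₀ ∈ Λ)
    (hest : (grid T n x).Nonempty → IsTwoStepLSE Λ T n x y α τ) :
    τ ∈ T ∧ n * (objective n x y α τ - objective n x y α₀ τ₀) ≤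
      2 * C * κ₀ ^ 2 + 4 * lam * √C * κ₀ := by
  obtain ⟨t, ht, htτ⟩ := hg.exists_mem_grid hn hc₀ hh hhH hT
  have hest' := hest ⟨t, ht⟩
  refine ⟨hest'.mem, ?_⟩
  have hgap := hg.gap_le (fun k => hx (k + 1)) hC hκ₀ hh hκ htτ
  have hobj := mul_objective_sub (τ := t) (α := α₀) hn hkink hy
  have e1 : firstHalf (α₀ - α₀) = 0 := by rw [sub_self]; ext j; rfl
  have e2 : secondHalf (α₀ - α₀) = 0 := by rw [sub_self]; ext j; rfl
  rw [e1, e2] at hobj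
  rw [← hobj] at hgap
  refine le_trans (mul_le_mul_of_nonneg_left ?_ (Nat.cast_nonneg n)) hgap
  exact sub_le_sub_right (hest'.objective_le hα₀ ht) _

theorem IsLSE.mul_sub_nonpos (hest : IsLSE Λ T n x y α τ) (hα₀ : α₀ ∈ Λ) (hτ₀ : τ₀ ∈ T) :
    n * (objective n x y α τ - objective n x y α₀ τ₀) ≤ 0 :=
  mul_nonpos_of_nonneg_of_nonpos (Nat.cast_nonneg n)
    (sub_nonpos.2 (hest.2.2 α₀ hα₀ τ₀ hτ₀))

theorem exists_Icc_subset_of_mem_nhds (hT : T ∈ 𝓝[≥] τ₀ ∨ T ∈ 𝓝[≤] τ₀) :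
    ∃ δ > 0, ∀ h ≤ δ, Set.Icc τ₀ (τ₀ + h) ⊆ T ∨ Set.Icc (τ₀ - h) τ₀ ⊆ T := by
  rcases hT with hT | hT
  · obtain ⟨v, hv, hv'⟩ := mem_nhdsGE_iff_exists_Icc_subset.1 hT
    have hv : τ₀ < v := hv
    exact ⟨v - τ₀, sub_pos.2 hv, fun h hh =>
      Or.inl ((Set.Icc_subset_Icc_right (by linarith)).trans hv')⟩
  · obtain ⟨v, hv, hv'⟩ := mem_nhdsLE_iff_exists_Icc_subset.1 hT
    have hv : v < τ₀ := hv
    exact ⟨τ₀ - v, sub_pos.2 hv, fun h hh =>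
      Or.inr ((Set.Icc_subset_Icc_left (by linarith)).trans hv')⟩

/-- By the restriction the `X₂` part drops out and the intercept is `-τ₀` times the coefficient of
`Q`. -/
theorem inner_effect {x : Regr p} (hx : x 0 = 1) {d₀ : Regr p} {φ : ℝ}
    (hd : ContinuityRestriction d₀ τ₀) (b : Regr p) (n : ℕ) :
    inner ℝ x (secondHalf (stack b (effect d₀ φ n))) =
      (n : ℝ) ^ (-φ) * thr d₀ * (thr x - τ₀) := by
  obtain ⟨-, h1, h2⟩ := hd
  have : secondHalf (stack b (effect d₀ φ n)) = (n : ℝ) ^ (-φ) • d₀ := rfl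
  rw [this, inner_smul_right, inner_regr_split, hx]
  simp only [h2, zero_mul, Finset.sum_const_zero]
  linear_combination (n : ℝ) ^ (-φ) * h1

end Estimator

/-! ### Exponents of the threshold rate -/

section Rates

variable {φ : ℝ} {n : ℕ}

theorem rate_pos (φ : ℝ) (hn : 1 ≤ n) : 0 < (n : ℝ) ^ ((2 * φ - 1) / 3) :=
  Real.rpow_pos_of_pos (by exact_mod_cast hn) _

theorem rate_cube (φ : ℝ) (hn : 1 ≤ n) :
    (n : ℝ) * ((n : ℝ) ^ ((2 * φ - 1) / 3)) ^ 3 = (n : ℝ) ^ (2 * φ) := by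
  have hn0 : (0 : ℝ) < n := by exact_mod_cast hn
  rw [← Real.rpow_natCast, ← Real.rpow_mul hn0.le]
  nth_rewrite 1 [← Real.rpow_one (n : ℝ)]
  rw [← Real.rpow_add hn0]
  congr 1
  push_cast
  ring

/-- This equation determines the rate `h`: at distance `h` from `τ₀` the signal `n κ² h³` is of
constant order. -/
theorem rate_balance (φ c : ℝ) (hn : 1 ≤ n) :
    n * ((n : ℝ) ^ (-φ) * c) ^ 2 * ((n : ℝ) ^ ((2 * φ - 1) / 3)) ^ 3 = |c| ^ 2 := by
  have hn0 : (0 : ℝ) < n := by exact_mod_cast hn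
  have h1 := rate_cube φ hn
  have h2 : ((n : ℝ) ^ (-φ)) ^ 2 * (n : ℝ) ^ (2 * φ) = 1 := by
    rw [← Real.rpow_natCast, ← Real.rpow_mul hn0.le, ← Real.rpow_add hn0]
    rw [← Real.rpow_zero (n : ℝ)]
    congr 1
    push_cast
    ring
  rw [sq_abs]
  linear_combination ((n : ℝ) ^ (-φ)) ^ 2 * c ^ 2 * h1 + c ^ 2 * h2

theorem tendsto_mul_rate (hφ : 0 ≤ φ) :
    Tendsto (fun n : ℕ => (n : ℝ) * (n : ℝ) ^ ((2 * φ - 1) / 3)) atTop atTop := by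
  have h := (tendsto_rpow_atTop (y := (2 + 2 * φ) / 3) (by linarith)).comp
    tendsto_natCast_atTop_atTop
  refine h.congr' ?_
  filter_upwards [eventually_ge_atTop 1] with n hn
  have hn0 : (0 : ℝ) < n := by exact_mod_cast hn
  simp only [Function.comp]
  nth_rewrite 2 [← Real.rpow_one (n : ℝ)]
  rw [← Real.rpow_add hn0]
  congr 1
  ring

theorem tendsto_rate (hφ : φ < 1 / 2) :
    Tendsto (fun n : ℕ => (n : ℝ) ^ ((2 * φ - 1) / 3)) atTop (𝓝 0) := by
  have h := (tendsto_rpow_neg_atTop (y := (1 - 2 * φ) / 3) (by linarith)).comp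
    tendsto_natCast_atTop_atTop
  refine h.congr fun n => ?_
  simp only [Function.comp]
  congr 1
  ring

end Rates

/-- Both rates hold on the same event, so they are derived together. The event concerns the sample
alone, and its complement is measured as an outer measure; no measurability of the estimators is
required. -/
theorem exists_error_bounds {Ω : Type*} [MeasurableSpace Ω] {μ : Measure Ω}
    [IsProbabilityMeasure μ] {p : ℕ} {X : ℤ → Ω → Regr p} {U : ℤ → Ω → ℝ}
    (hX : ∀ i ω, X i ω 0 = 1) {Λ : Set (Coef p)} {T : Set ℝ} (hT : IsCompact T)
    {β₀ d₀ : Regr p} {τ₀ φ : ℝ} (hφ₀ : 0 ≤ φ) (hφ₁ : φ < 1 / 2)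
    {α₀ : ℕ → Coef p} (hα₀ : ∀ n, α₀ n = stack β₀ (effect d₀ φ n))
    (hα₀Λ : ∀ n, 1 ≤ n → α₀ n ∈ Λ) (hτ₀ : τ₀ ∈ T) (hd : ContinuityRestriction d₀ τ₀)
    (h1 : DataAssumption μ X U τ₀) (h2 : ThresholdAssumption μ X U T τ₀)
    {Y : ℕ → ℤ → Ω → ℝ} (hY : ∀ n i ω, Y n i ω = response (α₀ n) τ₀ (X i ω) (U i ω))
    {αhat : ℕ → Ω → Coef p} {τhat : ℕ → Ω → ℝ}
    (hhat :
      (∀ n, 1 ≤ n → ∀ᵐ ω ∂μ, IsLSE Λ T n (fun i => X i ω) (fun i => Y n i ω)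
        (αhat n ω) (τhat n ω)) ∨
      ((T ∈ 𝓝[≥] τ₀ ∨ T ∈ 𝓝[≤] τ₀) ∧
        ∀ n, 1 ≤ n → ∀ᵐ ω ∂μ, (grid T n (fun i => X i ω)).Nonempty →
          IsTwoStepLSE Λ T n (fun i => X i ω) (fun i => Y n i ω) (αhat n ω) (τhat n ω)))
    {ε : ℝ} (hε : 0 < ε) :
    ∃ Z S : ℝ, ∀ᶠ n : ℕ in atTop, ∃ G : Set Ω, μ Gᶜ ≤ ENNReal.ofReal ε ∧
      ∀ᵐ ω ∂μ, ω ∈ G → |τhat n ω - τ₀| ≤ Z * (n : ℝ) ^ ((2 * φ - 1) / 3) ∧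
        n * ‖αhat n ω - α₀ n‖ ^ 2 ≤ S := by
  obtain ⟨l, hl⟩ := hT.exists_isLeast ⟨τ₀, hτ₀⟩
  obtain ⟨r, hr⟩ := hT.exists_isGreatest ⟨τ₀, hτ₀⟩
  have hIcc : T ⊆ Set.Icc l r := fun t ht => ⟨hl.2 ht, hr.2 ht⟩
  have hlr : l ≤ r := hl.2 hr.1
  -- All distances inside `T` are at most `r - l`; the added 1 keeps the bound positive when `T` is
  -- a single point.
  have hH : 0 < r - l + 1 := by linarith
  obtain ⟨c₁, C₂, c₀, C, hc₁, hC₂, hc₀, hC, hgood⟩ :=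
    exists_meas_not_goodSample_le h1 hX h2 hτ₀ hl.1 hr.1 hH (fun n hn => rate_pos φ hn)
      (fun n hn => (rate_cube φ hn).symm ▸
        Real.one_le_rpow (by exact_mod_cast hn) (by linarith)) (tendsto_mul_rate hφ₀)
  obtain ⟨lam, hlam, hev⟩ := hgood ε hε
  have hκ₀ : 0 < |thr d₀| := abs_pos.2 hd.1
  have hA : 0 ≤ 2 * C * |thr d₀| ^ 2 + 4 * lam * √C * |thr d₀| := by positivity
  obtain ⟨Z, S, hZS⟩ := exists_rate_constants (τ₀ := τ₀) (l := l) (r := r) hc₁ hc₀ hC hC₂ hκ₀ hH.le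
    hlam hA p
  have hnear : ∀ᶠ n : ℕ in atTop, 1 ≤ n ∧ ∀ᵐ ω ∂μ,
      GoodPath (fun i => X i ω) (fun i => U i ω) n τ₀ l r ((n : ℝ) ^ ((2 * φ - 1) / 3))
        (r - l + 1) lam c₁ C₂ c₀ C →
      τhat n ω ∈ T ∧ n * (objective n (fun i => X i ω) (fun i => Y n i ω) (αhat n ω) (τhat n ω) -
        objective n (fun i => X i ω) (fun i => Y n i ω) (α₀ n) τ₀) ≤
        2 * C * |thr d₀| ^ 2 + 4 * lam * √C * |thr d₀| := by
    rcases hhat with hhat | ⟨hTn, hhat⟩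
    · filter_upwards [eventually_ge_atTop 1] with n hn
      refine ⟨hn, ?_⟩
      filter_upwards [hhat n hn] with ω hω _
      exact ⟨hω.2.1, (hω.mul_sub_nonpos (hα₀Λ n hn) hτ₀).trans hA⟩
    · obtain ⟨δ, hδ, hsub⟩ := exists_Icc_subset_of_mem_nhds hTn
      filter_upwards [eventually_ge_atTop 1, (tendsto_rate hφ₁).eventually_le_const hδ,
        (tendsto_rate hφ₁).eventually_le_const hH] with n hn hn1 hn2
      refine ⟨hn, ?_⟩
      filter_upwards [hhat n hn] with ω hω hg
      exact hg.twoStep_le (κ := (n : ℝ) ^ (-φ) * thr d₀) (fun i => hX i ω) hn hc₀ hC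
        (rate_pos φ hn) hn2 hκ₀ (rate_balance φ _ hn)
        (fun i => by rw [hα₀]; exact inner_effect (hX i ω) hd β₀ n) (fun i => hY n i ω)
        (hsub _ hn1) (hα₀Λ n hn) hω
  refine ⟨Z, S, ?_⟩
  filter_upwards [hev, hnear] with n hn ⟨hn1, hae⟩
  refine ⟨{ω | GoodPath (fun i => X i ω) (fun i => U i ω) n τ₀ l r
    ((n : ℝ) ^ ((2 * φ - 1) / 3)) (r - l + 1) lam c₁ C₂ c₀ C}, hn, ?_⟩
  filter_upwards [hae] with ω hω hg
  obtain ⟨hτT, hle⟩ := hω hg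
  rw [mul_objective_sub (κ := (n : ℝ) ^ (-φ) * thr d₀) hn1
    (fun i => by rw [hα₀]; exact inner_effect (hX i ω) hd β₀ n) (fun i => hY n i ω)] at hle
  have hτI := hIcc hτT
  have hτ₀I := hIcc hτ₀
  rw [norm_sq_coef]
  refine hZS _ _ n _ _ _ _ _ hg (fun k => hX (k + 1) ω) hn1 (rate_pos φ hn1) ?_
    (rate_balance φ _ hn1) hτI hτ₀I ?_ hle
  · exact Real.rpow_le_one_of_one_le_of_nonpos (by exact_mod_cast hn1) (by linarith)
  · exact abs_le.2 ⟨by linarith [hτI.1, hτ₀I.2], by linarith [hτI.2, hτ₀I.1]⟩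

end KinkThreshold

theorem proposition1 {Ω : Type*} [MeasurableSpace Ω] (μ : Measure Ω) [IsProbabilityMeasure μ]
    (p : ℕ) (X : ℤ → Ω → KinkThreshold.Regr p) (U : ℤ → Ω → ℝ)
    (hX : ∀ i ω, X i ω 0 = 1)
    (Λ : Set (KinkThreshold.Coef p)) (T : Set ℝ) (hΛ : IsCompact Λ) (hT : IsCompact T)
    (β₀ d₀ : KinkThreshold.Regr p) (τ₀ φ : ℝ) (hφ₀ : 0 ≤ φ) (hφ₁ : φ < 1 / 2) (hd₀ : d₀ ≠ 0)
    (α₀ : ℕ → KinkThreshold.Coef p)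
    (hα₀ : ∀ n, α₀ n = KinkThreshold.stack β₀ (KinkThreshold.effect d₀ φ n))
    (hα₀Λ : ∀ n, 1 ≤ n → α₀ n ∈ Λ) (hτ₀ : τ₀ ∈ T)
    (hC : ∀ n, 1 ≤ n →
      KinkThreshold.ContinuityRestriction (KinkThreshold.effect d₀ φ n) τ₀)
    (h1 : KinkThreshold.DataAssumption μ X U τ₀)
    (h2 : KinkThreshold.ThresholdAssumption μ X U T τ₀)
    (Y : ℕ → ℤ → Ω → ℝ)
    (hY : ∀ n i ω, Y n i ω = KinkThreshold.response (α₀ n) τ₀ (X i ω) (U i ω))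
    (αhat : ℕ → Ω → KinkThreshold.Coef p) (τhat : ℕ → Ω → ℝ)
    (hhat :
      (∀ n, 1 ≤ n → ∀ᵐ ω ∂μ, KinkThreshold.IsLSE Λ T n (fun i => X i ω) (fun i => Y n i ω)
        (αhat n ω) (τhat n ω)) ∨
      ((T ∈ 𝓝[≥] τ₀ ∨ T ∈ 𝓝[≤] τ₀) ∧
        ∀ n, 1 ≤ n → ∀ᵐ ω ∂μ, (KinkThreshold.grid T n (fun i => X i ω)).Nonempty →
          KinkThreshold.IsTwoStepLSE Λ T n (fun i => X i ω) (fun i => Y n i ω)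
            (αhat n ω) (τhat n ω))) :
    KinkThreshold.IsBigOP μ (fun n ω => αhat n ω - α₀ n) (fun n => (n : ℝ) ^ (-(1 / 2) : ℝ)) ∧
    KinkThreshold.IsBigOP μ (fun n ω => τhat n ω - τ₀) (fun n => (n : ℝ) ^ ((2 * φ - 1) / 3)) := by
  -- At `n = 1` the factor `n^(-φ)` equals 1.
  have hd : KinkThreshold.ContinuityRestriction d₀ τ₀ := by
    simpa [KinkThreshold.effect] using hC 1 le_rfl
  constructor
  · intro ε hε
    obtain ⟨Z, S, h⟩ := KinkThreshold.exists_error_bounds hX hT hφ₀ hφ₁ hα₀ hα₀Λ hτ₀ hd h1 h2 hY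
      hhat hε
    refine ⟨√S, ?_⟩
    filter_upwards [h, eventually_ge_atTop 1] with n ⟨G, hG, hae⟩ hn
    refine (measure_mono_ae ?_).trans hG
    filter_upwards [hae] with ω hω hlt hmem
    have hn0 : (0 : ℝ) < n := by exact_mod_cast hn
    have hS := (hω hmem).2
    refine absurd hlt (not_lt.2 ?_)
    rw [Real.rpow_neg hn0.le, ← Real.sqrt_eq_rpow, ← div_eq_mul_inv, le_div_iff₀ (by positivity)]
    refine Real.le_sqrt_of_sq_le ?_
    rw [mul_pow, Real.sq_sqrt hn0.le, mul_comm]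
    exact hS
  · intro ε hε
    obtain ⟨Z, S, h⟩ := KinkThreshold.exists_error_bounds hX hT hφ₀ hφ₁ hα₀ hα₀Λ hτ₀ hd h1 h2 hY
      hhat hε
    refine ⟨Z, ?_⟩
    filter_upwards [h] with n ⟨G, hG, hae⟩
    refine (measure_mono_ae ?_).trans hG
    filter_upwards [hae] with ω hω hlt hmem
    exact absurd hlt (not_lt.2 (hω hmem).1)
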